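/- Let $\mathcal C$ be a symmetric monoidal category with unit object $\mathbb 1$ such that (0) $\mathcal C$ has all equalizers and coequalizers; (1) the monoidal structure is bistable, i.e. the functors sending a left or right action $(A,\alpha,X)$ of a bimonoid to its stabilized object (the coequalizer of $\alpha$ and the trivial action), and a left or right coaction to its stabilized object (the equalizer of the coaction and the trivial coaction), are strong monoidal; (2) the category $\mathsf{Hopf}^{bc}(\mathcal C)$ of bicommutative Hopf monoids in $\mathcal C$ and bimonoid homomorphisms is abelian. Kernels, cokernels, monomorphisms and epimorphisms are taken in $\mathsf{Hopf}^{bc}(\mathcal C)$. An invariant object of a left action $(A,\alpha,X)$ is a universal morphism $i:Z\to X$ with $\alpha\circ(\mathrm{id}_A\otimes i)=i\circ\tau$, where $\tau$ is the trivial action; invariant objects of right actions are defined likewise, and those of coactions dually. A bimonoid is small if for each of its left and right actions the invariant object and the stabilized object exist and the canonical morphism from the former to the latter is an isomorphism; it is cosmall if the dual condition holds for coactions, and bismall if both hold. If a bimonoid $A$ has a normalized two-sided integral $\sigma_A:\mathbb 1\to A$ and a normalized two-sided cointegral $\sigma^A:A\to\mathbb 1$ (these are unique), put $vol^{-1}(A)=\sigma^A\circ\sigma_A\in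 \mathrm{End}(\mathbb 1)$; $A$ has finite volume if moreover $vol^{-1}(A)$ is invertible. A homomorphism $\xi:A\to B$ of bicommutative Hopf monoids is Fredholm if $Ker(\xi)$ and $Cok(\xi)$ are bismall and have finite volume. A morphism $\mu:B\to A$ in $\mathcal C$ is a right integral along $\xi$ if $\nabla_A(\mu\otimes \mathrm{id}_A)=\mu\nabla_B(\mathrm{id}_B\otimes\xi)$ and $(\mu\otimes \mathrm{id}_B)\Delta_B=(\mathrm{id}_A\otimes\xi)\Delta_A\mu$; a left integral if $\nabla_A(\mathrm{id}_A\otimes \mu)=\mu\nabla_B(\xi\otimes\mathrm{id}_B)$ and $(\mathrm{id}_B\otimes\mu)\Delta_B=(\xi\otimes \mathrm{id}_A)\Delta_A\mu$; an integral if both. It is normalized if $\xi\mu\xi=\xi$, and a generator if $\mu\xi\mu'=\mu'=\mu'\xi\mu$ for every left or right integral $\mu'$ along $\xi$. For a Fredholm $\xi:A\to B$ let $\mu_\xi=\tilde\mu_{coim(\xi)}\circ\bar\xi^{-1}\circ\tilde\mu_{im(\xi)}:B\to A$, where $\bar\xi:Coim(\xi)\to Im(\xi)$ is the canonical isomorphism;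 $\tilde\mu_{coim(\xi)}$ is $i\circ(coim(\xi)\circ i)^{-1}$ for an invariant object $i$ of the left action of $Ker(\xi)$ on $A$ by multiplication through $ker(\xi)$; and dually $\tilde\mu_{im(\xi)}$ is $(q\circ im(\xi))^{-1}\circ q$ for an invariant object $q$ of the right coaction $(\mathrm{id}_B\otimes cok(\xi))\circ\Delta_B$ of $Cok(\xi)$ on $B$. Let $\upsilon_0(\xi)=vol^{-1}(Ker(\xi))$ and $\upsilon_1(\xi)=vol^{-1}(Cok(\xi))$, and for $\upsilon\in\{\upsilon_0,\upsilon_1\}$ put $\xi_!=\upsilon(\xi)^{-1}\cdot\mu_\xi:B\to A$, where $\cdot$ is the action of $\mathrm{End}(\mathbb 1)$ on morphisms of $\mathcal C$ by tensoring. Then: (a) For every Fredholm $\xi$, $\mu_\xi$ is the unique normalized generator integral along $\xi$. (b) If $\xi:A\to B$ and $\xi':B\to D$ are Fredholm, then $\xi'\circ\xi$ is Fredholm and $(\xi'\circ\xi)_!=\xi_!\circ\xi'_!$, both for $\upsilon=\upsilon_0$ and for $\upsilon=\upsilon_1$. (c) Consider a commutative square $\psi'\circ\varphi=\psi\circ\varphi'$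 of homomorphisms of bicommutative Hopf monoids, $\varphi:A\to B$, $\varphi':A\to D$, $\psi:D\to E$, $\psi':B\to E$, with $\varphi$ and $\psi$ Fredholm. If the induced homomorphism $Ker(\varphi)\to Ker(\psi)$ is an isomorphism and the induced homomorphism $Cok(\varphi)\to Cok(\psi)$ is a monomorphism, then $\varphi'\circ\varphi_!=\psi_!\circ\psi'$ for $\upsilon=\upsilon_0$. If $Ker(\varphi)\to Ker(\psi)$ is an epimorphism and $Cok(\varphi)\to Cok(\psi)$ is an isomorphism, then $\varphi'\circ\varphi_!=\psi_!\circ\psi'$ for $\upsilon=\upsilon_1$. -/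

import Mathlib

universe v u

open CategoryTheory MonoidalCategory Limits

namespace HopfIntegral

open scoped MonObj ComonObj

noncomputable section

/-! ### Actions, coactions, invariant and stabilized objects -/

section Actions

variable {C : Type u} [Category.{v} C] [MonoidalCategory C]

/-- `α : A ⊗ X ⟶ X` is a left action of the monoid `A` on `X`. -/
structure IsLeftAction (A : C) [MonObj A] (X : C) (α : A ⊗ X ⟶ X) : Prop where
  assoc : μ[A] ▷ X ≫ α = (α_ A A X).hom ≫ A ◁ α ≫ α
  unit : η[A] ▷ X ≫ α = (λ_ X).hom

/-- `α : X ⊗ A ⟶ X` is a right action of the monoid `A` on `X`. -/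
structure IsRightAction (A : C) [MonObj A] (X : C) (α : X ⊗ A ⟶ X) : Prop where
  assoc : X ◁ μ[A] ≫ α = (α_ X A A).inv ≫ α ▷ A ≫ α
  unit : X ◁ η[A] ≫ α = (ρ_ X).hom

/-- `β : Y ⟶ B ⊗ Y` is a left coaction of the comonoid `B` on `Y`. -/
structure IsLeftCoaction (B : C) [ComonObj B] (Y : C) (β : Y ⟶ B ⊗ Y) : Prop where
  coassoc : β ≫ Δ[B] ▷ Y = β ≫ B ◁ β ≫ (α_ B B Y).inv
  counit : β ≫ ε[B] ▷ Y = (λ_ Y).inv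

/-- `β : Y ⟶ Y ⊗ B` is a right coaction of the comonoid `B` on `Y`. -/
structure IsRightCoaction (B : C) [ComonObj B] (Y : C) (β : Y ⟶ Y ⊗ B) : Prop where
  coassoc : β ≫ Y ◁ Δ[B] = β ≫ β ▷ B ≫ (α_ Y B B).hom
  counit : β ≫ Y ◁ ε[B] = (ρ_ Y).inv

/-- The trivial left action. -/
def trivLeftAction (A : C) [ComonObj A] (X : C) : A ⊗ X ⟶ X := ε[A] ▷ X ≫ (λ_ X).hom

/-- The trivial right action. -/
def trivRightAction (A : C) [ComonObj A] (X : C) : X ⊗ A ⟶ X := X ◁ ε[A] ≫ (ρ_ X).hom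

/-- The trivial left coaction. -/
def trivLeftCoaction (B : C) [MonObj B] (Y : C) : Y ⟶ B ⊗ Y := (λ_ Y).inv ≫ η[B] ▷ Y

/-- The trivial right coaction. -/
def trivRightCoaction (B : C) [MonObj B] (Y : C) : Y ⟶ Y ⊗ B := (ρ_ Y).inv ≫ Y ◁ η[B]

/-- `i : Z ⟶ X` is an invariant object of the left action `α`: it is universal among the morphisms
into `X` on which `A` acts trivially. -/
structure IsLeftInvariant {A : C} [ComonObj A] {X : C} (α : A ⊗ X ⟶ X) {Z : C} (i : Z ⟶ X) :
    Prop where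
  comm : A ◁ i ≫ α = trivLeftAction A Z ≫ i
  universal : ∀ {W : C} (f : W ⟶ X), A ◁ f ≫ α = trivLeftAction A W ≫ f →
    ∃! g : W ⟶ Z, g ≫ i = f

/-- `i : Z ⟶ X` is an invariant object of the right action `α`. -/
structure IsRightInvariant {A : C} [ComonObj A] {X : C} (α : X ⊗ A ⟶ X) {Z : C} (i : Z ⟶ X) :
    Prop where
  comm : i ▷ A ≫ α = trivRightAction A Z ≫ i
  universal : ∀ {W : C} (f : W ⟶ X), f ▷ A ≫ α = trivRightAction A W ≫ f →
    ∃! g : W ⟶ Z, g ≫ i = f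

/-- `q : Y ⟶ Z` is an invariant object of the left coaction `β`. -/
structure IsLeftCoinvariant {B : C} [MonObj B] {Y : C} (β : Y ⟶ B ⊗ Y) {Z : C} (q : Y ⟶ Z) :
    Prop where
  comm : β ≫ B ◁ q = q ≫ trivLeftCoaction B Z
  universal : ∀ {W : C} (f : Y ⟶ W), β ≫ B ◁ f = f ≫ trivLeftCoaction B W →
    ∃! g : Z ⟶ W, q ≫ g = f

/-- `q : Y ⟶ Z` is an invariant object of the right coaction `β`. -/
structure IsRightCoinvariant {B : C} [MonObj B] {Y : C} (β : Y ⟶ Y ⊗ B) {Z : C} (q : Y ⟶ Z) :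
    Prop where
  comm : β ≫ q ▷ B = q ≫ trivRightCoaction B Z
  universal : ∀ {W : C} (f : Y ⟶ W), β ≫ f ▷ B = f ≫ trivRightCoaction B W →
    ∃! g : Z ⟶ W, q ≫ g = f

/-- `p` is a coequalizer of `f` and `g`. -/
def IsCoequalizer {X Y Q : C} (f g : X ⟶ Y) (p : Y ⟶ Q) : Prop :=
  ∃ w : f ≫ p = g ≫ p, Nonempty (IsColimit (Cofork.ofπ p w))

/-- `i` is an equalizer of `f` and `g`. -/
def IsEqualizer {X Y E : C} (f g : X ⟶ Y) (i : E ⟶ X) : Prop :=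
  ∃ w : i ≫ f = i ≫ g, Nonempty (IsLimit (Fork.ofι i w))

end Actions

/-! ### Small and cosmall bimonoids -/

section Small

variable {C : Type u} [Category.{v} C] [MonoidalCategory C] [BraidedCategory C]

/-- Every left or right action of `A` has an invariant object and a stabilized object (the
coequalizer of the action and the trivial action), and the canonical morphism from the former to
the latter is an isomorphism. -/
structure IsSmall (A : C) [BimonObj A] : Prop where
  left : ∀ (X : C) (α : A ⊗ X ⟶ X), IsLeftAction A X α →
    ∃ (Z Q : C) (i : Z ⟶ X) (p : X ⟶ Q),
      IsLeftInvariant α i ∧ IsCoequalizer α (trivLeftAction A X) p ∧ IsIso (i ≫ p)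
  right : ∀ (X : C) (α : X ⊗ A ⟶ X), IsRightAction A X α →
    ∃ (Z Q : C) (i : Z ⟶ X) (p : X ⟶ Q),
      IsRightInvariant α i ∧ IsCoequalizer α (trivRightAction A X) p ∧ IsIso (i ≫ p)

/-- Every left or right coaction of `B` has an invariant object and a stabilized object (the
equalizer of the coaction and the trivial coaction), and the canonical morphism from the latter to
the former is an isomorphism. -/
structure IsCosmall (B : C) [BimonObj B] : Prop where
  left : ∀ (Y : C) (β : Y ⟶ B ⊗ Y), IsLeftCoaction B Y β →
    ∃ (Z E : C) (q : Y ⟶ Z) (j : E ⟶ Y),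
      IsLeftCoinvariant β q ∧ IsEqualizer β (trivLeftCoaction B Y) j ∧ IsIso (j ≫ q)
  right : ∀ (Y : C) (β : Y ⟶ Y ⊗ B), IsRightCoaction B Y β →
    ∃ (Z E : C) (q : Y ⟶ Z) (j : E ⟶ Y),
      IsRightCoinvariant β q ∧ IsEqualizer β (trivRightCoaction B Y) j ∧ IsIso (j ≫ q)

/-- A bimonoid that is small and cosmall. -/
structure IsBismall (A : C) [BimonObj A] : Prop where
  small : IsSmall A
  cosmall : IsCosmall A

end Small

/-! ### Bistable monoidal structures -/

section Stable

variable {C : Type u} [Category.{v} C] [MonoidalCategory C] [BraidedCategory C]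

/-- The tensor product of two left actions, an action of `A ⊗ A'` on `X ⊗ X'`. -/
def tensorLeftAction {A X A' X' : C} (α : A ⊗ X ⟶ X) (α' : A' ⊗ X' ⟶ X') :
    (A ⊗ A') ⊗ (X ⊗ X') ⟶ X ⊗ X' :=
  tensorμ A A' X X' ≫ (α ⊗ₘ α')

/-- The tensor product of two right actions. -/
def tensorRightAction {A X A' X' : C} (α : X ⊗ A ⟶ X) (α' : X' ⊗ A' ⟶ X') :
    (X ⊗ X') ⊗ (A ⊗ A') ⟶ X ⊗ X' :=
  tensorμ X X' A A' ≫ (α ⊗ₘ α')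

/-- The tensor product of two left coactions. -/
def tensorLeftCoaction {B Y B' Y' : C} (β : Y ⟶ B ⊗ Y) (β' : Y' ⟶ B' ⊗ Y') :
    Y ⊗ Y' ⟶ (B ⊗ B') ⊗ (Y ⊗ Y') :=
  (β ⊗ₘ β') ≫ tensorμ B Y B' Y'

/-- The tensor product of two right coactions. -/
def tensorRightCoaction {B Y B' Y' : C} (β : Y ⟶ Y ⊗ B) (β' : Y' ⟶ Y' ⊗ B') :
    Y ⊗ Y' ⟶ (Y ⊗ Y') ⊗ (B ⊗ B') :=
  (β ⊗ₘ β') ≫ tensorμ Y B Y' B'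

lemma tensorLeftAction_triv (A X A' X' : C) [ComonObj A] [ComonObj A'] :
    tensorLeftAction (trivLeftAction A X) (trivLeftAction A' X') =
      trivLeftAction (A ⊗ A') (X ⊗ X') := by
  simp only [tensorLeftAction, trivLeftAction, Comon.tensorObj_counit,
    ← tensorHom_comp_tensorHom, comp_whiskerRight, Category.assoc]
  rw [tensor_left_unitality, ← tensorHom_id ε[A], ← tensorHom_id ε[A'],
    ← tensorμ_natural_assoc]
  simp

lemma tensorRightAction_triv (A X A' X' : C) [ComonObj A] [ComonObj A'] :
    tensorRightAction (trivRightAction A X) (trivRightAction A' X') =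
      trivRightAction (A ⊗ A') (X ⊗ X') := by
  simp only [tensorRightAction, trivRightAction, Comon.tensorObj_counit,
    ← tensorHom_comp_tensorHom, MonoidalCategory.whiskerLeft_comp, Category.assoc]
  rw [tensor_right_unitality, ← id_tensorHom X ε[A], ← id_tensorHom X' ε[A'],
    ← tensorμ_natural_assoc]
  simp [← MonoidalCategory.whiskerLeft_comp_assoc]

lemma tensorLeftCoaction_triv (B Y B' Y' : C) [MonObj B] [MonObj B'] :
    tensorLeftCoaction (trivLeftCoaction B Y) (trivLeftCoaction B' Y') =
      trivLeftCoaction (B ⊗ B') (Y ⊗ Y') := by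
  have h : ((λ_ Y).inv ⊗ₘ (λ_ Y').inv) ≫ tensorμ (𝟙_ C) Y (𝟙_ C) Y' =
      (λ_ (Y ⊗ Y')).inv ≫ (λ_ (𝟙_ C)).inv ▷ (Y ⊗ Y') := by
    rw [← cancel_mono ((λ_ (𝟙_ C)).hom ▷ (Y ⊗ Y') ≫ (λ_ (Y ⊗ Y')).hom),
      Category.assoc, ← leftUnitor_monoidal]
    simp
  simp only [tensorLeftCoaction, trivLeftCoaction, MonObj.tensorObj.one_def,
    ← tensorHom_comp_tensorHom, comp_whiskerRight, Category.assoc]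
  rw [← tensorHom_id η[B], ← tensorHom_id η[B'], tensorμ_natural, reassoc_of% h]
  simp

lemma tensorRightCoaction_triv (B Y B' Y' : C) [MonObj B] [MonObj B'] :
    tensorRightCoaction (trivRightCoaction B Y) (trivRightCoaction B' Y') =
      trivRightCoaction (B ⊗ B') (Y ⊗ Y') := by
  have h : ((ρ_ Y).inv ⊗ₘ (ρ_ Y').inv) ≫ tensorμ Y (𝟙_ C) Y' (𝟙_ C) =
      (ρ_ (Y ⊗ Y')).inv ≫ (Y ⊗ Y') ◁ (λ_ (𝟙_ C)).inv := by
    rw [← cancel_mono ((Y ⊗ Y') ◁ (λ_ (𝟙_ C)).hom ≫ (ρ_ (Y ⊗ Y')).hom),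
      Category.assoc, ← rightUnitor_monoidal]
    simp
  simp only [tensorRightCoaction, trivRightCoaction, MonObj.tensorObj.one_def,
    ← tensorHom_comp_tensorHom, MonoidalCategory.whiskerLeft_comp, Category.assoc]
  rw [← id_tensorHom Y η[B], ← id_tensorHom Y' η[B'], tensorμ_natural, reassoc_of% h]
  simp

/-- The canonical morphism from the stabilized object of a tensor product of two left actions to the
tensor product of the stabilized objects. -/
def leftActionComparison [HasCoequalizers C] {A X A' X' : C} [ComonObj A] [ComonObj A']
    (α : A ⊗ X ⟶ X) (α' : A' ⊗ X' ⟶ X') :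
    coequalizer (tensorLeftAction α α') (trivLeftAction (A ⊗ A') (X ⊗ X')) ⟶
      coequalizer α (trivLeftAction A X) ⊗ coequalizer α' (trivLeftAction A' X') :=
  coequalizer.desc
    (coequalizer.π α (trivLeftAction A X) ⊗ₘ coequalizer.π α' (trivLeftAction A' X')) (by
      rw [← tensorLeftAction_triv]
      simp only [tensorLeftAction, Category.assoc, tensorHom_comp_tensorHom]
      rw [coequalizer.condition α, coequalizer.condition α'])

/-- The canonical morphism from the stabilized object of a tensor product of two right actions to
the tensor product of the stabilized objects. -/
def rightActionComparison [HasCoequalizers C] {A X A' X' : C} [ComonObj A] [ComonObj A']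
    (α : X ⊗ A ⟶ X) (α' : X' ⊗ A' ⟶ X') :
    coequalizer (tensorRightAction α α') (trivRightAction (A ⊗ A') (X ⊗ X')) ⟶
      coequalizer α (trivRightAction A X) ⊗ coequalizer α' (trivRightAction A' X') :=
  coequalizer.desc
    (coequalizer.π α (trivRightAction A X) ⊗ₘ coequalizer.π α' (trivRightAction A' X')) (by
      rw [← tensorRightAction_triv]
      simp only [tensorRightAction, Category.assoc, tensorHom_comp_tensorHom]
      rw [coequalizer.condition α, coequalizer.condition α'])

/-- The canonical morphism from the tensor product of the stabilized objects of two left coactions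
to the stabilized object of their tensor product. -/
def leftCoactionComparison [HasEqualizers C] {B Y B' Y' : C} [MonObj B] [MonObj B']
    (β : Y ⟶ B ⊗ Y) (β' : Y' ⟶ B' ⊗ Y') :
    equalizer β (trivLeftCoaction B Y) ⊗ equalizer β' (trivLeftCoaction B' Y') ⟶
      equalizer (tensorLeftCoaction β β') (trivLeftCoaction (B ⊗ B') (Y ⊗ Y')) :=
  equalizer.lift
    (equalizer.ι β (trivLeftCoaction B Y) ⊗ₘ equalizer.ι β' (trivLeftCoaction B' Y')) (by
      rw [← tensorLeftCoaction_triv]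
      simp only [tensorLeftCoaction, tensorHom_comp_tensorHom_assoc]
      rw [equalizer.condition β, equalizer.condition β'])

/-- The canonical morphism from the tensor product of the stabilized objects of two right coactions
to the stabilized object of their tensor product. -/
def rightCoactionComparison [HasEqualizers C] {B Y B' Y' : C} [MonObj B] [MonObj B']
    (β : Y ⟶ Y ⊗ B) (β' : Y' ⟶ Y' ⊗ B') :
    equalizer β (trivRightCoaction B Y) ⊗ equalizer β' (trivRightCoaction B' Y') ⟶
      equalizer (tensorRightCoaction β β') (trivRightCoaction (B ⊗ B') (Y ⊗ Y')) :=
  equalizer.lift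
    (equalizer.ι β (trivRightCoaction B Y) ⊗ₘ equalizer.ι β' (trivRightCoaction B' Y')) (by
      rw [← tensorRightCoaction_triv]
      simp only [tensorRightCoaction, tensorHom_comp_tensorHom_assoc]
      rw [equalizer.condition β, equalizer.condition β'])

variable (C)

/-- Taking stabilized objects of left and of right actions of bimonoids is strong monoidal.
(The comparison of unit objects is an isomorphism in every monoidal category.) -/
structure IsStable [HasCoequalizers C] : Prop where
  left : ∀ (A X A' X' : C) [BimonObj A] [BimonObj A'] (α : A ⊗ X ⟶ X) (α' : A' ⊗ X' ⟶ X'),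
    IsLeftAction A X α → IsLeftAction A' X' α' → IsIso (leftActionComparison α α')
  right : ∀ (A X A' X' : C) [BimonObj A] [BimonObj A'] (α : X ⊗ A ⟶ X) (α' : X' ⊗ A' ⟶ X'),
    IsRightAction A X α → IsRightAction A' X' α' → IsIso (rightActionComparison α α')

/-- Taking stabilized objects of left and of right coactions of bimonoids is strong monoidal. -/
structure IsCostable [HasEqualizers C] : Prop where
  left : ∀ (B Y B' Y' : C) [BimonObj B] [BimonObj B'] (β : Y ⟶ B ⊗ Y) (β' : Y' ⟶ B' ⊗ Y'),
    IsLeftCoaction B Y β → IsLeftCoaction B' Y' β' → IsIso (leftCoactionComparison β β')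
  right : ∀ (B Y B' Y' : C) [BimonObj B] [BimonObj B'] (β : Y ⟶ Y ⊗ B) (β' : Y' ⟶ Y' ⊗ B'),
    IsRightCoaction B Y β → IsRightCoaction B' Y' β' → IsIso (rightCoactionComparison β β')

/-- The monoidal structure of `C` is stable and costable. -/
structure IsBistable [HasEqualizers C] [HasCoequalizers C] : Prop where
  stable : IsStable C
  costable : IsCostable C

end Stable

/-! ### Integrals -/

section Integrals

variable {C : Type u} [Category.{v} C] [MonoidalCategory C] [BraidedCategory C]

/-- `σ` is a normalized (two-sided) integral of the bimonoid `A`. -/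
structure IsNormalizedIntegral (A : C) [BimonObj A] (σ : 𝟙_ C ⟶ A) : Prop where
  left : σ ▷ A ≫ μ[A] = (σ ⊗ₘ ε[A]) ≫ (ρ_ A).hom
  right : A ◁ σ ≫ μ[A] = (ε[A] ⊗ₘ σ) ≫ (λ_ A).hom
  normalized : σ ≫ ε[A] = 𝟙 (𝟙_ C)

/-- `σ` is a normalized (two-sided) cointegral of the bimonoid `A`. -/
structure IsNormalizedCointegral (A : C) [BimonObj A] (σ : A ⟶ 𝟙_ C) : Prop where
  left : Δ[A] ≫ σ ▷ A = (ρ_ A).inv ≫ (σ ⊗ₘ η[A])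
  right : Δ[A] ≫ A ◁ σ = (λ_ A).inv ≫ (η[A] ⊗ₘ σ)
  normalized : η[A] ≫ σ = 𝟙 (𝟙_ C)

/-- The inverse volume of a bimonoid that has a normalized integral and a normalized cointegral
(these are unique): the composite of the two. -/
def invVol (A : C) [BimonObj A] (hi : ∃ σ, IsNormalizedIntegral A σ)
    (hc : ∃ σ, IsNormalizedCointegral A σ) : 𝟙_ C ⟶ 𝟙_ C :=
  hi.choose ≫ hc.choose

/-- `A` has a normalized integral and a normalized cointegral, and its inverse volume is
invertible. -/
structure HasFiniteVolume (A : C) [BimonObj A] : Prop where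
  integral : ∃ σ, IsNormalizedIntegral A σ
  cointegral : ∃ σ, IsNormalizedCointegral A σ
  isIso : IsIso (invVol A integral cointegral)

/-- The inverse volume of a bimonoid of finite volume, as an automorphism of the unit object. -/
def invVolIso (A : C) [BimonObj A] (h : HasFiniteVolume A) : 𝟙_ C ≅ 𝟙_ C :=
  haveI := h.isIso
  asIso (invVol A h.integral h.cointegral)

/-- `m : B ⟶ A` is a right integral along `ξ : A ⟶ B`. -/
structure IsRightIntegralAlong {A B : C} [BimonObj A] [BimonObj B] (ξ : A ⟶ B) (m : B ⟶ A) :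
    Prop where
  mul : m ▷ A ≫ μ[A] = B ◁ ξ ≫ μ[B] ≫ m
  comul : Δ[B] ≫ m ▷ B = m ≫ Δ[A] ≫ A ◁ ξ

/-- `m : B ⟶ A` is a left integral along `ξ : A ⟶ B`. -/
structure IsLeftIntegralAlong {A B : C} [BimonObj A] [BimonObj B] (ξ : A ⟶ B) (m : B ⟶ A) :
    Prop where
  mul : A ◁ m ≫ μ[A] = ξ ▷ B ≫ μ[B] ≫ m
  comul : Δ[B] ≫ B ◁ m = m ≫ Δ[A] ≫ ξ ▷ A

/-- `m : B ⟶ A` is a normalized generator integral along `ξ : A ⟶ B`. -/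
structure IsNormalizedGeneratorIntegral {A B : C} [BimonObj A] [BimonObj B] (ξ : A ⟶ B)
    (m : B ⟶ A) : Prop where
  right : IsRightIntegralAlong ξ m
  left : IsLeftIntegralAlong ξ m
  normalized : ξ ≫ m ≫ ξ = ξ
  generator : ∀ m' : B ⟶ A, IsRightIntegralAlong ξ m' ∨ IsLeftIntegralAlong ξ m' →
    m' ≫ ξ ≫ m = m' ∧ m ≫ ξ ≫ m' = m'

/-- The action of an endomorphism of the unit object on a morphism. -/
def scalarMul (r : 𝟙_ C ⟶ 𝟙_ C) {X Y : C} (f : X ⟶ Y) : X ⟶ Y :=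
  (λ_ X).inv ≫ (r ⊗ₘ f) ≫ (λ_ Y).hom

end Integrals

/-! ### Bicommutative Hopf monoids -/

section HopfBC

variable (C : Type u) [Category.{v} C] [MonoidalCategory C] [BraidedCategory C]

/-- A bicommutative Hopf monoid in `C`. -/
structure HopfBC where
  /-- The underlying object. -/
  X : C
  [hopf : HopfObj X]
  [comm : IsCommMonObj X]
  [cocomm : IsCommComonObj X]

attribute [instance] HopfBC.hopf HopfBC.comm HopfBC.cocomm

variable {C}

/-- A morphism of bicommutative Hopf monoids is a bimonoid homomorphism. -/
@[ext]
structure HopfBC.Hom (A B : HopfBC C) where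
  /-- The underlying morphism. -/
  hom : A.X ⟶ B.X
  [isBimonHom : IsBimonHom hom]

attribute [instance] HopfBC.Hom.isBimonHom

/-- The category of bicommutative Hopf monoids in `C`. -/
instance : Category (HopfBC C) where
  Hom A B := HopfBC.Hom A B
  id A := { hom := 𝟙 A.X, isBimonHom := { } }
  comp f g := { hom := f.hom ≫ g.hom, isBimonHom := { } }

end HopfBC

/-! ### Fredholm homomorphisms and functorial integrals -/

section Fredholm

variable {C : Type u} [Category.{v} C] [MonoidalCategory C] [SymmetricCategory C]
  [Abelian (HopfBC C)] {A B : HopfBC C}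

/-- The homomorphism `ξ` is Fredholm: its kernel and cokernel are bismall and of finite volume. -/
structure IsFredholm (ξ : A ⟶ B) : Prop where
  ker_bismall : IsBismall (kernel ξ).X
  cok_bismall : IsBismall (cokernel ξ).X
  ker_finiteVolume : HasFiniteVolume (kernel ξ).X
  cok_finiteVolume : HasFiniteVolume (cokernel ξ).X

/-- The left action of `A` on `B` through `ξ`. -/
def actionThrough (ξ : A ⟶ B) : A.X ⊗ B.X ⟶ B.X := ξ.hom ▷ B.X ≫ μ[B.X]

/-- The right coaction of `B` on `A` through `ξ`. -/
def coactionThrough (ξ : A ⟶ B) : A.X ⟶ A.X ⊗ B.X := Δ[A.X] ≫ A.X ◁ ξ.hom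

/-- There is an invariant object `i` of the action of `A` on `B` through `ξ` such that the canonical
morphism `i ≫ cok ξ` to the stabilized object `Cok ξ` is an isomorphism. -/
def HasCokIntegral (ξ : A ⟶ B) : Prop :=
  ∃ (Z : C) (i : Z ⟶ B.X),
    IsLeftInvariant (actionThrough ξ) i ∧ IsIso (i ≫ (cokernel.π ξ).hom)

/-- There is an invariant object `q` of the coaction of `B` on `A` through `ξ` such that the
canonical morphism `ker ξ ≫ q` from the stabilized object `Ker ξ` is an isomorphism. -/
def HasKerIntegral (ξ : A ⟶ B) : Prop :=
  ∃ (Z : C) (q : A.X ⟶ Z),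
    IsRightCoinvariant (coactionThrough ξ) q ∧ IsIso ((kernel.ι ξ).hom ≫ q)

open Classical in
/-- The normalized integral along `cok ξ : B ⟶ Cok ξ`: the inverse of the canonical morphism from
the invariant object to the stabilized object `Cok ξ`, followed by the inclusion of the invariant
object. It does not depend on the choice of the invariant object. If there is no such invariant
object, the value is the trivial morphism. -/
def cokIntegral (ξ : A ⟶ B) : (cokernel ξ).X ⟶ B.X :=
  if h : HasCokIntegral ξ then
    haveI := h.choose_spec.choose_spec.2
    inv (h.choose_spec.choose ≫ (cokernel.π ξ).hom) ≫ h.choose_spec.choose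
  else ε[(cokernel ξ).X] ≫ η[B.X]

open Classical in
/-- The normalized integral along `ker ξ : Ker ξ ⟶ A`: the projection to the invariant object,
followed by the inverse of the canonical morphism to it from the stabilized object `Ker ξ`. If there
is no such invariant object, the value is the trivial morphism. -/
def kerIntegral (ξ : A ⟶ B) : A.X ⟶ (kernel ξ).X :=
  if h : HasKerIntegral ξ then
    haveI := h.choose_spec.choose_spec.2
    h.choose_spec.choose ≫ inv ((kernel.ι ξ).hom ≫ h.choose_spec.choose)
  else ε[A.X] ≫ η[(kernel ξ).X]

/-- The morphism `μ_ξ : B ⟶ A`: the composite of the normalized integral along `im ξ = ker (cok ξ)`,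
the inverse of the canonical isomorphism `Coim ξ ≅ Im ξ`, and the normalized integral along
`coim ξ = cok (ker ξ)`. -/
def fredholmIntegral (ξ : A ⟶ B) : B.X ⟶ A.X :=
  kerIntegral (cokernel.π ξ) ≫ (inv (Abelian.coimageImageComparison ξ)).hom ≫
    cokIntegral (kernel.ι ξ)

variable (C) in
/-- A family of automorphisms of the unit object indexed by the Fredholm homomorphisms. -/
def Cochain : Type (max u v) :=
  ∀ ⦃A B : HopfBC C⦄ (ξ : A ⟶ B), IsFredholm ξ → (𝟙_ C ≅ 𝟙_ C)

variable (C) in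
/-- `υ₀ ξ = vol⁻¹ (Ker ξ)`. -/
def upsilonZero : Cochain C := fun _ _ ξ h => invVolIso (kernel ξ).X h.ker_finiteVolume

variable (C) in
/-- `υ₁ ξ = vol⁻¹ (Cok ξ)`. -/
def upsilonOne : Cochain C := fun _ _ ξ h => invVolIso (cokernel ξ).X h.cok_finiteVolume

/-- `ξ_! = υ(ξ)⁻¹ · μ_ξ`. -/
def shriek (υ : Cochain C) (ξ : A ⟶ B) (h : IsFredholm ξ) : B.X ⟶ A.X :=
  scalarMul (υ ξ h).inv (fredholmIntegral ξ)

end Fredholm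

end

end HopfIntegral

/-! Composites are written in diagrammatic order. Bistability makes exactness in `HopfBC C` visible
in `C`: the equalizer of the coaction through `ξ : A ⟶ B` and the trivial coaction stays an
equalizer after tensoring, so it inherits a Hopf structure and is the kernel of `ξ`. Cokernels are
dual (`isEqualizer_of_isLimit`, `isCoequalizer_of_isColimit`).

In a short exact sequence N → A → Q, translation by a normalized integral of N is an averaging
operator on A. It is N-invariant, hence descends to a section Q → A of the projection, and this
section is an integral along it (`IsExtension.exists_isSection`). A normalized cointegral of Q
dually gives a retraction A → N. These are the two outer factors of μ_ξ. Hence ξ ≫ μ_ξ averages over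
Ker ξ, μ_ξ ≫ ξ is contraction with the cointegral of Cok ξ, and ξ and μ_ξ are generalized inverses
of each other (`IsMuAlong`). Every integral along ξ carries these two operators across to the other
side, where they become the identity because ξ kills Ker ξ and is killed by Cok ξ. This is the
generator property, and uniqueness is formal.

For composition, μ_ξ' ≫ μ_ξ is an integral along ξ ≫ ξ', and it equals r · μ_{ξ ≫ ξ'}, where r is
the normalized integral of Ker ξ' followed by δ : Ker ξ' → Cok ξ and the normalized cointegral of
Cok ξ (`fredholmIntegral_comp`). So r is the inverse volume of the image of δ. The exact sequence 0
→ Ker ξ → Ker(ξ ≫ ξ') → Ker ξ' → Cok ξ → Cok(ξ ≫ ξ') → Cok ξ' → 0 breaks into extensions, along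
which inverse volumes multiply. Thus r times the inverse volume of Ker(ξ ≫ ξ') is the product of
those of Ker ξ and Ker ξ', and likewise for cokernels: either υ corrects exactly by r.

The crux is that r is invertible (`isIso_integral_comp_cointegral`); without this Ker δ and Cok δ
need not have the required integral and cointegral. A Hopf monoid of finite volume is self-dual by a
Frobenius pairing (`frobenius_eq`). The image of δ is a quotient of Ker ξ' and a subobject of Cok ξ.
Transporting both dualities to it gives a closed loop whose product with r is the product of the two
invertible inverse volumes. Bismallness costs nothing: averaging splits every action and coaction
(`HasFiniteVolume.isBismall`).

For base change, normalized integrals push forward along epimorphisms and normalized cointegrals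
pull back along monomorphisms. Both sides of the square therefore equal the zigzag μ_φ ≫ φ' ≫ ψ ≫
μ_ψ (`fredholmIntegral_baseChange`), and the isomorphism on kernels or cokernels matches the
scalars. -/

namespace HopfIntegral

open scoped MonObj ComonObj

/-! ### Hopf structures on subobjects and quotients -/

section SubHopf

open HopfObj

variable {C : Type u} [Category.{v} C] [MonoidalCategory C] [BraidedCategory C]

/-- A subobject of a Hopf monoid that is closed under the structure morphisms is a Hopf monoid. -/
@[reducible] def hopfObjOfMono {A E : C} [HopfObj A] (i : E ⟶ A) [Mono i] [Mono (i ⊗ₘ i)]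
    [Mono (i ⊗ₘ i ⊗ₘ i)] (e : 𝟙_ C ⟶ E) (m : E ⊗ E ⟶ E) (d : E ⟶ E ⊗ E) (s : E ⟶ E)
    (he : e ≫ i = η[A]) (hm : m ≫ i = (i ⊗ₘ i) ≫ μ[A]) (hd : d ≫ (i ⊗ₘ i) = i ≫ Δ[A])
    (hs : s ≫ i = i ≫ 𝒮[A]) : HopfObj E where
  one := e
  mul := m
  counit := i ≫ ε[A]
  comul := d
  antipode := s
  one_mul := by
    rw [← cancel_mono i]
    simp only [Category.assoc, hm, ← tensorHom_id, tensorHom_comp_tensorHom_assoc, he]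
    simp [MonoidalCategory.tensorHom_def']
  mul_one := by
    rw [← cancel_mono i]
    simp only [Category.assoc, hm, ← id_tensorHom, tensorHom_comp_tensorHom_assoc, he]
    simp [MonoidalCategory.tensorHom_def]
  mul_assoc := by
    rw [← cancel_mono i]
    have h₁ : m ▷ E ≫ (i ⊗ₘ i) = ((i ⊗ₘ i) ⊗ₘ i) ≫ μ[A] ▷ A := by
      simp only [← tensorHom_id, tensorHom_comp_tensorHom, hm, Category.id_comp, Category.comp_id]
    have h₂ : E ◁ m ≫ (i ⊗ₘ i) = (i ⊗ₘ (i ⊗ₘ i)) ≫ A ◁ μ[A] := by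
      simp only [← id_tensorHom, tensorHom_comp_tensorHom, hm, Category.id_comp, Category.comp_id]
    simp only [Category.assoc, hm, reassoc_of% h₁, reassoc_of% h₂]
    simp
  counit_comul := by
    have : Mono (𝟙_ C ◁ i) := by rw [id_whiskerLeft]; infer_instance
    rw [← cancel_mono ((𝟙_ C) ◁ i)]
    have h : (i ≫ ε[A]) ▷ E ≫ 𝟙_ C ◁ i = (i ⊗ₘ i) ≫ ε[A] ▷ A := by
      simp [MonoidalCategory.tensorHom_def', whisker_exchange]
    rw [Category.assoc, h, reassoc_of% hd]
    simp
  comul_counit := by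
    have : Mono (i ▷ 𝟙_ C) := by rw [whiskerRight_id]; infer_instance
    rw [← cancel_mono (i ▷ (𝟙_ C))]
    have h : E ◁ (i ≫ ε[A]) ≫ i ▷ 𝟙_ C = (i ⊗ₘ i) ≫ A ◁ ε[A] := by
      simp [MonoidalCategory.tensorHom_def, ← whisker_exchange]
    rw [Category.assoc, h, reassoc_of% hd]
    simp
  comul_assoc := by
    rw [← cancel_mono (i ⊗ₘ i ⊗ₘ i)]
    have h₁ : d ▷ E ≫ ((i ⊗ₘ i) ⊗ₘ i) = (i ⊗ₘ i) ≫ Δ[A] ▷ A := by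
      simp only [← tensorHom_id, tensorHom_comp_tensorHom, hd, Category.id_comp, Category.comp_id]
    have h₂ : E ◁ d ≫ (i ⊗ₘ (i ⊗ₘ i)) = (i ⊗ₘ i) ≫ A ◁ Δ[A] := by
      simp only [← id_tensorHom, tensorHom_comp_tensorHom, hd, Category.id_comp, Category.comp_id]
    rw [Category.assoc, h₂, reassoc_of% hd, Category.assoc, Category.assoc,
      ← associator_naturality, reassoc_of% h₁, reassoc_of% hd, ComonObj.comul_assoc]
  mul_comul := by
    rw [← cancel_mono (i ⊗ₘ i)]
    have h₁ : (m ⊗ₘ m) ≫ (i ⊗ₘ i) = ((i ⊗ₘ i) ⊗ₘ (i ⊗ₘ i)) ≫ (μ[A] ⊗ₘ μ[A]) := by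
      simp only [tensorHom_comp_tensorHom, hm]
    have h₂ : (d ⊗ₘ d) ≫ ((i ⊗ₘ i) ⊗ₘ (i ⊗ₘ i)) = (i ⊗ₘ i) ≫ (Δ[A] ⊗ₘ Δ[A]) := by
      simp only [tensorHom_comp_tensorHom, hd]
    simp only [Category.assoc, h₁, hd, reassoc_of% hm]
    rw [← tensorμ_natural_assoc, reassoc_of% h₂, BimonObj.mul_comul]
  one_comul := by
    change e ≫ d = (λ_ _).inv ≫ (e ⊗ₘ e)
    rw [← cancel_mono (i ⊗ₘ i)]
    simp only [Category.assoc, hd, MonObj.tensorObj.one_def, tensorHom_comp_tensorHom, he,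
      reassoc_of% he, BimonObj.one_comul]
  mul_counit := by
    simp only [Comon.tensorObj_counit, reassoc_of% hm, BimonObj.mul_counit,
      tensorHom_comp_tensorHom_assoc]
  one_counit := by simp [reassoc_of% he]
  antipode_left := by
    rw [← cancel_mono i]
    have h₁ : s ▷ E ≫ (i ⊗ₘ i) = (i ⊗ₘ i) ≫ 𝒮[A] ▷ A := by
      simp only [← tensorHom_id, tensorHom_comp_tensorHom, hs, Category.id_comp, Category.comp_id]
    simp only [Category.assoc, hm, he, reassoc_of% h₁, reassoc_of% hd, antipode_left]
  antipode_right := by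
    rw [← cancel_mono i]
    have h₁ : E ◁ s ≫ (i ⊗ₘ i) = (i ⊗ₘ i) ≫ A ◁ 𝒮[A] := by
      simp only [← id_tensorHom, tensorHom_comp_tensorHom, hs, Category.id_comp, Category.comp_id]
    simp only [Category.assoc, hm, he, reassoc_of% h₁, reassoc_of% hd, antipode_right]

/-- A quotient object of a Hopf monoid to which the structure morphisms descend is a Hopf
monoid. -/
@[reducible] def hopfObjOfEpi {A Q : C} [HopfObj A] (p : A ⟶ Q) [Epi p] [Epi (p ⊗ₘ p)]
    [Epi ((p ⊗ₘ p) ⊗ₘ p)] (c : Q ⟶ 𝟙_ C) (d : Q ⟶ Q ⊗ Q) (m : Q ⊗ Q ⟶ Q) (s : Q ⟶ Q)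
    (hc : p ≫ c = ε[A]) (hd : p ≫ d = Δ[A] ≫ (p ⊗ₘ p)) (hm : (p ⊗ₘ p) ≫ m = μ[A] ≫ p)
    (hs : p ≫ s = 𝒮[A] ≫ p) : HopfObj Q where
  one := η[A] ≫ p
  mul := m
  counit := c
  comul := d
  antipode := s
  one_mul := by
    have : Epi (𝟙_ C ◁ p) := by rw [id_whiskerLeft]; infer_instance
    rw [← cancel_epi ((𝟙_ C) ◁ p)]
    have h : 𝟙_ C ◁ p ≫ (η[A] ≫ p) ▷ Q = η[A] ▷ A ≫ (p ⊗ₘ p) := by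
      rw [comp_whiskerRight, whisker_exchange_assoc, MonoidalCategory.tensorHom_def']
    rw [reassoc_of% h, hm]
    simp
  mul_one := by
    have : Epi (p ▷ 𝟙_ C) := by rw [whiskerRight_id]; infer_instance
    rw [← cancel_epi (p ▷ (𝟙_ C))]
    have h : p ▷ 𝟙_ C ≫ Q ◁ (η[A] ≫ p) = A ◁ η[A] ≫ (p ⊗ₘ p) := by
      rw [MonoidalCategory.whiskerLeft_comp, ← whisker_exchange_assoc,
        MonoidalCategory.tensorHom_def]
    rw [reassoc_of% h, hm]
    simp
  mul_assoc := by
    rw [← cancel_epi ((p ⊗ₘ p) ⊗ₘ p)]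
    have h₁ : ((p ⊗ₘ p) ⊗ₘ p) ≫ m ▷ Q = μ[A] ▷ A ≫ (p ⊗ₘ p) := by
      simp only [← tensorHom_id, tensorHom_comp_tensorHom, hm, Category.id_comp, Category.comp_id]
    have h₂ : (p ⊗ₘ (p ⊗ₘ p)) ≫ Q ◁ m = A ◁ μ[A] ≫ (p ⊗ₘ p) := by
      simp only [← id_tensorHom, tensorHom_comp_tensorHom, hm, Category.id_comp, Category.comp_id]
    rw [reassoc_of% h₁, hm, associator_naturality_assoc, reassoc_of% h₂, hm]
    simp
  counit_comul := by
    rw [← cancel_epi p]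
    simp only [reassoc_of% hd, ← tensorHom_id, tensorHom_comp_tensorHom, hc]
    simp
  comul_counit := by
    rw [← cancel_epi p]
    simp only [reassoc_of% hd, ← id_tensorHom, tensorHom_comp_tensorHom, hc]
    simp
  comul_assoc := by
    rw [← cancel_epi p]
    have h₁ : (p ⊗ₘ p) ≫ d ▷ Q = Δ[A] ▷ A ≫ ((p ⊗ₘ p) ⊗ₘ p) := by
      simp only [← tensorHom_id, tensorHom_comp_tensorHom, hd, Category.id_comp, Category.comp_id]
    have h₂ : (p ⊗ₘ p) ≫ Q ◁ d = A ◁ Δ[A] ≫ (p ⊗ₘ (p ⊗ₘ p)) := by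
      simp only [← id_tensorHom, tensorHom_comp_tensorHom, hd, Category.id_comp, Category.comp_id]
    rw [reassoc_of% hd, h₂, reassoc_of% hd, reassoc_of% h₁, associator_naturality,
      ComonObj.comul_assoc_assoc]
  mul_comul := by
    rw [← cancel_epi (p ⊗ₘ p)]
    have h₁ : ((p ⊗ₘ p) ⊗ₘ (p ⊗ₘ p)) ≫ (m ⊗ₘ m) = (μ[A] ⊗ₘ μ[A]) ≫ (p ⊗ₘ p) := by
      simp only [tensorHom_comp_tensorHom, hm]
    have h₂ : (p ⊗ₘ p) ≫ (d ⊗ₘ d) = (Δ[A] ⊗ₘ Δ[A]) ≫ ((p ⊗ₘ p) ⊗ₘ (p ⊗ₘ p)) := by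
      simp only [tensorHom_comp_tensorHom, hd]
    rw [reassoc_of% hm, hd, reassoc_of% h₂, tensorμ_natural_assoc, h₁, BimonObj.mul_comul_assoc]
  one_comul := by
    change (η[A] ≫ p) ≫ d = (λ_ _).inv ≫ (η[A] ≫ p ⊗ₘ η[A] ≫ p)
    simp only [Category.assoc, hd, BimonObj.one_comul_assoc, MonObj.tensorObj.one_def,
      tensorHom_comp_tensorHom]
  mul_counit := by
    rw [← cancel_epi (p ⊗ₘ p)]
    simp only [Comon.tensorObj_counit, reassoc_of% hm, hc, BimonObj.mul_counit,
      tensorHom_comp_tensorHom_assoc]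
  one_counit := by simp [hc]
  antipode_left := by
    rw [← cancel_epi p]
    have h₁ : (p ⊗ₘ p) ≫ s ▷ Q = 𝒮[A] ▷ A ≫ (p ⊗ₘ p) := by
      simp only [← tensorHom_id, tensorHom_comp_tensorHom, hs, Category.id_comp, Category.comp_id]
    rw [reassoc_of% hd, reassoc_of% h₁, hm, reassoc_of% hc, antipode_left_assoc]
  antipode_right := by
    rw [← cancel_epi p]
    have h₁ : (p ⊗ₘ p) ≫ Q ◁ s = A ◁ 𝒮[A] ≫ (p ⊗ₘ p) := by
      simp only [← id_tensorHom, tensorHom_comp_tensorHom, hs, Category.id_comp, Category.comp_id]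
    rw [reassoc_of% hd, reassoc_of% h₁, hm, reassoc_of% hc, antipode_right_assoc]

end SubHopf

/-! ### Elementary calculus of equalizers and coequalizers -/

section Equalizers

variable {C : Type u} [Category.{v} C]

lemma IsEqualizer.condition {X Y E : C} {f g : X ⟶ Y} {i : E ⟶ X} (h : IsEqualizer f g i) :
    i ≫ f = i ≫ g := h.1

lemma IsEqualizer.mono {X Y E : C} {f g : X ⟶ Y} {i : E ⟶ X} (h : IsEqualizer f g i) :
    Mono i := by
  obtain ⟨w, ⟨hl⟩⟩ := h
  exact ⟨fun a b hab => Fork.IsLimit.hom_ext hl hab⟩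

lemma IsEqualizer.exists_lift {X Y E : C} {f g : X ⟶ Y} {i : E ⟶ X} (h : IsEqualizer f g i)
    {W : C} (k : W ⟶ X) (hk : k ≫ f = k ≫ g) : ∃ l : W ⟶ E, l ≫ i = k := by
  obtain ⟨w, ⟨hl⟩⟩ := h
  exact ⟨Fork.IsLimit.lift hl k hk, Fork.IsLimit.lift_ι' hl k hk⟩

lemma IsEqualizer.of_exists_lift {X Y E : C} {f g : X ⟶ Y} {i : E ⟶ X} [Mono i]
    (w : i ≫ f = i ≫ g) (h : ∀ {W : C} (k : W ⟶ X), k ≫ f = k ≫ g → ∃ l : W ⟶ E, l ≫ i = k) :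
    IsEqualizer f g i :=
  ⟨w, ⟨Fork.IsLimit.mk' _ fun s => ⟨(h s.ι s.condition).choose, (h s.ι s.condition).choose_spec,
    fun hm => (cancel_mono i).1 (hm.trans (h s.ι s.condition).choose_spec.symm)⟩⟩⟩

lemma IsEqualizer.of_iso {X Y E E' : C} {f g : X ⟶ Y} {i : E ⟶ X} (h : IsEqualizer f g i)
    (e : E' ⟶ E) [IsIso e] {i' : E' ⟶ X} (hi : e ≫ i = i') : IsEqualizer f g i' := by
  have := h.mono
  subst hi
  refine .of_exists_lift (by simp [h.condition]) fun k hk => ?_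
  obtain ⟨l, hl⟩ := h.exists_lift k hk
  exact ⟨l ≫ inv e, by simp [hl]⟩

lemma IsEqualizer.comp_mono {X Y Y' E : C} {f g : X ⟶ Y} {i : E ⟶ X} (h : IsEqualizer f g i)
    (m : Y ⟶ Y') [Mono m] : IsEqualizer (f ≫ m) (g ≫ m) i := by
  have := h.mono
  refine .of_exists_lift (by simp [reassoc_of% h.condition]) fun k hk =>
    h.exists_lift k ((cancel_mono m).1 (by simpa using hk))

lemma isEqualizer_equalizer [HasEqualizers C] {X Y : C} (f g : X ⟶ Y) :
    IsEqualizer f g (equalizer.ι f g) :=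
  .of_exists_lift (equalizer.condition f g) fun k hk =>
    ⟨equalizer.lift k hk, equalizer.lift_ι k hk⟩

lemma IsEqualizer.exists_iso [HasEqualizers C] {X Y E : C} {f g : X ⟶ Y} {i : E ⟶ X}
    (h : IsEqualizer f g i) : ∃ e : E ⟶ equalizer f g, IsIso e ∧ e ≫ equalizer.ι f g = i := by
  have := h.mono
  obtain ⟨l, hl⟩ := h.exists_lift _ (equalizer.condition f g)
  exact ⟨equalizer.lift i h.condition, ⟨l, by simp [← cancel_mono i, hl],
    by simp [← cancel_mono (equalizer.ι f g), hl]⟩, by simp⟩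

lemma IsCoequalizer.condition {X Y Q : C} {f g : X ⟶ Y} {p : Y ⟶ Q} (h : IsCoequalizer f g p) :
    f ≫ p = g ≫ p := h.1

lemma IsCoequalizer.epi {X Y Q : C} {f g : X ⟶ Y} {p : Y ⟶ Q} (h : IsCoequalizer f g p) :
    Epi p := by
  obtain ⟨w, ⟨hl⟩⟩ := h
  exact ⟨fun a b hab => Cofork.IsColimit.hom_ext hl hab⟩

lemma IsCoequalizer.exists_desc {X Y Q : C} {f g : X ⟶ Y} {p : Y ⟶ Q} (h : IsCoequalizer f g p)
    {W : C} (k : Y ⟶ W) (hk : f ≫ k = g ≫ k) : ∃ l : Q ⟶ W, p ≫ l = k := by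
  obtain ⟨w, ⟨hl⟩⟩ := h
  exact ⟨Cofork.IsColimit.desc hl k hk, Cofork.IsColimit.π_desc' hl k hk⟩

lemma IsCoequalizer.of_exists_desc {X Y Q : C} {f g : X ⟶ Y} {p : Y ⟶ Q} [Epi p]
    (w : f ≫ p = g ≫ p) (h : ∀ {W : C} (k : Y ⟶ W), f ≫ k = g ≫ k → ∃ l : Q ⟶ W, p ≫ l = k) :
    IsCoequalizer f g p :=
  ⟨w, ⟨Cofork.IsColimit.mk' _ fun s => ⟨(h s.π s.condition).choose,
    (h s.π s.condition).choose_spec,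
    fun hm => (cancel_epi p).1 (hm.trans (h s.π s.condition).choose_spec.symm)⟩⟩⟩

lemma IsCoequalizer.of_iso {X Y Q Q' : C} {f g : X ⟶ Y} {p : Y ⟶ Q} (h : IsCoequalizer f g p)
    (e : Q ⟶ Q') [IsIso e] {p' : Y ⟶ Q'} (hp : p ≫ e = p') : IsCoequalizer f g p' := by
  have := h.epi
  subst hp
  refine .of_exists_desc (by simp [reassoc_of% h.condition]) fun k hk => ?_
  obtain ⟨l, hl⟩ := h.exists_desc k hk
  exact ⟨inv e ≫ l, by simp [hl]⟩

lemma IsCoequalizer.epi_comp {X X' Y Q : C} {f g : X ⟶ Y} {p : Y ⟶ Q} (h : IsCoequalizer f g p)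
    (m : X' ⟶ X) [Epi m] : IsCoequalizer (m ≫ f) (m ≫ g) p := by
  have := h.epi
  refine .of_exists_desc (by simp [h.condition]) fun k hk =>
    h.exists_desc k ((cancel_epi m).1 (by simpa using hk))

lemma isCoequalizer_coequalizer [HasCoequalizers C] {X Y : C} (f g : X ⟶ Y) :
    IsCoequalizer f g (coequalizer.π f g) :=
  .of_exists_desc (coequalizer.condition f g) fun k hk =>
    ⟨coequalizer.desc k hk, coequalizer.π_desc k hk⟩

lemma IsCoequalizer.exists_iso [HasCoequalizers C] {X Y Q : C} {f g : X ⟶ Y} {p : Y ⟶ Q}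
    (h : IsCoequalizer f g p) :
    ∃ e : coequalizer f g ⟶ Q, IsIso e ∧ coequalizer.π f g ≫ e = p := by
  have := h.epi
  obtain ⟨l, hl⟩ := h.exists_desc _ (coequalizer.condition f g)
  exact ⟨coequalizer.desc p h.condition, ⟨l, by simp [← cancel_epi (coequalizer.π f g), hl],
    by simp [← cancel_epi p, reassoc_of% hl]⟩, by simp⟩

lemma isEqualizer_self {X Y : C} (f : X ⟶ Y) : IsEqualizer f f (𝟙 X) :=
  .of_exists_lift rfl fun k _ => ⟨k, Category.comp_id k⟩

lemma isCoequalizer_self {X Y : C} (f : X ⟶ Y) : IsCoequalizer f f (𝟙 Y) :=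
  .of_exists_desc rfl fun k _ => ⟨k, Category.id_comp k⟩

end Equalizers

/-! ### Bistability: tensor products of stabilized objects -/

section Stable

variable {C : Type u} [Category.{v} C] [MonoidalCategory C] [BraidedCategory C]

instance tensorμ_isIso (X₁ X₂ Y₁ Y₂ : C) : IsIso (tensorμ X₁ X₂ Y₁ Y₂) := by
  unfold tensorμ; infer_instance

lemma isRightCoaction_triv (B : C) [BimonObj B] (Y : C) :
    IsRightCoaction B Y (trivRightCoaction B Y) where
  coassoc := by
    simp only [trivRightCoaction, Category.assoc, ← MonoidalCategory.whiskerLeft_comp,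
      BimonObj.one_comul, MonObj.tensorObj.one_def, comp_whiskerRight]
    rw [whisker_exchange_assoc, MonoidalCategory.tensorHom_def']
    monoidal
  counit := by
    simp only [trivRightCoaction, Category.assoc, ← MonoidalCategory.whiskerLeft_comp,
      BimonObj.one_counit]
    simp

lemma isLeftAction_triv (A : C) [BimonObj A] (X : C) :
    IsLeftAction A X (trivLeftAction A X) where
  assoc := by
    simp only [trivLeftAction, ← comp_whiskerRight_assoc,
      BimonObj.mul_counit, Comon.tensorObj_counit, MonoidalCategory.whiskerLeft_comp,
      MonoidalCategory.tensorHom_def']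
    simp only [Category.assoc]
    rw [whisker_exchange_assoc ε[A] (λ_ X).hom]
    monoidal
  unit := by
    simp only [trivLeftAction, ← comp_whiskerRight_assoc, BimonObj.one_counit]
    simp

/-- Costability identifies the tensor product of the two equalizers with the equalizer of the tensor
coaction. That coaction differs from `β ⊗ₘ β'` by the interchange `tensorμ`, which is invertible and
can be stripped off. -/
lemma IsCostable.isEqualizer_tensor [HasEqualizers C] (hC : IsCostable C) {B Y E B' Y' E' : C}
    [BimonObj B] [BimonObj B'] {β : Y ⟶ Y ⊗ B} {β' : Y' ⟶ Y' ⊗ B'} (hβ : IsRightCoaction B Y β)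
    (hβ' : IsRightCoaction B' Y' β') {i : E ⟶ Y} {i' : E' ⟶ Y'}
    (hi : IsEqualizer β (trivRightCoaction B Y) i)
    (hi' : IsEqualizer β' (trivRightCoaction B' Y') i') :
    IsEqualizer (β ⊗ₘ β') (trivRightCoaction B Y ⊗ₘ trivRightCoaction B' Y') (i ⊗ₘ i') := by
  obtain ⟨e, he, rfl⟩ := hi.exists_iso
  obtain ⟨e', he', rfl⟩ := hi'.exists_iso
  have := hC.right B Y B' Y' β β' hβ hβ'
  have h := (isEqualizer_equalizer (tensorRightCoaction β β')
    (trivRightCoaction (B ⊗ B') (Y ⊗ Y'))).of_iso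
    (i' := e ≫ equalizer.ι β (trivRightCoaction B Y) ⊗ₘ
      e' ≫ equalizer.ι β' (trivRightCoaction B' Y'))
    ((e ⊗ₘ e') ≫ rightCoactionComparison β β') (by simp [rightCoactionComparison])
  rw [← tensorRightCoaction_triv] at h
  have h' := h.comp_mono (inv (tensorμ Y B Y' B'))
  simp only [tensorRightCoaction, Category.assoc, IsIso.hom_inv_id, Category.comp_id] at h'
  exact h'

lemma IsStable.isCoequalizer_tensor [HasCoequalizers C] (hC : IsStable C) {A X Q A' X' Q' : C}
    [BimonObj A] [BimonObj A'] {α : A ⊗ X ⟶ X} {α' : A' ⊗ X' ⟶ X'} (hα : IsLeftAction A X α)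
    (hα' : IsLeftAction A' X' α') {p : X ⟶ Q} {p' : X' ⟶ Q'}
    (hp : IsCoequalizer α (trivLeftAction A X) p)
    (hp' : IsCoequalizer α' (trivLeftAction A' X') p') :
    IsCoequalizer (α ⊗ₘ α') (trivLeftAction A X ⊗ₘ trivLeftAction A' X') (p ⊗ₘ p') := by
  obtain ⟨e, he, rfl⟩ := hp.exists_iso
  obtain ⟨e', he', rfl⟩ := hp'.exists_iso
  have := hC.left A X A' X' α α' hα hα'
  have h := (isCoequalizer_coequalizer (tensorLeftAction α α')
    (trivLeftAction (A ⊗ A') (X ⊗ X'))).of_iso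
    (p' := coequalizer.π α (trivLeftAction A X) ≫ e ⊗ₘ
      coequalizer.π α' (trivLeftAction A' X') ≫ e')
    (leftActionComparison α α' ≫ (e ⊗ₘ e')) (by simp [leftActionComparison])
  rw [← tensorLeftAction_triv] at h
  have h' := h.epi_comp (inv (tensorμ A A' X X'))
  simp only [tensorLeftAction, IsIso.inv_hom_id_assoc] at h'
  exact h'

/-- The second tensor factor is `X` with the trivial coaction, whose stabilized object is `X`
itself. Tensoring with an arbitrary object thus preserves these particular equalizers, although
nothing is assumed about equalizers in general. -/
lemma IsCostable.isEqualizer_whiskerRight [HasEqualizers C] (hC : IsCostable C) {B Y E : C}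
    [BimonObj B] {β : Y ⟶ Y ⊗ B} (hβ : IsRightCoaction B Y β) {i : E ⟶ Y}
    (hi : IsEqualizer β (trivRightCoaction B Y) i) (X : C) :
    IsEqualizer (β ▷ X) (trivRightCoaction B Y ▷ X) (i ▷ X) := by
  have h := hC.isEqualizer_tensor hβ (isRightCoaction_triv B X) hi (isEqualizer_self _)
  have := h.mono
  rw [tensorHom_id] at this
  refine .of_exists_lift ?_ fun k hk => ?_
  · rw [← comp_whiskerRight, hi.condition, comp_whiskerRight]
  · simpa using h.exists_lift k (by
      simp only [MonoidalCategory.tensorHom_def, reassoc_of% hk])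

lemma IsCostable.isEqualizer_whiskerLeft [HasEqualizers C] (hC : IsCostable C) {B Y E : C}
    [BimonObj B] {β : Y ⟶ Y ⊗ B} (hβ : IsRightCoaction B Y β) {i : E ⟶ Y}
    (hi : IsEqualizer β (trivRightCoaction B Y) i) (X : C) :
    IsEqualizer (X ◁ β) (X ◁ trivRightCoaction B Y) (X ◁ i) := by
  have h := hC.isEqualizer_tensor (isRightCoaction_triv B X) hβ (isEqualizer_self _) hi
  have := h.mono
  rw [id_tensorHom] at this
  refine .of_exists_lift ?_ fun k hk => ?_
  · rw [← MonoidalCategory.whiskerLeft_comp, hi.condition, MonoidalCategory.whiskerLeft_comp]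
  · simpa using h.exists_lift k (by
      simp only [MonoidalCategory.tensorHom_def', reassoc_of% hk])

lemma IsStable.isCoequalizer_whiskerRight [HasCoequalizers C] (hC : IsStable C) {A X Q : C}
    [BimonObj A] {α : A ⊗ X ⟶ X} (hα : IsLeftAction A X α) {p : X ⟶ Q}
    (hp : IsCoequalizer α (trivLeftAction A X) p) (Y : C) :
    IsCoequalizer (α ▷ Y) (trivLeftAction A X ▷ Y) (p ▷ Y) := by
  have h := hC.isCoequalizer_tensor hα (isLeftAction_triv A Y) hp (isCoequalizer_self _)
  have := h.epi
  rw [tensorHom_id] at this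
  refine .of_exists_desc ?_ fun k hk => ?_
  · rw [← comp_whiskerRight, hp.condition, comp_whiskerRight]
  · simpa using h.exists_desc k (by
      simp only [MonoidalCategory.tensorHom_def', Category.assoc, hk])

lemma IsStable.isCoequalizer_whiskerLeft [HasCoequalizers C] (hC : IsStable C) {A X Q : C}
    [BimonObj A] {α : A ⊗ X ⟶ X} (hα : IsLeftAction A X α) {p : X ⟶ Q}
    (hp : IsCoequalizer α (trivLeftAction A X) p) (Y : C) :
    IsCoequalizer (Y ◁ α) (Y ◁ trivLeftAction A X) (Y ◁ p) := by
  have h := hC.isCoequalizer_tensor (isLeftAction_triv A Y) hα (isCoequalizer_self _) hp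
  have := h.epi
  rw [id_tensorHom] at this
  refine .of_exists_desc ?_ fun k hk => ?_
  · rw [← MonoidalCategory.whiskerLeft_comp, hp.condition, MonoidalCategory.whiskerLeft_comp]
  · simpa using h.exists_desc k (by
      simp only [MonoidalCategory.tensorHom_def, Category.assoc, hk])

end Stable

/-! ### Kernels and cokernels of bicommutative Hopf monoids inside `C` -/

section HopfBC

open HopfObj

variable {C : Type u} [Category.{v} C] [MonoidalCategory C]

lemma comul_whiskerLeft_trivRightCoaction (A B : C) [ComonObj A] [MonObj B] :
    Δ[A] ≫ A ◁ trivRightCoaction B A =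
      trivRightCoaction B A ≫ Δ[A] ▷ B ≫ (α_ A A B).hom := by
  simp only [trivRightCoaction, MonoidalCategory.whiskerLeft_comp, Category.assoc]
  rw [whisker_exchange_assoc, ← rightUnitor_inv_naturality_assoc]
  simp

lemma trivLeftAction_whiskerRight_mul (A B : C) [ComonObj A] [MonObj B] :
    trivLeftAction A B ▷ B ≫ μ[B] = (α_ A B B).hom ≫ A ◁ μ[B] ≫ trivLeftAction A B := by
  simp only [trivLeftAction, comp_whiskerRight, Category.assoc]
  rw [whisker_exchange_assoc, leftUnitor_naturality]
  simp

lemma tensorHom_trivLeftAction {A A' X X' : C} [ComonObj A] [ComonObj A'] (f : A ⟶ A')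
    (g : X ⟶ X') (hf : f ≫ ε[A'] = ε[A]) :
    (f ⊗ₘ g) ≫ trivLeftAction A' X' = trivLeftAction A X ≫ g := by
  rw [trivLeftAction, MonoidalCategory.tensorHom_def', Category.assoc,
    ← comp_whiskerRight_assoc, hf, whisker_exchange_assoc]
  simp [trivLeftAction]

lemma tensorHom_trivLeftAction_assoc {A A' X X' W : C} [ComonObj A] [ComonObj A'] (f : A ⟶ A')
    (g : X ⟶ X') (hf : f ≫ ε[A'] = ε[A]) (h : X' ⟶ W) :
    (f ⊗ₘ g) ≫ trivLeftAction A' X' ≫ h = trivLeftAction A X ≫ g ≫ h := by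
  rw [reassoc_of% tensorHom_trivLeftAction f g hf]

lemma trivRightCoaction_tensorHom {B B' Y Y' : C} [MonObj B] [MonObj B'] (g : Y ⟶ Y')
    (f : B ⟶ B') (hf : η[B] ≫ f = η[B']) :
    trivRightCoaction B Y ≫ (g ⊗ₘ f) = g ≫ trivRightCoaction B' Y' := by
  rw [trivRightCoaction, MonoidalCategory.tensorHom_def', Category.assoc,
    ← MonoidalCategory.whiskerLeft_comp_assoc, hf, whisker_exchange]
  simp [trivRightCoaction]

section Braided

variable [BraidedCategory C]

@[simp] lemma HopfBC.id_hom (A : HopfBC C) : HopfBC.Hom.hom (𝟙 A) = 𝟙 A.X := rfl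

@[simp]
lemma HopfBC.comp_hom {A B D : HopfBC C} (f : A ⟶ B) (g : B ⟶ D) :
    (f ≫ g).hom = f.hom ≫ g.hom := rfl

@[ext] lemma HopfBC.hom_ext {A B : HopfBC C} {f g : A ⟶ B} (h : f.hom = g.hom) : f = g :=
  HopfBC.Hom.ext h

instance (A B : HopfBC C) (f : A ⟶ B) : IsBimonHom f.hom := HopfBC.Hom.isBimonHom f

instance {A B : HopfBC C} (f : A ⟶ B) [IsIso f] : IsIso f.hom :=
  ⟨(inv f).hom, by rw [← HopfBC.comp_hom, IsIso.hom_inv_id, HopfBC.id_hom],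
    by rw [← HopfBC.comp_hom, IsIso.inv_hom_id, HopfBC.id_hom]⟩

/-- The trivial homomorphism. -/
def HopfBC.trivHom (A B : HopfBC C) : A ⟶ B :=
  HopfBC.Hom.mk (isBimonHom :=
    { one_hom := by simp
      mul_hom := by
        rw [BimonObj.mul_counit_assoc, Comon.tensorObj_counit, ← tensorHom_comp_tensorHom]
        simp only [Category.assoc]
        rw [MonoidalCategory.tensorHom_def η[B.X]]
        simp [unitors_equal]
      hom_counit := by simp
      hom_comul := by
        rw [Category.assoc, BimonObj.one_comul, MonObj.tensorObj.one_def,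
          ← tensorHom_comp_tensorHom, MonoidalCategory.tensorHom_def ε[A.X]]
        simp [unitors_inv_equal] }) (ε[A.X] ≫ η[B.X])

-- The zero morphisms come from an abstract abelian structure. Precomposing zero with the trivial
-- endomorphism gives zero on one side and the trivial homomorphism on the other, since
-- homomorphisms preserve units.
@[simp] lemma HopfBC.zero_hom [HasZeroMorphisms (HopfBC C)] (A B : HopfBC C) :
    (0 : A ⟶ B).hom = ε[A.X] ≫ η[B.X] := by
  have h : HopfBC.trivHom A A ≫ (0 : A ⟶ B) = HopfBC.trivHom A B := by
    ext
    simp [HopfBC.trivHom, -comp_zero]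
  rw [comp_zero] at h
  rw [h]
  rfl

lemma HopfBC.comp_eq_zero_iff [HasZeroMorphisms (HopfBC C)] {A B D : HopfBC C} (f : A ⟶ B)
    (g : B ⟶ D) : f ≫ g = 0 ↔ f.hom ≫ g.hom = ε[A.X] ≫ η[D.X] := by
  rw [HopfBC.hom_ext_iff, HopfBC.zero_hom, HopfBC.comp_hom]

end Braided

variable [SymmetricCategory C]

lemma isRightCoaction_coactionThrough {A B : HopfBC C} (ξ : A ⟶ B) :
    IsRightCoaction B.X A.X (coactionThrough ξ) where
  coassoc := by
    simp only [coactionThrough, Category.assoc, ← MonoidalCategory.whiskerLeft_comp,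
      IsComonHom.hom_comul, comp_whiskerRight, whisker_assoc, Iso.inv_hom_id, Category.comp_id]
    rw [whisker_exchange_assoc, ComonObj.comul_assoc_flip_assoc]
    simp [MonoidalCategory.tensorHom_def']
  counit := by
    simp only [coactionThrough, Category.assoc, ← MonoidalCategory.whiskerLeft_comp,
      IsComonHom.hom_counit, ComonObj.comul_counit]

lemma isLeftAction_actionThrough {A B : HopfBC C} (ξ : A ⟶ B) :
    IsLeftAction A.X B.X (actionThrough ξ) where
  assoc := by
    simp only [actionThrough, ← comp_whiskerRight_assoc, IsMonHom.mul_hom,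
      MonoidalCategory.whiskerLeft_comp, Category.assoc]
    rw [whisker_exchange_assoc]
    simp [MonoidalCategory.tensorHom_def']
  unit := by
    simp only [actionThrough, ← comp_whiskerRight_assoc, IsMonHom.one_hom, MonObj.one_mul]

lemma mul_coactionThrough {A B : HopfBC C} (ξ : A ⟶ B) :
    μ[A.X] ≫ coactionThrough ξ = (coactionThrough ξ ⊗ₘ coactionThrough ξ) ≫
      tensorμ A.X B.X A.X B.X ≫ (μ[A.X] ⊗ₘ μ[B.X]) := by
  simp only [coactionThrough, BimonObj.mul_comul_assoc, ← tensorHom_comp_tensorHom,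
    ← id_tensorHom, Category.assoc]
  rw [tensorμ_natural_assoc]
  simp only [tensorHom_comp_tensorHom, IsMonHom.mul_hom, Category.id_comp, id_tensorHom_id,
    Category.comp_id]

lemma mul_trivRightCoaction {A B : C} [MonObj A] [MonObj B] :
    μ[A] ≫ trivRightCoaction B A = (trivRightCoaction B A ⊗ₘ trivRightCoaction B A) ≫
      tensorμ A B A B ≫ (μ[A] ⊗ₘ μ[B]) := by
  have := tensorRightCoaction_triv (C := C) B A B A
  rw [tensorRightCoaction] at this
  rw [reassoc_of% this]
  simp only [trivRightCoaction, Category.assoc, MonoidalCategory.tensorHom_def',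
    ← MonoidalCategory.whiskerLeft_comp_assoc, MonObj.tensorObj.one_def]
  rw [rightUnitor_inv_naturality_assoc, ← whisker_exchange]
  simp

lemma actionThrough_comul {A B : HopfBC C} (ξ : A ⟶ B) :
    actionThrough ξ ≫ Δ[B.X] = (Δ[A.X] ⊗ₘ Δ[B.X]) ≫ tensorμ A.X A.X B.X B.X ≫
      (actionThrough ξ ⊗ₘ actionThrough ξ) := by
  simp only [actionThrough, Category.assoc, BimonObj.mul_comul, ← tensorHom_id,
    ← tensorHom_comp_tensorHom]
  rw [← tensorμ_natural_assoc]
  simp only [tensorHom_comp_tensorHom_assoc, IsComonHom.hom_comul]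

lemma trivLeftAction_comul {A B : C} [ComonObj A] [ComonObj B] :
    trivLeftAction A B ≫ Δ[B] = (Δ[A] ⊗ₘ Δ[B]) ≫ tensorμ A A B B ≫
      (trivLeftAction A B ⊗ₘ trivLeftAction A B) := by
  have := tensorLeftAction_triv (C := C) A B A B
  rw [tensorLeftAction] at this
  rw [this]
  simp only [trivLeftAction, Category.assoc, MonoidalCategory.tensorHom_def',
    ← comp_whiskerRight_assoc, Comon.tensorObj_counit]
  rw [← leftUnitor_naturality, ← whisker_exchange_assoc]
  simp

lemma comul_whiskerLeft_coactionThrough {A B : HopfBC C} (ξ : A ⟶ B) :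
    Δ[A.X] ≫ A.X ◁ coactionThrough ξ =
      coactionThrough ξ ≫ Δ[A.X] ▷ B.X ≫ (α_ A.X A.X B.X).hom := by
  simp only [coactionThrough, MonoidalCategory.whiskerLeft_comp, Category.assoc]
  rw [whisker_exchange_assoc, ComonObj.comul_assoc_flip_assoc]
  simp

lemma actionThrough_whiskerRight_mul {A B : HopfBC C} (ξ : A ⟶ B) :
    actionThrough ξ ▷ B.X ≫ μ[B.X] =
      (α_ A.X B.X B.X).hom ≫ A.X ◁ μ[B.X] ≫ actionThrough ξ := by
  simp only [actionThrough, comp_whiskerRight, Category.assoc]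
  rw [whisker_exchange_assoc]
  simp

lemma comul_whiskerRight_of_isCommComonObj (A : C) [ComonObj A] [IsCommComonObj A] {X : C}
    (f : A ⟶ X) : Δ[A] ≫ f ▷ A = Δ[A] ≫ A ◁ f ≫ (β_ A X).hom := by
  rw [BraidedCategory.braiding_naturality_right, IsCommComonObj.comul_comm_assoc]

lemma whiskerLeft_mul_of_isCommMonObj (A : C) [MonObj A] [IsCommMonObj A] {X : C}
    (f : X ⟶ A) : A ◁ f ≫ μ[A] = (β_ A X).hom ≫ f ▷ A ≫ μ[A] := by
  rw [← BraidedCategory.braiding_naturality_right_assoc, IsCommMonObj.mul_comm]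

section Sub

variable {A E : C} (i : E ⟶ A)

lemma isCommMonObj_of_mono [MonObj A] [MonObj E] [IsMonHom i] [Mono i] [IsCommMonObj A] :
    IsCommMonObj E where
  mul_comm := by
    rw [← cancel_mono i, Category.assoc, IsMonHom.mul_hom,
      ← BraidedCategory.braiding_naturality_assoc, IsCommMonObj.mul_comm]

lemma isCommComonObj_of_mono [ComonObj A] [ComonObj E] [IsComonHom i] [Mono (i ⊗ₘ i)]
    [IsCommComonObj A] : IsCommComonObj E where
  comul_comm := by
    rw [← cancel_mono (i ⊗ₘ i), Category.assoc, ← BraidedCategory.braiding_naturality,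
      ← IsComonHom.hom_comul, ← IsComonHom.hom_comul_assoc, IsCommComonObj.comul_comm]

lemma isCommMonObj_of_epi [MonObj A] [MonObj E] (p : A ⟶ E) [IsMonHom p] [Epi (p ⊗ₘ p)]
    [IsCommMonObj A] : IsCommMonObj E where
  mul_comm := by
    rw [← cancel_epi (p ⊗ₘ p), BraidedCategory.braiding_naturality_assoc, ← IsMonHom.mul_hom,
      IsCommMonObj.mul_comm_assoc]

lemma isCommComonObj_of_epi [ComonObj A] [ComonObj E] (p : A ⟶ E) [IsComonHom p] [Epi p]
    [IsCommComonObj A] : IsCommComonObj E where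
  comul_comm := by
    rw [← cancel_epi p, IsComonHom.hom_comul_assoc, BraidedCategory.braiding_naturality,
      IsCommComonObj.comul_comm_assoc, IsComonHom.hom_comul]

lemma mono_whiskerRight (h : ∀ X : C, Mono (X ◁ i)) (X : C) : Mono (i ▷ X) := by
  have := h X
  rw [show i ▷ X = (β_ E X).hom ≫ X ◁ i ≫ (β_ A X).inv by simp]
  infer_instance

/-- The triple tensor power is factored into whiskerings of one `i` at a time, each conjugate by
associators and braidings to a left whiskering. It serves to check coassociativity on a Hopf kernel.
-/
lemma mono_tensorHom_tensorHom (h : ∀ X : C, Mono (X ◁ i)) : Mono (i ⊗ₘ i ⊗ₘ i) := by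
  have h₁ (X Y : C) : Mono (X ◁ Y ◁ i) := by
    have := h (X ⊗ Y)
    rw [show X ◁ Y ◁ i = (α_ X Y E).inv ≫ (X ⊗ Y) ◁ i ≫ (α_ X Y A).hom by simp]
    infer_instance
  have h₂ (X Y : C) : Mono (X ◁ i ▷ Y) := by
    have := h₁ X Y
    rw [show X ◁ i ▷ Y = X ◁ (β_ E Y).hom ≫ X ◁ Y ◁ i ≫ X ◁ (β_ A Y).inv by
      simp [← MonoidalCategory.whiskerLeft_comp]]
    infer_instance
  have := h₁ E E
  have := h₂ E A
  have := mono_whiskerRight i h (A ⊗ A)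
  rw [MonoidalCategory.tensorHom_def', MonoidalCategory.tensorHom_def',
    MonoidalCategory.whiskerLeft_comp]
  infer_instance

lemma epi_whiskerRight (h : ∀ X : C, Epi (X ◁ i)) (X : C) : Epi (i ▷ X) := by
  have := h X
  rw [show i ▷ X = (β_ E X).hom ≫ X ◁ i ≫ (β_ A X).inv by simp]
  infer_instance

lemma epi_tensorHom_tensorHom (h : ∀ X : C, Epi (X ◁ i)) : Epi ((i ⊗ₘ i) ⊗ₘ i) := by
  have h₁ (X Y : C) : Epi (X ◁ Y ◁ i) := by
    have := h (X ⊗ Y)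
    rw [show X ◁ Y ◁ i = (α_ X Y E).inv ≫ (X ⊗ Y) ◁ i ≫ (α_ X Y A).hom by simp]
    infer_instance
  have h₂ (X Y : C) : Epi ((X ◁ i) ▷ Y) := by
    have := h₁ Y X
    rw [show (X ◁ i) ▷ Y = (β_ _ Y).hom ≫ Y ◁ X ◁ i ≫ (β_ _ Y).inv by
      rw [← BraidedCategory.braiding_naturality_left_assoc, Iso.hom_inv_id, Category.comp_id]]
    infer_instance
  have h₃ (X Y : C) : Epi (i ▷ X ▷ Y) := by
    have := epi_whiskerRight i h (X ⊗ Y)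
    rw [show i ▷ X ▷ Y = (α_ E X Y).hom ≫ i ▷ (X ⊗ Y) ≫ (α_ A X Y).inv by simp]
    infer_instance
  have := h₃ E E
  have := h₂ A E
  have := h (A ⊗ A)
  rw [MonoidalCategory.tensorHom_def, MonoidalCategory.tensorHom_def, comp_whiskerRight]
  infer_instance

end Sub

lemma antipode_comul_of_isCommComonObj (A : C) [HopfObj A] [IsCommComonObj A] :
    𝒮[A] ≫ Δ[A] = Δ[A] ≫ (𝒮[A] ⊗ₘ 𝒮[A]) := by
  rw [antipode_comul, IsCommComonObj.comul_comm_assoc]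

lemma mul_antipode_of_isCommMonObj (A : C) [HopfObj A] [IsCommMonObj A] :
    μ[A] ≫ 𝒮[A] = (𝒮[A] ⊗ₘ 𝒮[A]) ≫ μ[A] := by
  rw [mul_antipode, IsCommMonObj.mul_comm]

/-- The coaction through `ξ` is multiplicative and compatible with the antipode, so coinvariants are
closed under these operations. The comultiplication is the delicate one: it must land in the tensor
square of the equalizer, which costability describes as an equalizer. -/
theorem exists_kernel_isEqualizer [HasEqualizers C] (hC : IsCostable C) {A B : HopfBC C}
    (ξ : A ⟶ B) : ∃ (K : HopfBC C) (k : K ⟶ A),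
      IsEqualizer (coactionThrough ξ) (trivRightCoaction B.X A.X) k.hom := by
  let i := equalizer.ι (coactionThrough ξ) (trivRightCoaction B.X A.X)
  have hi : IsEqualizer _ _ i := isEqualizer_equalizer _ _
  have hβ := isRightCoaction_coactionThrough ξ
  have h₂ := hC.isEqualizer_tensor hβ hβ hi hi
  have : Mono i := hi.mono
  have : Mono (i ⊗ₘ i) := h₂.mono
  have : Mono (i ⊗ₘ i ⊗ₘ i) :=
    mono_tensorHom_tensorHom i fun X => (hC.isEqualizer_whiskerLeft hβ hi X).mono
  obtain ⟨e, he⟩ := hi.exists_lift η[A.X] (by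
    simp only [coactionThrough, trivRightCoaction, BimonObj.one_comul_assoc,
      MonObj.tensorObj.one_def]
    simp [MonoidalCategory.tensorHom_def, ← MonoidalCategory.whiskerLeft_comp, unitors_inv_equal])
  obtain ⟨m, hm⟩ := hi.exists_lift ((i ⊗ₘ i) ≫ μ[A.X]) (by
    rw [Category.assoc, Category.assoc, mul_coactionThrough, mul_trivRightCoaction,
      tensorHom_comp_tensorHom_assoc, hi.condition, tensorHom_comp_tensorHom_assoc])
  obtain ⟨d, hd⟩ := h₂.exists_lift (i ≫ Δ[A.X]) (by
    have h₁ : i ≫ Δ[A.X] ≫ A.X ◁ coactionThrough ξ =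
        i ≫ Δ[A.X] ≫ A.X ◁ trivRightCoaction B.X A.X := by
      rw [comul_whiskerLeft_coactionThrough, comul_whiskerLeft_trivRightCoaction,
        reassoc_of% hi.condition]
    -- Coassociativity gives coinvariance in the second factor only; cocommutativity moves it to the
    -- first.
    have h₂ : i ≫ Δ[A.X] ≫ coactionThrough ξ ▷ A.X =
        i ≫ Δ[A.X] ≫ trivRightCoaction B.X A.X ▷ A.X := by
      rw [comul_whiskerRight_of_isCommComonObj, reassoc_of% h₁,
        comul_whiskerRight_of_isCommComonObj]
    rw [Category.assoc, Category.assoc, MonoidalCategory.tensorHom_def, reassoc_of% h₂,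
      ← whisker_exchange, reassoc_of% h₁, whisker_exchange, ← MonoidalCategory.tensorHom_def])
  obtain ⟨s, hs⟩ := hi.exists_lift (i ≫ 𝒮[A.X]) (by
    have h₁ : 𝒮[A.X] ≫ coactionThrough ξ = coactionThrough ξ ≫ (𝒮[A.X] ⊗ₘ 𝒮[B.X]) := by
      simp only [coactionThrough, Category.assoc]
      rw [← Category.assoc, antipode_comul_of_isCommComonObj]
      simp only [Category.assoc, ← id_tensorHom, tensorHom_comp_tensorHom, hom_antipode,
        Category.id_comp, Category.comp_id]
    rw [Category.assoc, Category.assoc, h₁, reassoc_of% hi.condition]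
    rw [trivRightCoaction_tensorHom _ _ (one_antipode _)])
  let := hopfObjOfMono i e m d s he hm hd hs
  have hhom : IsBimonHom i :=
    { one_hom := he, mul_hom := hm, hom_counit := rfl, hom_comul := hd.symm }
  have := isCommMonObj_of_mono i
  have := isCommComonObj_of_mono i
  exact ⟨HopfBC.mk (equalizer (coactionThrough ξ) (trivRightCoaction B.X A.X)), ⟨i⟩, hi⟩

/-- Dual to the kernel: here the multiplication is the delicate structure, and commutativity of `B`
makes it descend in both variables. -/
theorem exists_cokernel_isCoequalizer [HasCoequalizers C] (hC : IsStable C) {A B : HopfBC C}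
    (ξ : A ⟶ B) : ∃ (Q : HopfBC C) (q : B ⟶ Q),
      IsCoequalizer (actionThrough ξ) (trivLeftAction A.X B.X) q.hom := by
  let p := coequalizer.π (actionThrough ξ) (trivLeftAction A.X B.X)
  have hp : IsCoequalizer _ _ p := isCoequalizer_coequalizer _ _
  have hα := isLeftAction_actionThrough ξ
  have h₂ := hC.isCoequalizer_tensor hα hα hp hp
  have : Epi p := hp.epi
  have : Epi (p ⊗ₘ p) := h₂.epi
  have : Epi ((p ⊗ₘ p) ⊗ₘ p) :=
    epi_tensorHom_tensorHom p fun X => (hC.isCoequalizer_whiskerLeft hα hp X).epi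
  obtain ⟨c, hc⟩ := hp.exists_desc ε[B.X] (by
    simp only [actionThrough, trivLeftAction, BimonObj.mul_counit, Category.assoc,
      Comon.tensorObj_counit]
    simp [MonoidalCategory.tensorHom_def, ← comp_whiskerRight_assoc])
  obtain ⟨d, hd⟩ := hp.exists_desc (Δ[B.X] ≫ (p ⊗ₘ p)) (by
    rw [reassoc_of% actionThrough_comul, reassoc_of% trivLeftAction_comul,
      tensorHom_comp_tensorHom, hp.condition, tensorHom_comp_tensorHom])
  obtain ⟨m, hm⟩ := h₂.exists_desc (μ[B.X] ≫ p) (by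
    have h₁ : actionThrough ξ ▷ B.X ≫ μ[B.X] ≫ p =
        trivLeftAction A.X B.X ▷ B.X ≫ μ[B.X] ≫ p := by
      rw [reassoc_of% actionThrough_whiskerRight_mul,
        reassoc_of% trivLeftAction_whiskerRight_mul, hp.condition]
    have h₂ : B.X ◁ actionThrough ξ ≫ μ[B.X] ≫ p =
        B.X ◁ trivLeftAction A.X B.X ≫ μ[B.X] ≫ p := by
      rw [reassoc_of% whiskerLeft_mul_of_isCommMonObj, h₁,
        reassoc_of% whiskerLeft_mul_of_isCommMonObj]
    rw [MonoidalCategory.tensorHom_def, Category.assoc, h₂, ← whisker_exchange_assoc, h₁,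
      whisker_exchange_assoc, ← tensorHom_def_assoc])
  obtain ⟨s, hs⟩ := hp.exists_desc (𝒮[B.X] ≫ p) (by
    have h₁ : actionThrough ξ ≫ 𝒮[B.X] = (𝒮[A.X] ⊗ₘ 𝒮[B.X]) ≫ actionThrough ξ := by
      simp only [actionThrough, Category.assoc, mul_antipode_of_isCommMonObj]
      simp only [← tensorHom_id, tensorHom_comp_tensorHom_assoc, hom_antipode,
        Category.id_comp, Category.comp_id]
    rw [reassoc_of% h₁, hp.condition]
    rw [tensorHom_trivLeftAction_assoc _ _ (antipode_counit _)])
  let := hopfObjOfEpi p c d m s hc hd hm hs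
  have hhom : IsBimonHom p :=
    { one_hom := rfl, mul_hom := hm.symm, hom_counit := hc, hom_comul := hd }
  have := isCommMonObj_of_epi p
  have := isCommComonObj_of_epi p
  exact ⟨HopfBC.mk (coequalizer (actionThrough ξ) (trivLeftAction A.X B.X)), ⟨p⟩, hp⟩

end HopfBC

/-! ### Abstract kernels and cokernels are equalizers and coequalizers in `C` -/

section Exact

variable {C : Type u} [Category.{v} C] [MonoidalCategory C] [SymmetricCategory C]

lemma isBimonHom_of_comp_mono {A B D : C} [BimonObj A] [BimonObj B] [BimonObj D] (f : A ⟶ B)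
    (g : B ⟶ D) [IsBimonHom g] [IsBimonHom (f ≫ g)] [Mono g] [Mono (g ⊗ₘ g)] : IsBimonHom f where
  one_hom := by rw [← cancel_mono g, Category.assoc, IsMonHom.one_hom, IsMonHom.one_hom]
  mul_hom := by
    rw [← cancel_mono g, Category.assoc, IsMonHom.mul_hom, Category.assoc, IsMonHom.mul_hom,
      tensorHom_comp_tensorHom_assoc]
  hom_counit := by rw [← IsComonHom.hom_counit g, ← Category.assoc, IsComonHom.hom_counit (f ≫ g)]
  hom_comul := by
    rw [← cancel_mono (g ⊗ₘ g), Category.assoc, ← IsComonHom.hom_comul, ← Category.assoc,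
      IsComonHom.hom_comul, Category.assoc, tensorHom_comp_tensorHom]

lemma isBimonHom_of_epi_comp {A B D : C} [BimonObj A] [BimonObj B] [BimonObj D] (f : A ⟶ B)
    (g : B ⟶ D) [IsBimonHom f] [IsBimonHom (f ≫ g)] [Epi f] [Epi (f ⊗ₘ f)] : IsBimonHom g where
  one_hom := by rw [← IsMonHom.one_hom f, Category.assoc, IsMonHom.one_hom (f ≫ g)]
  mul_hom := by
    rw [← cancel_epi (f ⊗ₘ f), ← IsMonHom.mul_hom_assoc, IsMonHom.mul_hom (f ≫ g),
      tensorHom_comp_tensorHom_assoc]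
  hom_counit := by
    rw [← cancel_epi f, ← Category.assoc, IsComonHom.hom_counit, IsComonHom.hom_counit]
  hom_comul := by
    rw [← cancel_epi f, ← Category.assoc, IsComonHom.hom_comul, IsComonHom.hom_comul_assoc,
      tensorHom_comp_tensorHom]

variable {A B : HopfBC C}

lemma coactionThrough_counit (ξ : A ⟶ B) :
    coactionThrough ξ ≫ ε[A.X] ▷ B.X ≫ (λ_ B.X).hom = ξ.hom := by
  rw [coactionThrough, Category.assoc, whisker_exchange_assoc]
  simp

lemma trivRightCoaction_counit (A B : C) [ComonObj A] [MonObj B] :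
    trivRightCoaction B A ≫ ε[A] ▷ B ≫ (λ_ B).hom = ε[A] ≫ η[B] := by
  rw [trivRightCoaction, Category.assoc, whisker_exchange_assoc]
  simp [unitors_equal]

lemma one_actionThrough (ξ : A ⟶ B) :
    (ρ_ A.X).inv ≫ A.X ◁ η[B.X] ≫ actionThrough ξ = ξ.hom := by
  rw [actionThrough, whisker_exchange_assoc]
  simp

lemma one_trivLeftAction (A B : C) [ComonObj A] [MonObj B] :
    (ρ_ A).inv ≫ A ◁ η[B] ≫ trivLeftAction A B = ε[A] ≫ η[B] := by
  rw [trivLeftAction, whisker_exchange_assoc]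
  simp [unitors_equal]

variable [HasZeroMorphisms (HopfBC C)]

lemma comp_coactionThrough_of_comp_eq_zero {X : HopfBC C} (f : X ⟶ A) (ξ : A ⟶ B)
    (h : f ≫ ξ = 0) : f.hom ≫ coactionThrough ξ = f.hom ≫ trivRightCoaction B.X A.X := by
  rw [HopfBC.comp_eq_zero_iff] at h
  rw [coactionThrough, IsComonHom.hom_comul_assoc, ← id_tensorHom, tensorHom_comp_tensorHom, h,
    Category.comp_id, trivRightCoaction, ← Category.comp_id f.hom, ← tensorHom_comp_tensorHom,
    ComonObj.comul_counit_hom_assoc]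
  simp

lemma actionThrough_comp_of_comp_eq_zero {X : HopfBC C} (ξ : A ⟶ B) (f : B ⟶ X)
    (h : ξ ≫ f = 0) : actionThrough ξ ≫ f.hom = trivLeftAction A.X B.X ≫ f.hom := by
  rw [HopfBC.comp_eq_zero_iff] at h
  rw [actionThrough, Category.assoc, IsMonHom.mul_hom, ← tensorHom_id,
    tensorHom_comp_tensorHom_assoc, h, Category.id_comp, trivLeftAction,
    MonoidalCategory.tensorHom_def]
  simp only [comp_whiskerRight, Category.assoc]
  rw [← whisker_exchange_assoc]
  simp

lemma comp_eq_zero_of_comp_coactionThrough {X : HopfBC C} (f : X ⟶ A) (ξ : A ⟶ B)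
    (h : f.hom ≫ coactionThrough ξ = f.hom ≫ trivRightCoaction B.X A.X) : f ≫ ξ = 0 := by
  rw [HopfBC.comp_eq_zero_iff, ← coactionThrough_counit ξ, reassoc_of% h, trivRightCoaction_counit,
    IsComonHom.hom_counit_assoc]

lemma comp_eq_zero_of_actionThrough_comp {X : HopfBC C} (ξ : A ⟶ B) (f : B ⟶ X)
    (h : actionThrough ξ ≫ f.hom = trivLeftAction A.X B.X ≫ f.hom) : ξ ≫ f = 0 := by
  rw [HopfBC.comp_eq_zero_iff, ← one_actionThrough, Category.assoc, Category.assoc, h,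
    reassoc_of% one_trivLeftAction, IsMonHom.one_hom]

/-- The Hopf submonoid built on the equalizer maps to `A` and composes to zero with `ξ`, while `k`
equalizes the two coactions. The two universal properties give mutually inverse comparison
homomorphisms. -/
theorem isEqualizer_of_isLimit [HasEqualizers C] (hC : IsCostable C) {K : HopfBC C} {k : K ⟶ A}
    {ξ : A ⟶ B} {w : k ≫ ξ = 0} (hk : IsLimit (KernelFork.ofι k w)) :
    IsEqualizer (coactionThrough ξ) (trivRightCoaction B.X A.X) k.hom := by
  obtain ⟨E, i, hi⟩ := exists_kernel_isEqualizer hC ξ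
  have hβ := isRightCoaction_coactionThrough ξ
  have := hi.mono
  have := (hC.isEqualizer_tensor hβ hβ hi hi).mono
  obtain ⟨l, hl⟩ := hi.exists_lift k.hom (comp_coactionThrough_of_comp_eq_zero _ _ w)
  have : IsBimonHom (l ≫ i.hom) := hl ▸ inferInstance
  have := isBimonHom_of_comp_mono l i.hom
  let l' : K ⟶ E := ⟨l⟩
  have hl' : l' ≫ i = k := by ext; exact hl
  obtain ⟨u, hu⟩ := KernelFork.IsLimit.lift' hk i
    (comp_eq_zero_of_comp_coactionThrough _ _ hi.condition)
  change u ≫ k = i at hu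
  have h₁ : u ≫ l' = 𝟙 E := by
    ext
    rw [← cancel_mono i.hom, ← HopfBC.comp_hom, Category.assoc, hl', hu]
    simp
  have h₂ : l' ≫ u = 𝟙 K := Fork.IsLimit.hom_ext hk (by
    change (l' ≫ u) ≫ k = 𝟙 K ≫ k
    rw [Category.assoc, hu, hl', Category.id_comp])
  have : IsIso l := ⟨u.hom, congrArg HopfBC.Hom.hom h₂, congrArg HopfBC.Hom.hom h₁⟩
  exact hi.of_iso l hl

theorem isCoequalizer_of_isColimit [HasCoequalizers C] (hC : IsStable C) {Q : HopfBC C}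
    {q : B ⟶ Q} {ξ : A ⟶ B} {w : ξ ≫ q = 0} (hq : IsColimit (CokernelCofork.ofπ q w)) :
    IsCoequalizer (actionThrough ξ) (trivLeftAction A.X B.X) q.hom := by
  obtain ⟨E, p, hp⟩ := exists_cokernel_isCoequalizer hC ξ
  have hα := isLeftAction_actionThrough ξ
  have := hp.epi
  have := (hC.isCoequalizer_tensor hα hα hp hp).epi
  obtain ⟨l, hl⟩ := hp.exists_desc q.hom (actionThrough_comp_of_comp_eq_zero _ _ w)
  have : IsBimonHom (p.hom ≫ l) := hl ▸ inferInstance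
  have := isBimonHom_of_epi_comp p.hom l
  let l' : E ⟶ Q := ⟨l⟩
  have hl' : p ≫ l' = q := by ext; exact hl
  obtain ⟨u, hu⟩ := CokernelCofork.IsColimit.desc' hq p
    (comp_eq_zero_of_actionThrough_comp _ _ hp.condition)
  change q ≫ u = p at hu
  have h₁ : l' ≫ u = 𝟙 E := by
    ext
    rw [← cancel_epi p.hom, ← HopfBC.comp_hom, reassoc_of% hl', hu]
    simp
  have h₂ : u ≫ l' = 𝟙 Q := Cofork.IsColimit.hom_ext hq (by
    change q ≫ u ≫ l' = q ≫ 𝟙 Q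
    rw [reassoc_of% hu, hl', Category.comp_id])
  have : IsIso l := ⟨u.hom, congrArg HopfBC.Hom.hom h₁, congrArg HopfBC.Hom.hom h₂⟩
  exact hp.of_iso l hl

/-- The kernel and the cokernel of a short exact sequence are an equalizer and a coequalizer in the
underlying category. -/
structure IsExtension {N A Q : HopfBC C} (n : N ⟶ A) (p : A ⟶ Q) : Prop where
  ker : IsEqualizer (coactionThrough p) (trivRightCoaction Q.X A.X) n.hom
  cok : IsCoequalizer (actionThrough n) (trivLeftAction N.X A.X) p.hom

end Exact

/-! ### Translations by points and contractions by functionals -/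

section Translation

variable {C : Type u} [Category.{v} C] [MonoidalCategory C]

@[simp]
lemma leftUnitor_inv_rightUnitor_hom : (λ_ (𝟙_ C)).inv ≫ (ρ_ (𝟙_ C)).hom = 𝟙 (𝟙_ C) := by
  simp [unitors_inv_equal]

@[simp] lemma leftUnitor_inv_rightUnitor_hom_assoc {W : C} (h : 𝟙_ C ⟶ W) :
    (λ_ (𝟙_ C)).inv ≫ (ρ_ (𝟙_ C)).hom ≫ h = h := by
  rw [reassoc_of% leftUnitor_inv_rightUnitor_hom (C := C)]

@[simp]
lemma rightUnitor_inv_leftUnitor_hom : (ρ_ (𝟙_ C)).inv ≫ (λ_ (𝟙_ C)).hom = 𝟙 (𝟙_ C) := by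
  simp [unitors_equal]

@[simp] lemma rightUnitor_inv_leftUnitor_hom_assoc {W : C} (h : 𝟙_ C ⟶ W) :
    (ρ_ (𝟙_ C)).inv ≫ (λ_ (𝟙_ C)).hom ≫ h = h := by
  rw [reassoc_of% rightUnitor_inv_leftUnitor_hom (C := C)]

/-- Left multiplication by a point of a monoid. -/
def lmul {A : C} [MonObj A] (x : 𝟙_ C ⟶ A) : A ⟶ A := (λ_ A).inv ≫ x ▷ A ≫ μ[A]

/-- Contraction of the comultiplication with a functional on the right. -/
def rcomul {A : C} [ComonObj A] (t : A ⟶ 𝟙_ C) : A ⟶ A := Δ[A] ≫ A ◁ t ≫ (ρ_ A).hom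

lemma mul_lmul {A : C} [MonObj A] (x : 𝟙_ C ⟶ A) : μ[A] ≫ lmul x = lmul x ▷ A ≫ μ[A] := by
  simp only [lmul, comp_whiskerRight, Category.assoc, MonObj.mul_assoc]
  rw [leftUnitor_inv_naturality_assoc, whisker_exchange_assoc]
  simp

lemma rcomul_comul {A : C} [ComonObj A] (t : A ⟶ 𝟙_ C) :
    rcomul t ≫ Δ[A] = Δ[A] ≫ A ◁ rcomul t := by
  simp only [rcomul, MonoidalCategory.whiskerLeft_comp, Category.assoc]
  rw [← rightUnitor_naturality, whisker_exchange_assoc, ComonObj.comul_assoc_flip_assoc]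
  simp

lemma rcomul_comul_assoc {A W : C} [ComonObj A] (t : A ⟶ 𝟙_ C) (h : A ⊗ A ⟶ W) :
    rcomul t ≫ Δ[A] ≫ h = Δ[A] ≫ A ◁ rcomul t ≫ h := by
  rw [reassoc_of% rcomul_comul t]

lemma lmul_comp_hom {A B : C} [MonObj A] [MonObj B] (x : 𝟙_ C ⟶ A) (f : A ⟶ B) [IsMonHom f] :
    lmul x ≫ f = f ≫ lmul (x ≫ f) := by
  simp only [lmul, Category.assoc, IsMonHom.mul_hom, MonoidalCategory.tensorHom_def]
  rw [leftUnitor_inv_naturality_assoc, whisker_exchange_assoc, comp_whiskerRight_assoc]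

lemma comp_rcomul {A B : C} [ComonObj A] [ComonObj B] (t : B ⟶ 𝟙_ C) (f : A ⟶ B)
    [IsComonHom f] : f ≫ rcomul t = rcomul (f ≫ t) ≫ f := by
  simp only [rcomul, Category.assoc, IsComonHom.hom_comul_assoc, MonoidalCategory.tensorHom_def,
    MonoidalCategory.whiskerLeft_comp]
  rw [← rightUnitor_naturality]
  simp only [whisker_exchange_assoc]

lemma comp_rcomul_assoc {A B W : C} [ComonObj A] [ComonObj B] (t : B ⟶ 𝟙_ C) (f : A ⟶ B)
    [IsComonHom f] (h : B ⟶ W) : f ≫ rcomul t ≫ h = rcomul (f ≫ t) ≫ f ≫ h := by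
  rw [reassoc_of% comp_rcomul t f]

@[simp]
lemma one_lmul {A : C} [MonObj A] (x : 𝟙_ C ⟶ A) : η[A] ≫ lmul x = x := by
  rw [lmul, leftUnitor_inv_naturality_assoc, whisker_exchange_assoc]
  simp [unitors_inv_equal]

@[simp] lemma one_lmul_assoc {A W : C} [MonObj A] (x : 𝟙_ C ⟶ A) (h : A ⟶ W) :
    η[A] ≫ lmul x ≫ h = x ≫ h := by
  rw [reassoc_of% one_lmul x]

@[simp]
lemma rcomul_counit {A : C} [ComonObj A] (t : A ⟶ 𝟙_ C) : rcomul t ≫ ε[A] = t := by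
  rw [rcomul, Category.assoc, Category.assoc, ← rightUnitor_naturality, whisker_exchange_assoc]
  simp

end Translation

/-! ### Translations and contractions by integrals and cointegrals -/

section Integral

variable {C : Type u} [Category.{v} C] [MonoidalCategory C] [BraidedCategory C]

lemma IsNormalizedIntegral.lmul_eq {A : C} [BimonObj A] {σ : 𝟙_ C ⟶ A}
    (h : IsNormalizedIntegral A σ) : lmul σ = ε[A] ≫ σ := by
  rw [lmul, h.left, MonoidalCategory.tensorHom_def']
  simp

lemma IsNormalizedCointegral.rcomul_eq {A : C} [BimonObj A] {τ : A ⟶ 𝟙_ C}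
    (h : IsNormalizedCointegral A τ) : rcomul τ = τ ≫ η[A] := by
  rw [rcomul, reassoc_of% h.right, MonoidalCategory.tensorHom_def']
  simp

lemma tensorμ_unit_left (A A' B : C) : tensorμ A (𝟙_ C) A' B ≫ (A ⊗ A') ◁ (λ_ B).hom =
    (ρ_ A).hom ▷ (A' ⊗ B) ≫ (α_ A A' B).inv := by
  simp only [tensorμ, braiding_tensorUnit_left]
  monoidal

end Integral

/-! ### Equivariance of translations and contractions -/

section Equivariance

variable {C : Type u} [Category.{v} C] [MonoidalCategory C] [SymmetricCategory C]

/-- The coaction is multiplicative, and a coinvariant point contributes only the unit to the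
`B`-factor; so translating by it does not touch that factor. -/
lemma lmul_coactionThrough {A B : HopfBC C} (ξ : A ⟶ B) {x : 𝟙_ C ⟶ A.X}
    (hx : x ≫ coactionThrough ξ = x ≫ trivRightCoaction B.X A.X) :
    lmul x ≫ coactionThrough ξ = coactionThrough ξ ≫ lmul x ▷ B.X := by
  have h₁ : (trivRightCoaction B.X A.X ⊗ₘ coactionThrough ξ) ≫ tensorμ A.X B.X A.X B.X ≫
      (μ[A.X] ⊗ₘ μ[B.X]) = A.X ◁ coactionThrough ξ ≫ (α_ A.X A.X B.X).inv ≫ μ[A.X] ▷ B.X := by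
    have : (trivRightCoaction B.X A.X ⊗ₘ coactionThrough ξ) =
      ((ρ_ A.X).inv ⊗ₘ coactionThrough ξ) ≫ ((𝟙 A.X ⊗ₘ η[B.X]) ⊗ₘ (𝟙 A.X ⊗ₘ 𝟙 B.X)) := by
      simp only [trivRightCoaction, tensorHom_comp_tensorHom, id_tensorHom,
        MonoidalCategory.whiskerLeft_id, Category.comp_id]
    rw [this, Category.assoc, tensorμ_natural_assoc, tensorHom_comp_tensorHom]
    have : (𝟙 A.X ⊗ₘ 𝟙 A.X) ≫ μ[A.X] ⊗ₘ (η[B.X] ⊗ₘ 𝟙 B.X) ≫ μ[B.X] =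
      (A.X ⊗ A.X) ◁ (λ_ B.X).hom ≫ μ[A.X] ▷ B.X := by
      simp [MonoidalCategory.tensorHom_def']
    rw [this, reassoc_of% tensorμ_unit_left, MonoidalCategory.tensorHom_def']
    simp
  rw [lmul, Category.assoc, Category.assoc, mul_coactionThrough]
  have h₂ : x ▷ A.X ≫ (coactionThrough ξ ⊗ₘ coactionThrough ξ) =
      x ▷ A.X ≫ (trivRightCoaction B.X A.X ⊗ₘ coactionThrough ξ) := by
    rw [MonoidalCategory.tensorHom_def, MonoidalCategory.tensorHom_def,
      ← comp_whiskerRight_assoc, hx, comp_whiskerRight_assoc]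
  rw [reassoc_of% h₂, h₁, ← whisker_exchange_assoc, ← leftUnitor_inv_naturality_assoc]
  simp

lemma actionThrough_rcomul {A B : HopfBC C} (ξ : A ⟶ B) {t : B.X ⟶ 𝟙_ C}
    (ht : actionThrough ξ ≫ t = trivLeftAction A.X B.X ≫ t) :
    actionThrough ξ ≫ rcomul t = A.X ◁ rcomul t ≫ actionThrough ξ := by
  have h₁ : (Δ[A.X] ⊗ₘ Δ[B.X]) ≫ tensorμ A.X A.X B.X B.X ≫
      (actionThrough ξ ⊗ₘ trivLeftAction A.X B.X) =
      A.X ◁ Δ[B.X] ≫ (α_ A.X B.X B.X).inv ≫ actionThrough ξ ▷ B.X := by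
    have : (actionThrough ξ ⊗ₘ trivLeftAction A.X B.X) =
      ((𝟙 A.X ⊗ₘ 𝟙 B.X) ⊗ₘ (ε[A.X] ⊗ₘ 𝟙 B.X)) ≫ (A.X ⊗ B.X) ◁ (λ_ B.X).hom ≫
        actionThrough ξ ▷ B.X := by
      simp [trivLeftAction, MonoidalCategory.tensorHom_def']
    rw [this, ← tensorμ_natural_assoc, reassoc_of% tensorμ_unit_left,
      tensorHom_comp_tensorHom_assoc, id_tensorHom, id_tensorHom_id, Category.comp_id,
      ComonObj.comul_counit, MonoidalCategory.tensorHom_def']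
    simp
  have h₂ : (actionThrough ξ ⊗ₘ trivLeftAction A.X B.X ≫ t) =
      (actionThrough ξ ⊗ₘ trivLeftAction A.X B.X) ≫ B.X ◁ t := by
    rw [← id_tensorHom, tensorHom_comp_tensorHom, Category.comp_id]
  rw [rcomul, reassoc_of% actionThrough_comul, ← id_tensorHom, tensorHom_comp_tensorHom_assoc, ht,
    Category.comp_id, h₂, Category.assoc, reassoc_of% h₁, id_tensorHom, ← whisker_exchange_assoc]
  simp

end Equivariance

/-! ### Formal properties of integrals along homomorphisms -/

section Along

variable {C : Type u} [Category.{v} C] [MonoidalCategory C] [BraidedCategory C]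

lemma IsRightIntegralAlong.comp {A B D : C} [BimonObj A] [BimonObj B] [BimonObj D] {f : A ⟶ B}
    {g : B ⟶ D} {m : B ⟶ A} {m' : D ⟶ B} (h : IsRightIntegralAlong f m)
    (h' : IsRightIntegralAlong g m') : IsRightIntegralAlong (f ≫ g) (m' ≫ m) where
  mul := by
    rw [comp_whiskerRight, Category.assoc, h.mul, ← whisker_exchange_assoc, reassoc_of% h'.mul,
      MonoidalCategory.whiskerLeft_comp, Category.assoc]
  comul := by
    rw [comp_whiskerRight, reassoc_of% h'.comul, whisker_exchange, reassoc_of% h.comul,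
      MonoidalCategory.whiskerLeft_comp, Category.assoc]

lemma IsRightIntegralAlong.left {A B : C} [BimonObj A] [BimonObj B] [IsCommMonObj A]
    [IsCommMonObj B] [IsCommComonObj A] [IsCommComonObj B] {f : A ⟶ B} {m : B ⟶ A}
    (h : IsRightIntegralAlong f m) : IsLeftIntegralAlong f m where
  mul := by
    rw [← IsCommMonObj.mul_comm A, BraidedCategory.braiding_naturality_right_assoc, h.mul,
      ← BraidedCategory.braiding_naturality_left_assoc, IsCommMonObj.mul_comm_assoc]
  comul := by
    rw [← IsCommComonObj.comul_comm B, Category.assoc, ← BraidedCategory.braiding_naturality_left,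
      reassoc_of% h.comul, BraidedCategory.braiding_naturality_right,
      IsCommComonObj.comul_comm_assoc]

lemma IsLeftIntegralAlong.right {A B : C} [BimonObj A] [BimonObj B] [IsCommMonObj A]
    [IsCommMonObj B] [IsCommComonObj A] [IsCommComonObj B] {f : A ⟶ B} {m : B ⟶ A}
    (h : IsLeftIntegralAlong f m) : IsRightIntegralAlong f m where
  mul := by
    rw [← IsCommMonObj.mul_comm A, BraidedCategory.braiding_naturality_left_assoc, h.mul,
      ← BraidedCategory.braiding_naturality_right_assoc, IsCommMonObj.mul_comm_assoc]
  comul := by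
    rw [← IsCommComonObj.comul_comm B, Category.assoc, ← BraidedCategory.braiding_naturality_right,
      reassoc_of% h.comul, BraidedCategory.braiding_naturality_left,
      IsCommComonObj.comul_comm_assoc]

lemma isRightIntegralAlong_inv {A B : C} [BimonObj A] [BimonObj B] (f : A ⟶ B) [IsBimonHom f]
    (g : B ⟶ A) (h : f ≫ g = 𝟙 A) (h' : g ≫ f = 𝟙 B) : IsRightIntegralAlong f g where
  mul := by
    have : IsIso f := ⟨g, h, h'⟩
    rw [← cancel_mono f, Category.assoc, IsMonHom.mul_hom, MonoidalCategory.tensorHom_def]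
    simp [h', ← comp_whiskerRight_assoc]
  comul := by
    have : IsIso f := ⟨g, h, h'⟩
    rw [← cancel_epi f, IsComonHom.hom_comul_assoc, MonoidalCategory.tensorHom_def']
    simp [reassoc_of% h, ← comp_whiskerRight, h]

end Along

/-! ### Sections and retractions of extensions given by averaging -/

section Extension

variable {C : Type u} [Category.{v} C] [MonoidalCategory C] [SymmetricCategory C]
  {N A Q : HopfBC C} {n : N ⟶ A} {p : A ⟶ Q}

lemma actionThrough_lmul (n : N ⟶ A) {σ : 𝟙_ C ⟶ N.X} (hσ : IsNormalizedIntegral N.X σ) :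
    actionThrough n ≫ lmul (σ ≫ n.hom) = trivLeftAction N.X A.X ≫ lmul (σ ≫ n.hom) := by
  rw [actionThrough, Category.assoc, mul_lmul, ← comp_whiskerRight_assoc, ← lmul_comp_hom,
    hσ.lmul_eq, Category.assoc, comp_whiskerRight_assoc, trivLeftAction, Category.assoc, lmul]
  simp

lemma rcomul_coactionThrough (p : A ⟶ Q) {τ : Q.X ⟶ 𝟙_ C} (hτ : IsNormalizedCointegral Q.X τ) :
    rcomul (p.hom ≫ τ) ≫ coactionThrough p =
      rcomul (p.hom ≫ τ) ≫ trivRightCoaction Q.X A.X := by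
  rw [coactionThrough, rcomul_comul_assoc, ← MonoidalCategory.whiskerLeft_comp, ← comp_rcomul,
    hτ.rcomul_eq, MonoidalCategory.whiskerLeft_comp, MonoidalCategory.whiskerLeft_comp,
    trivRightCoaction, rcomul]
  simp

/-- The properties of the integral along the projection of an extension that is induced by a
normalized integral of the kernel. -/
structure IsSection (n : N ⟶ A) (p : A ⟶ Q) (σ : 𝟙_ C ⟶ N.X) (s : Q.X ⟶ A.X) : Prop where
  fac : p.hom ≫ s = lmul (σ ≫ n.hom)
  comp_hom : s ≫ p.hom = 𝟙 Q.X
  integral : IsRightIntegralAlong p.hom s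

/-- The properties of the integral along the inclusion of an extension that is induced by a
normalized cointegral of the cokernel. -/
structure IsRetraction (n : N ⟶ A) (p : A ⟶ Q) (τ : Q.X ⟶ 𝟙_ C) (k : A.X ⟶ N.X) : Prop where
  fac : k ≫ n.hom = rcomul (p.hom ≫ τ)
  hom_comp : n.hom ≫ k = 𝟙 N.X
  integral : IsRightIntegralAlong n.hom k

lemma IsExtension.hom_comp_hom (h : IsExtension n p) :
    n.hom ≫ p.hom = ε[N.X] ≫ η[Q.X] := by
  rw [← coactionThrough_counit p, reassoc_of% h.ker.condition, trivRightCoaction_counit,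
    IsComonHom.hom_counit_assoc]

/-- Translation by `σ` absorbs the action of N, hence factors through the coequalizer `p`. The
factor is a section because `p` sends `σ` to the unit, and it inherits linearity and colinearity
from translation, stability keeping `p ▷ A.X` epi. -/
lemma IsExtension.exists_isSection [HasCoequalizers C] (hC : IsStable C) (h : IsExtension n p)
    {σ : 𝟙_ C ⟶ N.X} (hσ : IsNormalizedIntegral N.X σ) : ∃ s, IsSection n p σ s := by
  obtain ⟨s, hs⟩ := h.cok.exists_desc _ (actionThrough_lmul n hσ)
  have := h.cok.epi
  have hα := isLeftAction_actionThrough n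
  have := (hC.isCoequalizer_whiskerRight hα h.cok A.X).epi
  refine ⟨s, hs, ?_, ?_, ?_⟩
  · rw [← cancel_epi p.hom, reassoc_of% hs, lmul_comp_hom, Category.assoc, h.hom_comp_hom,
      reassoc_of% hσ.normalized, lmul]
    simp
  · rw [← cancel_epi (p.hom ▷ A.X), ← comp_whiskerRight_assoc, hs, ← mul_lmul, ← hs,
      IsMonHom.mul_hom_assoc, MonoidalCategory.tensorHom_def]
    simp
  · rw [← cancel_epi p.hom, reassoc_of% hs, IsComonHom.hom_comul_assoc]
    change _ = lmul _ ≫ coactionThrough p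
    -- The translating point comes from N, hence is coinvariant under Q, so translation is colinear.
    rw [lmul_coactionThrough, coactionThrough, MonoidalCategory.tensorHom_def']
    · simp [← comp_whiskerRight, hs]
    · rw [Category.assoc, Category.assoc, h.ker.condition]

/-- Contraction with the pulled-back cointegral has coinvariant image, hence lands in N. The left
integral conditions are the direct ones here, because `actionThrough` is a left action;
bicommutativity converts them. -/
lemma IsExtension.exists_isRetraction [HasEqualizers C] (hC : IsCostable C) (h : IsExtension n p)
    {τ : Q.X ⟶ 𝟙_ C} (hτ : IsNormalizedCointegral Q.X τ) : ∃ k, IsRetraction n p τ k := by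
  obtain ⟨k, hk⟩ := h.ker.exists_lift _ (rcomul_coactionThrough p hτ)
  have := h.ker.mono
  have hβ := isRightCoaction_coactionThrough p
  have := (hC.isEqualizer_whiskerLeft hβ h.ker A.X).mono
  refine ⟨k, hk, ?_, ?_⟩
  · rw [← cancel_mono n.hom, Category.assoc, hk, comp_rcomul, reassoc_of% h.hom_comp_hom,
      hτ.normalized, rcomul]
    simp
  · refine IsLeftIntegralAlong.right ⟨?_, ?_⟩
    · rw [← cancel_mono n.hom, Category.assoc, Category.assoc, Category.assoc, hk, IsMonHom.mul_hom,
        ← Category.assoc (n.hom ▷ A.X)]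
      change _ = actionThrough n ≫ _
      rw [actionThrough_rcomul, actionThrough, MonoidalCategory.tensorHom_def']
      · simp [← MonoidalCategory.whiskerLeft_comp_assoc, hk]
      · rw [reassoc_of% h.cok.condition]
    · rw [← cancel_mono (A.X ◁ n.hom), Category.assoc, ← MonoidalCategory.whiskerLeft_comp, hk,
        ← rcomul_comul, ← hk, Category.assoc, IsComonHom.hom_comul,
        MonoidalCategory.tensorHom_def]
      simp

end Extension

/-! ### Uniqueness of normalized integrals and cointegrals -/

section Uniqueness

variable {C : Type u} [Category.{v} C] [MonoidalCategory C]

lemma comp_lmul_eq {A : C} [MonObj A] (x y : 𝟙_ C ⟶ A) :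
    y ≫ lmul x = (λ_ (𝟙_ C)).inv ≫ (x ⊗ₘ y) ≫ μ[A] := by
  rw [lmul, leftUnitor_inv_naturality_assoc, whisker_exchange_assoc,
    MonoidalCategory.tensorHom_def, Category.assoc]

lemma rcomul_comp_eq {A : C} [ComonObj A] (s t : A ⟶ 𝟙_ C) :
    rcomul t ≫ s = Δ[A] ≫ (s ⊗ₘ t) ≫ (λ_ (𝟙_ C)).hom := by
  rw [rcomul, Category.assoc, Category.assoc, ← rightUnitor_naturality, whisker_exchange_assoc,
    MonoidalCategory.tensorHom_def, Category.assoc, unitors_equal]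

variable [BraidedCategory C]

/-- The product of the two integrals equals each of them, depending on which one absorbs the other.
-/
lemma IsNormalizedIntegral.unique {A : C} [BimonObj A] {σ σ' : 𝟙_ C ⟶ A}
    (h : IsNormalizedIntegral A σ) (h' : IsNormalizedIntegral A σ') : σ = σ' := by
  have h₁ : σ' ≫ lmul σ = σ := by
    rw [h.lmul_eq, reassoc_of% h'.normalized]
  have h₂ : σ' ≫ lmul σ = σ' := by
    rw [comp_lmul_eq, MonoidalCategory.tensorHom_def, Category.assoc, h'.right,
      MonoidalCategory.tensorHom_def, Category.assoc, ← comp_whiskerRight_assoc, h.normalized]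
    simp
  rw [← h₁, h₂]

lemma IsNormalizedCointegral.unique {A : C} [BimonObj A] {τ τ' : A ⟶ 𝟙_ C}
    (h : IsNormalizedCointegral A τ) (h' : IsNormalizedCointegral A τ') : τ = τ' := by
  have h₁ : rcomul τ ≫ τ' = τ := by
    rw [h.rcomul_eq, Category.assoc, h'.normalized, Category.comp_id]
  have h₂ : rcomul τ ≫ τ' = τ' := by
    rw [rcomul_comp_eq, MonoidalCategory.tensorHom_def, Category.assoc, reassoc_of% h'.left,
      MonoidalCategory.tensorHom_def, Category.assoc, ← MonoidalCategory.whiskerLeft_comp_assoc,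
      h.normalized]
    simp
  rw [← h₁, h₂]

end Uniqueness

/-! ### Computation of the morphism `fredholmIntegral` -/

section Invariant

variable {C : Type u} [Category.{v} C] [MonoidalCategory C]

lemma whiskerLeft_lmul_mul [BraidedCategory C] {A : C} [MonObj A] [IsCommMonObj A]
    (x : 𝟙_ C ⟶ A) : A ◁ lmul x ≫ μ[A] = μ[A] ≫ lmul x := by
  rw [← IsCommMonObj.mul_comm A, BraidedCategory.braiding_naturality_right_assoc, ← mul_lmul,
    Category.assoc]

lemma comul_whiskerRight_rcomul [BraidedCategory C] {A : C} [ComonObj A] [IsCommComonObj A]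
    (t : A ⟶ 𝟙_ C) : Δ[A] ≫ rcomul t ▷ A = rcomul t ≫ Δ[A] := by
  rw [← IsCommComonObj.comul_comm A, Category.assoc, ← BraidedCategory.braiding_naturality_right,
    reassoc_of% rcomul_comul]

variable [SymmetricCategory C]

lemma comp_lmul_of_invariant {N A : HopfBC C} (n : N ⟶ A) {σ : 𝟙_ C ⟶ N.X}
    (hσ : σ ≫ ε[N.X] = 𝟙 _) {W : C} (f : W ⟶ A.X)
    (hf : N.X ◁ f ≫ actionThrough n = trivLeftAction N.X W ≫ f) :
    f ≫ lmul (σ ≫ n.hom) = f := by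
  have : f ≫ lmul (σ ≫ n.hom) = (λ_ W).inv ≫ σ ▷ W ≫ N.X ◁ f ≫ actionThrough n := by
    rw [lmul, leftUnitor_inv_naturality_assoc, comp_whiskerRight_assoc, whisker_exchange_assoc,
      actionThrough]
  rw [this, hf, trivLeftAction, Category.assoc, ← comp_whiskerRight_assoc, hσ]
  simp

lemma rcomul_comp_of_coinvariant {A Q : HopfBC C} (p : A ⟶ Q) {τ : Q.X ⟶ 𝟙_ C}
    (hτ : η[Q.X] ≫ τ = 𝟙 _) {W : C} (f : A.X ⟶ W)
    (hf : coactionThrough p ≫ f ▷ Q.X = f ≫ trivRightCoaction Q.X W) :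
    rcomul (p.hom ≫ τ) ≫ f = f := by
  have : rcomul (p.hom ≫ τ) ≫ f = (coactionThrough p ≫ f ▷ Q.X) ≫ W ◁ τ ≫ (ρ_ W).hom := by
    rw [rcomul, Category.assoc, Category.assoc, ← rightUnitor_naturality,
      MonoidalCategory.whiskerLeft_comp_assoc, whisker_exchange_assoc, coactionThrough,
      Category.assoc, Category.assoc]
  rw [this, hf, trivRightCoaction, Category.assoc, Category.assoc,
    ← MonoidalCategory.whiskerLeft_comp_assoc, hτ]
  simp

/-- An invariant morphism is fixed by averaging, and averaging is the projection followed by `s`. So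
it factors through `s`, uniquely since `s` is split. -/
lemma IsSection.isLeftInvariant [HasCoequalizers C] (hC : IsStable C) {N A Q : HopfBC C}
    {n : N ⟶ A} {p : A ⟶ Q} (h : IsExtension n p) {σ : 𝟙_ C ⟶ N.X}
    (hσ : IsNormalizedIntegral N.X σ) {s : Q.X ⟶ A.X} (hs : IsSection n p σ s) :
    IsLeftInvariant (actionThrough n) s where
  comm := by
    have := (hC.isCoequalizer_whiskerLeft (isLeftAction_actionThrough n) h.cok N.X).epi
    rw [← cancel_epi (N.X ◁ p.hom), ← MonoidalCategory.whiskerLeft_comp_assoc, hs.fac,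
      ← id_tensorHom N.X p.hom, tensorHom_trivLeftAction_assoc _ _ (Category.id_comp _), hs.fac,
      ← actionThrough_lmul n hσ, actionThrough, Category.assoc, ← whiskerLeft_lmul_mul,
      whisker_exchange_assoc]
  universal f hf := by
    have := comp_lmul_of_invariant n hσ.normalized f hf
    refine ⟨f ≫ p.hom, by dsimp only; rw [Category.assoc, hs.fac, this], fun g hg => ?_⟩
    rw [← hg, Category.assoc, hs.comp_hom, Category.comp_id]

lemma IsRetraction.isRightCoinvariant [HasEqualizers C] (hC : IsCostable C) {N A Q : HopfBC C}
    {n : N ⟶ A} {p : A ⟶ Q} (h : IsExtension n p) {τ : Q.X ⟶ 𝟙_ C}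
    (hτ : IsNormalizedCointegral Q.X τ) {k : A.X ⟶ N.X} (hk : IsRetraction n p τ k) :
    IsRightCoinvariant (coactionThrough p) k where
  comm := by
    have := (hC.isEqualizer_whiskerRight (isRightCoaction_coactionThrough p) h.ker Q.X).mono
    rw [← cancel_mono (n.hom ▷ Q.X), Category.assoc, ← comp_whiskerRight, hk.fac, Category.assoc,
      ← tensorHom_id n.hom, trivRightCoaction_tensorHom _ _ (Category.comp_id _),
      reassoc_of% hk.fac, ← rcomul_coactionThrough p hτ, coactionThrough, Category.assoc,
      ← reassoc_of% comul_whiskerRight_rcomul, whisker_exchange]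
  universal f hf := by
    have := rcomul_comp_of_coinvariant p hτ.normalized f hf
    refine ⟨n.hom ≫ f, by dsimp only; rw [reassoc_of% hk.fac, this], fun g hg => ?_⟩
    rw [← hg, reassoc_of% hk.hom_comp]

variable [Abelian (HopfBC C)]

/-- The section provides the witness that excludes the default value in `cokIntegral`. Whichever
invariant object `i` is chosen there, averaging fixes it, which says that `i` is `i` followed by the
projection and `s`; inverting the first two factors gives the claim. -/
lemma IsSection.cokIntegral_eq [HasCoequalizers C] (hC : IsStable C) {N A : HopfBC C}
    {n : N ⟶ A} (h : IsExtension n (cokernel.π n)) {σ : 𝟙_ C ⟶ N.X}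
    (hσ : IsNormalizedIntegral N.X σ) {s : (cokernel n).X ⟶ A.X}
    (hs : IsSection n (cokernel.π n) σ s) : cokIntegral n = s := by
  have H : HasCokIntegral n := ⟨_, s, hs.isLeftInvariant hC h hσ, by
    rw [hs.comp_hom]; infer_instance⟩
  rw [cokIntegral, dif_pos H, IsIso.inv_comp_eq, Category.assoc, hs.fac,
    comp_lmul_of_invariant n hσ.normalized _ H.choose_spec.choose_spec.1.comm]

lemma IsRetraction.kerIntegral_eq [HasEqualizers C] (hC : IsCostable C) {A Q : HopfBC C}
    {p : A ⟶ Q} (h : IsExtension (kernel.ι p) p) {τ : Q.X ⟶ 𝟙_ C}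
    (hτ : IsNormalizedCointegral Q.X τ) {k : A.X ⟶ (kernel p).X}
    (hk : IsRetraction (kernel.ι p) p τ k) : kerIntegral p = k := by
  have H : HasKerIntegral p := ⟨_, k, hk.isRightCoinvariant hC h hτ, by
    rw [hk.hom_comp]; infer_instance⟩
  rw [kerIntegral, dif_pos H, IsIso.comp_inv_eq, reassoc_of% hk.fac,
    rcomul_comp_of_coinvariant p hτ.normalized _ H.choose_spec.choose_spec.1.comm]

lemma isExtension_cokernel [HasEqualizers C] [HasCoequalizers C] (hC : IsBistable C)
    {N A : HopfBC C} (n : N ⟶ A) [Mono n] : IsExtension n (cokernel.π n) where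
  ker := isEqualizer_of_isLimit hC.costable (Abelian.monoIsKernelOfCokernel
    (CokernelCofork.ofπ (cokernel.π n) (cokernel.condition n)) (cokernelIsCokernel n))
  cok := isCoequalizer_of_isColimit (w := cokernel.condition n) hC.stable (cokernelIsCokernel n)

lemma isExtension_kernel [HasEqualizers C] [HasCoequalizers C] (hC : IsBistable C)
    {A Q : HopfBC C} (p : A ⟶ Q) [Epi p] : IsExtension (kernel.ι p) p where
  ker := isEqualizer_of_isLimit (w := kernel.condition p) hC.costable (kernelIsKernel p)
  cok := isCoequalizer_of_isColimit hC.stable (Abelian.epiIsCokernelOfKernel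
    (KernelFork.ofι (kernel.ι p) (kernel.condition p)) (kernelIsKernel p))

/-- The properties that characterize `μ_ξ`. -/
structure IsMuAlong {A B : HopfBC C} (ξ : A ⟶ B) (m : B.X ⟶ A.X) : Prop where
  integral : IsRightIntegralAlong ξ.hom m
  hom_comp : ∀ σ, IsNormalizedIntegral (kernel ξ).X σ →
    ξ.hom ≫ m = lmul (σ ≫ (kernel.ι ξ).hom)
  comp_hom : ∀ τ, IsNormalizedCointegral (cokernel ξ).X τ →
    m ≫ ξ.hom = rcomul ((cokernel.π ξ).hom ≫ τ)
  hom_comp_hom : ξ.hom ≫ m ≫ ξ.hom = ξ.hom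
  comp_hom_comp : m ≫ ξ.hom ≫ m = m

/-- Along the factorization of `ξ` through coimage and image, the integral is retraction, inverse
comparison, section. All five properties follow by cancelling the adjacent one-sided inverses. -/
theorem isMuAlong_fredholmIntegral [HasEqualizers C] [HasCoequalizers C] (hC : IsBistable C)
    {A B : HopfBC C} (ξ : A ⟶ B) (hi : ∃ σ, IsNormalizedIntegral (kernel ξ).X σ)
    (hc : ∃ τ, IsNormalizedCointegral (cokernel ξ).X τ) : IsMuAlong ξ (fredholmIntegral ξ) := by
  obtain ⟨σ, hσ⟩ := hi
  obtain ⟨τ, hτ⟩ := hc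
  have h₁ := isExtension_cokernel hC (kernel.ι ξ)
  have h₂ := isExtension_kernel hC (cokernel.π ξ)
  obtain ⟨s, hs⟩ := h₁.exists_isSection hC.stable hσ
  obtain ⟨k, hk⟩ := h₂.exists_isRetraction hC.costable hτ
  let c := Abelian.coimageImageComparison ξ
  have hfac : (cokernel.π (kernel.ι ξ)).hom ≫ c.hom ≫ (kernel.ι (cokernel.π ξ)).hom = ξ.hom := by
    rw [← HopfBC.comp_hom, ← HopfBC.comp_hom]
    exact congrArg HopfBC.Hom.hom (Abelian.coimage_image_factorisation ξ)
  have hm : fredholmIntegral ξ = k ≫ (inv c).hom ≫ s := by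
    rw [fredholmIntegral, hs.cokIntegral_eq hC.stable h₁ hσ, hk.kerIntegral_eq hC.costable h₂ hτ]
  have hc₁ : c.hom ≫ (inv c).hom = 𝟙 _ := by
    rw [← HopfBC.comp_hom, IsIso.hom_inv_id, HopfBC.id_hom]
  have hc₂ : (inv c).hom ≫ c.hom = 𝟙 _ := by
    rw [← HopfBC.comp_hom, IsIso.inv_hom_id, HopfBC.id_hom]
  rw [hm]
  refine ⟨?_, fun σ' hσ' => ?_, fun τ' hτ' => ?_, ?_, ?_⟩
  · rw [← hfac, ← Category.assoc k]
    exact hs.integral.comp ((isRightIntegralAlong_inv c.hom _ hc₁ hc₂).comp hk.integral)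
  · rw [hσ'.unique hσ, ← hs.fac, ← hfac]
    simp only [Category.assoc]
    rw [reassoc_of% hk.hom_comp, reassoc_of% hc₁]
  · rw [hτ'.unique hτ, ← hk.fac, ← hfac]
    simp only [Category.assoc]
    rw [reassoc_of% hs.comp_hom, reassoc_of% hc₂]
  · simp only [← hfac, Category.assoc]
    rw [reassoc_of% hk.hom_comp, reassoc_of% hs.comp_hom, reassoc_of% hc₂]
  · simp only [← hfac, Category.assoc]
    rw [reassoc_of% hs.comp_hom, reassoc_of% hc₂, reassoc_of% hk.hom_comp]

end Invariant

/-! ### Integrals along a homomorphism intertwine averaging operators -/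

section Generator

variable {C : Type u} [Category.{v} C] [MonoidalCategory C]

@[simp] lemma lmul_one (A : C) [MonObj A] : lmul η[A] = 𝟙 A := by
  simp [lmul]

@[simp] lemma rcomul_counit_self (A : C) [ComonObj A] : rcomul ε[A] = 𝟙 A := by
  simp [rcomul]

variable [BraidedCategory C] {A B : C} [BimonObj A] [BimonObj B] {ξ : A ⟶ B} {m : B ⟶ A}

lemma IsLeftIntegralAlong.comp_lmul (h : IsLeftIntegralAlong ξ m) (x : 𝟙_ C ⟶ A) :
    m ≫ lmul x = lmul (x ≫ ξ) ≫ m := by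
  rw [lmul, leftUnitor_inv_naturality_assoc, whisker_exchange_assoc, h.mul, lmul,
    comp_whiskerRight, Category.assoc, Category.assoc, Category.assoc]

lemma IsRightIntegralAlong.rcomul_comp (h : IsRightIntegralAlong ξ m) (t : B ⟶ 𝟙_ C) :
    rcomul t ≫ m = m ≫ rcomul (ξ ≫ t) := by
  rw [rcomul, Category.assoc, Category.assoc, ← rightUnitor_naturality, whisker_exchange_assoc,
    reassoc_of% h.comul, rcomul, MonoidalCategory.whiskerLeft_comp, Category.assoc]

lemma IsNormalizedGeneratorIntegral.unique {m' : B ⟶ A} (h : IsNormalizedGeneratorIntegral ξ m)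
    (h' : IsNormalizedGeneratorIntegral ξ m') : m = m' := by
  rw [← (h'.generator m (Or.inl h.right)).1, (h.generator m' (Or.inl h'.right)).2]

lemma invVol_eq {σ : 𝟙_ C ⟶ A} {τ : A ⟶ 𝟙_ C} (hσ : IsNormalizedIntegral A σ)
    (hτ : IsNormalizedCointegral A τ) (hi : ∃ σ, IsNormalizedIntegral A σ)
    (hc : ∃ σ, IsNormalizedCointegral A σ) : invVol A hi hc = σ ≫ τ := by
  rw [invVol, hi.choose_spec.unique hσ, hc.choose_spec.unique hτ]

lemma HasFiniteVolume.mk' {σ : 𝟙_ C ⟶ A} {τ : A ⟶ 𝟙_ C} (hσ : IsNormalizedIntegral A σ)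
    (hτ : IsNormalizedCointegral A τ) (h : IsIso (σ ≫ τ)) : HasFiniteVolume A :=
  ⟨⟨σ, hσ⟩, ⟨τ, hτ⟩, by rwa [invVol_eq hσ hτ]⟩

lemma HasFiniteVolume.isIso_comp (h : HasFiniteVolume A) {σ : 𝟙_ C ⟶ A} {τ : A ⟶ 𝟙_ C}
    (hσ : IsNormalizedIntegral A σ) (hτ : IsNormalizedCointegral A τ) : IsIso (σ ≫ τ) := by
  rw [← invVol_eq hσ hτ h.integral h.cointegral]
  exact h.isIso

end Generator

/-! ### The generator property and part (a) -/

section MuAlong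

variable {C : Type u} [Category.{v} C] [MonoidalCategory C] [SymmetricCategory C]
  [Abelian (HopfBC C)]

/-- An arbitrary integral `m'` turns translation by the integral of Ker ξ into translation by its
image under `ξ`, which is the unit. Dually it turns contraction by the cointegral of Cok ξ into
contraction by the counit. Bicommutativity makes left and right integrals the same. -/
theorem IsMuAlong.isNormalizedGeneratorIntegral {A B : HopfBC C} {ξ : A ⟶ B} {m : B.X ⟶ A.X}
    (h : IsMuAlong ξ m) (hi : ∃ σ, IsNormalizedIntegral (kernel ξ).X σ)
    (hc : ∃ τ, IsNormalizedCointegral (cokernel ξ).X τ) :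
    IsNormalizedGeneratorIntegral ξ.hom m := by
  obtain ⟨σ, hσ⟩ := hi
  obtain ⟨τ, hτ⟩ := hc
  refine ⟨h.integral, h.integral.left, h.hom_comp_hom, fun m' hm' => ?_⟩
  have hr : IsRightIntegralAlong ξ.hom m' := hm'.elim id IsLeftIntegralAlong.right
  have h₁ : (kernel.ι ξ).hom ≫ ξ.hom = ε ≫ η := (HopfBC.comp_eq_zero_iff _ _).1 (kernel.condition ξ)
  have h₂ : ξ.hom ≫ (cokernel.π ξ).hom = ε ≫ η :=
    (HopfBC.comp_eq_zero_iff _ _).1 (cokernel.condition ξ)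
  constructor
  · rw [h.hom_comp σ hσ, hr.left.comp_lmul, Category.assoc, h₁, reassoc_of% hσ.normalized]
    simp
  · rw [reassoc_of% h.comp_hom τ hτ, hr.rcomul_comp, reassoc_of% h₂, hτ.normalized]
    simp

theorem isNormalizedGeneratorIntegral_iff [HasEqualizers C] [HasCoequalizers C]
    (hC : IsBistable C) {A B : HopfBC C} {ξ : A ⟶ B} (hξ : IsFredholm ξ) (m : B.X ⟶ A.X) :
    IsNormalizedGeneratorIntegral ξ.hom m ↔ m = fredholmIntegral ξ := by
  have h := (isMuAlong_fredholmIntegral hC ξ hξ.ker_finiteVolume.integral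
    hξ.cok_finiteVolume.cointegral).isNormalizedGeneratorIntegral hξ.ker_finiteVolume.integral
    hξ.cok_finiteVolume.cointegral
  exact ⟨fun hm => hm.unique h, fun hm => hm ▸ h⟩

end MuAlong

/-! ### Splitting idempotents -/

section Split

variable {C : Type u} [Category.{v} C]

lemma exists_split [HasEqualizers C] {X : C} (e : X ⟶ X) (he : e ≫ e = e) :
    ∃ (Z : C) (i : Z ⟶ X) (r : X ⟶ Z), i ≫ r = 𝟙 Z ∧ r ≫ i = e :=
  ((Idempotents.isIdempotentComplete_iff_hasEqualizer_of_id_and_idempotent C).2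
    fun _ _ _ => inferInstance).idempotents_split X e he

lemma isCoequalizer_of_split {W X Z : C} {f g : W ⟶ X} {i : Z ⟶ X} {r : X ⟶ Z} {e : X ⟶ X}
    (hir : i ≫ r = 𝟙 Z) (hri : r ≫ i = e) (w : f ≫ e = g ≫ e)
    (h : ∀ {V : C} (k : X ⟶ V), f ≫ k = g ≫ k → e ≫ k = k) : IsCoequalizer f g r := by
  have : IsSplitEpi r := ⟨⟨i, hir⟩⟩
  have her : e ≫ r = r := by rw [← hri, Category.assoc, hir, Category.comp_id]
  refine .of_exists_desc ?_ fun k hk => ⟨i ≫ k, by rw [reassoc_of% hri, h k hk]⟩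
  rw [← her, reassoc_of% w]

lemma isEqualizer_of_split {X W Z : C} {f g : X ⟶ W} {i : Z ⟶ X} {r : X ⟶ Z} {e : X ⟶ X}
    (hir : i ≫ r = 𝟙 Z) (hri : r ≫ i = e) (w : e ≫ f = e ≫ g)
    (h : ∀ {V : C} (k : V ⟶ X), k ≫ f = k ≫ g → k ≫ e = k) : IsEqualizer f g i := by
  have : IsSplitMono i := ⟨⟨r, hir⟩⟩
  have hie : i ≫ e = i := by rw [← hri, reassoc_of% hir]
  refine .of_exists_lift ?_ fun k hk => ⟨k ≫ r, by rw [Category.assoc, hri, h k hk]⟩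
  rw [← hie, Category.assoc, w, Category.assoc]

end Split

/-! ### Integrals imply smallness -/

section Small

variable {C : Type u} [Category.{v} C] [MonoidalCategory C]

lemma whiskerLeft_trivLeftAction (A : C) [ComonObj A] {W X : C} (f : W ⟶ X) :
    A ◁ f ≫ trivLeftAction A X = trivLeftAction A W ≫ f := by
  simp [trivLeftAction, whisker_exchange_assoc]

lemma whiskerRight_trivRightAction (A : C) [ComonObj A] {W X : C} (f : W ⟶ X) :
    f ▷ A ≫ trivRightAction A X = trivRightAction A W ≫ f := by
  simp [trivRightAction, ← whisker_exchange_assoc]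

lemma trivLeftCoaction_whiskerLeft (B : C) [MonObj B] {Y W : C} (f : Y ⟶ W) :
    trivLeftCoaction B Y ≫ B ◁ f = f ≫ trivLeftCoaction B W := by
  simp [trivLeftCoaction, ← whisker_exchange]

lemma trivRightCoaction_whiskerRight (B : C) [MonObj B] {Y W : C} (f : Y ⟶ W) :
    trivRightCoaction B Y ≫ f ▷ B = f ≫ trivRightCoaction B W := by
  simp [trivRightCoaction, whisker_exchange]

variable [BraidedCategory C] [HasEqualizers C]

/-- Acting by `σ` is an idempotent, as in averaging over a finite group. Its image is at once the
object of invariants and the object of coinvariants, and the canonical morphism between them is the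
identity of that image. -/
lemma IsNormalizedIntegral.isSmall {A : C} [BimonObj A] {σ : 𝟙_ C ⟶ A}
    (h : IsNormalizedIntegral A σ) : IsSmall A where
  left X α hα := by
    set e : X ⟶ X := (λ_ X).inv ≫ σ ▷ X ≫ α with he
    have h₁ : α ≫ e = trivLeftAction A X ≫ e := by
      rw [he, leftUnitor_inv_naturality_assoc, whisker_exchange_assoc,
        ← Iso.inv_hom_id_assoc (α_ A A X) (A ◁ α ≫ α), ← hα.assoc]
      have := h.left =≫ (ρ_ A).inv
      have : σ ▷ (A ⊗ X) ≫ (α_ A A X).inv ≫ μ[A] ▷ X =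
        (α_ (𝟙_ C) A X).inv ≫ ((σ ⊗ₘ ε[A]) ≫ (ρ_ A).hom) ▷ X := by
        rw [← h.left, comp_whiskerRight]
        monoidal
      rw [reassoc_of% this, trivLeftAction, MonoidalCategory.tensorHom_def']
      simp
    have h₂ : A ◁ e ≫ α = trivLeftAction A X ≫ e := by
      have : A ◁ σ ▷ X ≫ (α_ A A X).inv ≫ μ[A] ▷ X =
        (α_ A (𝟙_ C) X).inv ≫ ((ε[A] ⊗ₘ σ) ≫ (λ_ A).hom) ▷ X := by
        rw [← h.right, comp_whiskerRight]
        monoidal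
      rw [he, MonoidalCategory.whiskerLeft_comp, MonoidalCategory.whiskerLeft_comp, Category.assoc,
        Category.assoc, ← Iso.inv_hom_id_assoc (α_ A A X) (A ◁ α ≫ α), ← hα.assoc,
        reassoc_of% this, trivLeftAction, MonoidalCategory.tensorHom_def]
      simp
    have h₃ : ∀ {W : C} (f : W ⟶ X), A ◁ f ≫ α = trivLeftAction A W ≫ f → f ≫ e = f := by
      intro W f hf
      rw [he, leftUnitor_inv_naturality_assoc, whisker_exchange_assoc, hf, trivLeftAction,
        Category.assoc, ← comp_whiskerRight_assoc, h.normalized]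
      simp
    have h₄ : ∀ {V : C} (k : X ⟶ V), α ≫ k = trivLeftAction A X ≫ k → e ≫ k = k := by
      intro V k hk
      rw [he, Category.assoc, Category.assoc, hk, trivLeftAction, Category.assoc,
        ← comp_whiskerRight_assoc, h.normalized]
      simp
    -- Idempotence: `e` itself coequalizes the action and the trivial action, and `e` fixes every
    -- such morphism.
    obtain ⟨Z, i, r, hir, hri⟩ := exists_split e (h₄ e h₁)
    have hie : i ≫ e = i := by rw [← hri, reassoc_of% hir]
    refine ⟨Z, Z, i, r, ⟨?_, fun f hf => ⟨f ≫ r, ?_, fun g hg => ?_⟩⟩,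
      isCoequalizer_of_split hir hri h₁ h₄, by rw [hir]; infer_instance⟩
    · rw [← hie, MonoidalCategory.whiskerLeft_comp, Category.assoc, h₂,
        reassoc_of% whiskerLeft_trivLeftAction]
    · dsimp only; rw [Category.assoc, hri, h₃ f hf]
    · rw [← hg, Category.assoc, hir, Category.comp_id]
  right X α hα := by
    set e : X ⟶ X := (ρ_ X).inv ≫ X ◁ σ ≫ α with he
    have h₁ : α ≫ e = trivRightAction A X ≫ e := by
      rw [he, rightUnitor_inv_naturality_assoc, ← whisker_exchange_assoc,
        ← Iso.hom_inv_id_assoc (α_ X A A) (α ▷ A ≫ α), ← hα.assoc]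
      have : (X ⊗ A) ◁ σ ≫ (α_ X A A).hom ≫ X ◁ μ[A] =
        (α_ X A (𝟙_ C)).hom ≫ X ◁ ((ε[A] ⊗ₘ σ) ≫ (λ_ A).hom) := by
        rw [← h.right, MonoidalCategory.whiskerLeft_comp]
        monoidal
      rw [reassoc_of% this, trivRightAction, MonoidalCategory.tensorHom_def]
      simp
    have h₂ : e ▷ A ≫ α = trivRightAction A X ≫ e := by
      have : (X ◁ σ) ▷ A ≫ (α_ X A A).hom ≫ X ◁ μ[A] =
        (α_ X (𝟙_ C) A).hom ≫ X ◁ ((σ ⊗ₘ ε[A]) ≫ (ρ_ A).hom) := by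
        rw [← h.left, MonoidalCategory.whiskerLeft_comp]
        monoidal
      rw [he, comp_whiskerRight, comp_whiskerRight, Category.assoc,
        Category.assoc, ← Iso.hom_inv_id_assoc (α_ X A A) (α ▷ A ≫ α), ← hα.assoc,
        reassoc_of% this, trivRightAction, MonoidalCategory.tensorHom_def']
      simp
    have h₃ : ∀ {W : C} (f : W ⟶ X), f ▷ A ≫ α = trivRightAction A W ≫ f → f ≫ e = f := by
      intro W f hf
      rw [he, rightUnitor_inv_naturality_assoc, ← whisker_exchange_assoc, hf, trivRightAction,
        Category.assoc, ← MonoidalCategory.whiskerLeft_comp_assoc, h.normalized]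
      simp
    have h₄ : ∀ {V : C} (k : X ⟶ V), α ≫ k = trivRightAction A X ≫ k → e ≫ k = k := by
      intro V k hk
      rw [he, Category.assoc, Category.assoc, hk, trivRightAction, Category.assoc,
        ← MonoidalCategory.whiskerLeft_comp_assoc, h.normalized]
      simp
    obtain ⟨Z, i, r, hir, hri⟩ := exists_split e (h₄ e h₁)
    have hie : i ≫ e = i := by rw [← hri, reassoc_of% hir]
    refine ⟨Z, Z, i, r, ⟨?_, fun f hf => ⟨f ≫ r, ?_, fun g hg => ?_⟩⟩,
      isCoequalizer_of_split hir hri h₁ h₄, by rw [hir]; infer_instance⟩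
    · rw [← hie, comp_whiskerRight, Category.assoc, h₂,
        reassoc_of% whiskerRight_trivRightAction]
    · dsimp only; rw [Category.assoc, hri, h₃ f hf]
    · rw [← hg, Category.assoc, hir, Category.comp_id]

lemma IsNormalizedCointegral.isCosmall {B : C} [BimonObj B] {τ : B ⟶ 𝟙_ C}
    (h : IsNormalizedCointegral B τ) : IsCosmall B where
  left Y β hβ := by
    set e : Y ⟶ Y := β ≫ τ ▷ Y ≫ (λ_ Y).hom with he
    have h₁ : e ≫ β = e ≫ trivLeftCoaction B Y := by
      have : Δ[B] ▷ Y ≫ (α_ B B Y).hom ≫ τ ▷ (B ⊗ Y) =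
        ((ρ_ B).inv ≫ (τ ⊗ₘ η[B])) ▷ Y ≫ (α_ (𝟙_ C) B Y).hom := by
        rw [← h.left, comp_whiskerRight]
        monoidal
      rw [he, Category.assoc, Category.assoc, ← leftUnitor_naturality, ← whisker_exchange_assoc,
        ← Iso.inv_hom_id_assoc (α_ B B Y) (τ ▷ (B ⊗ Y) ≫ _), ← Category.assoc β,
        ← Category.assoc _ (α_ B B Y).inv, Category.assoc β, ← hβ.coassoc, Category.assoc,
        reassoc_of% this, trivLeftCoaction, MonoidalCategory.tensorHom_def]
      monoidal
    have h₂ : β ≫ B ◁ e = e ≫ trivLeftCoaction B Y := by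
      have : Δ[B] ▷ Y ≫ (α_ B B Y).hom ≫ B ◁ τ ▷ Y =
        ((λ_ B).inv ≫ (η[B] ⊗ₘ τ)) ▷ Y ≫ (α_ B (𝟙_ C) Y).hom := by
        rw [← h.right, comp_whiskerRight]
        monoidal
      rw [he, MonoidalCategory.whiskerLeft_comp, MonoidalCategory.whiskerLeft_comp,
        ← Iso.inv_hom_id_assoc (α_ B B Y) (B ◁ τ ▷ Y ≫ _), ← Category.assoc β,
        ← Category.assoc _ (α_ B B Y).inv, Category.assoc β, ← hβ.coassoc, Category.assoc,
        reassoc_of% this, trivLeftCoaction, MonoidalCategory.tensorHom_def']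
      monoidal
    have h₃ : ∀ {W : C} (f : Y ⟶ W), β ≫ B ◁ f = f ≫ trivLeftCoaction B W → e ≫ f = f := by
      intro W f hf
      rw [he, Category.assoc, Category.assoc, ← leftUnitor_naturality, ← whisker_exchange_assoc,
        reassoc_of% hf, trivLeftCoaction, Category.assoc, ← comp_whiskerRight_assoc, h.normalized]
      simp
    have h₄ : ∀ {V : C} (k : V ⟶ Y), k ≫ β = k ≫ trivLeftCoaction B Y → k ≫ e = k := by
      intro V k hk
      rw [he, reassoc_of% hk, trivLeftCoaction, Category.assoc,
        ← comp_whiskerRight_assoc, h.normalized]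
      simp
    obtain ⟨Z, i, r, hir, hri⟩ := exists_split e (h₄ e h₁)
    have her : e ≫ r = r := by rw [← hri, Category.assoc, hir, Category.comp_id]
    refine ⟨Z, Z, r, i, ⟨?_, fun f hf => ⟨i ≫ f, ?_, fun g hg => ?_⟩⟩,
      isEqualizer_of_split hir hri h₁ h₄, by rw [hir]; infer_instance⟩
    · rw [← her, MonoidalCategory.whiskerLeft_comp, reassoc_of% h₂, trivLeftCoaction_whiskerLeft, her,
        reassoc_of% her]
    · dsimp only; rw [reassoc_of% hri, h₃ f hf]
    · rw [← hg, reassoc_of% hir]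
  right Y β hβ := by
    set e : Y ⟶ Y := β ≫ Y ◁ τ ≫ (ρ_ Y).hom with he
    have h₁ : e ≫ β = e ≫ trivRightCoaction B Y := by
      have : Y ◁ Δ[B] ≫ (α_ Y B B).inv ≫ (Y ⊗ B) ◁ τ =
        Y ◁ ((λ_ B).inv ≫ (η[B] ⊗ₘ τ)) ≫ (α_ Y B (𝟙_ C)).inv := by
        rw [← h.right, MonoidalCategory.whiskerLeft_comp]
        monoidal
      rw [he, Category.assoc, Category.assoc, ← rightUnitor_naturality, whisker_exchange_assoc,
        ← Iso.hom_inv_id_assoc (α_ Y B B) ((Y ⊗ B) ◁ τ ≫ _), ← Category.assoc β,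
        ← Category.assoc _ (α_ Y B B).hom, Category.assoc β, ← hβ.coassoc, Category.assoc,
        reassoc_of% this, trivRightCoaction, MonoidalCategory.tensorHom_def']
      monoidal
    have h₂ : β ≫ e ▷ B = e ≫ trivRightCoaction B Y := by
      have : Y ◁ Δ[B] ≫ (α_ Y B B).inv ≫ (Y ◁ τ) ▷ B =
        Y ◁ ((ρ_ B).inv ≫ (τ ⊗ₘ η[B])) ≫ (α_ Y (𝟙_ C) B).inv := by
        rw [← h.left, MonoidalCategory.whiskerLeft_comp]
        monoidal
      rw [he, comp_whiskerRight, comp_whiskerRight,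
        ← Iso.hom_inv_id_assoc (α_ Y B B) ((Y ◁ τ) ▷ B ≫ _), ← Category.assoc β,
        ← Category.assoc _ (α_ Y B B).hom, Category.assoc β, ← hβ.coassoc, Category.assoc,
        reassoc_of% this, trivRightCoaction, MonoidalCategory.tensorHom_def]
      monoidal
    have h₃ : ∀ {W : C} (f : Y ⟶ W), β ≫ f ▷ B = f ≫ trivRightCoaction B W → e ≫ f = f := by
      intro W f hf
      rw [he, Category.assoc, Category.assoc, ← rightUnitor_naturality, whisker_exchange_assoc,
        reassoc_of% hf, trivRightCoaction, Category.assoc,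
        ← MonoidalCategory.whiskerLeft_comp_assoc, h.normalized]
      simp
    have h₄ : ∀ {V : C} (k : V ⟶ Y), k ≫ β = k ≫ trivRightCoaction B Y → k ≫ e = k := by
      intro V k hk
      rw [he, reassoc_of% hk, trivRightCoaction, Category.assoc,
        ← MonoidalCategory.whiskerLeft_comp_assoc, h.normalized]
      simp
    obtain ⟨Z, i, r, hir, hri⟩ := exists_split e (h₄ e h₁)
    have her : e ≫ r = r := by rw [← hri, Category.assoc, hir, Category.comp_id]
    refine ⟨Z, Z, r, i, ⟨?_, fun f hf => ⟨i ≫ f, ?_, fun g hg => ?_⟩⟩,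
      isEqualizer_of_split hir hri h₁ h₄, by rw [hir]; infer_instance⟩
    · rw [← her, comp_whiskerRight, reassoc_of% h₂, trivRightCoaction_whiskerRight, her,
        reassoc_of% her]
    · dsimp only; rw [reassoc_of% hri, h₃ f hf]
    · rw [← hg, reassoc_of% hir]

/-- Showing that a composite is Fredholm therefore reduces to computing volumes. -/
lemma HasFiniteVolume.isBismall {A : C} [BimonObj A] (h : HasFiniteVolume A) : IsBismall A :=
  ⟨h.integral.choose_spec.isSmall, h.cointegral.choose_spec.isCosmall⟩

end Small

/-! ### Transport of integrals along epimorphisms and monomorphisms -/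

section Volume

variable {C : Type u} [Category.{v} C] [MonoidalCategory C] [BraidedCategory C]

lemma isNormalizedIntegral_of_lmul {A : C} [BimonObj A] [IsCommMonObj A] {σ : 𝟙_ C ⟶ A}
    (h : lmul σ = ε[A] ≫ σ) (hn : σ ≫ ε[A] = 𝟙 _) : IsNormalizedIntegral A σ := by
  have hl : σ ▷ A ≫ μ[A] = (λ_ A).hom ≫ ε[A] ≫ σ := by rw [← h, lmul, Iso.hom_inv_id_assoc]
  refine ⟨?_, ?_, hn⟩
  · rw [hl, MonoidalCategory.tensorHom_def']
    simp
  · rw [← IsCommMonObj.mul_comm A, BraidedCategory.braiding_naturality_right_assoc, hl,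
      braiding_tensorUnit_right, MonoidalCategory.tensorHom_def]
    simp [unitors_equal]

lemma isNormalizedCointegral_of_rcomul {A : C} [BimonObj A] [IsCommComonObj A] {τ : A ⟶ 𝟙_ C}
    (h : rcomul τ = τ ≫ η[A]) (hn : η[A] ≫ τ = 𝟙 _) : IsNormalizedCointegral A τ := by
  have hl : Δ[A] ≫ A ◁ τ = τ ≫ η[A] ≫ (ρ_ A).inv := by
    rw [← reassoc_of% h, rcomul]
    simp
  refine ⟨?_, ?_, hn⟩
  · rw [← IsCommComonObj.comul_comm A, Category.assoc,
      ← BraidedCategory.braiding_naturality_right, reassoc_of% hl,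
      braiding_tensorUnit_right, MonoidalCategory.tensorHom_def]
    simp [-IsMonHom.one_hom, -IsMonHom.one_hom_assoc]
  · rw [hl, MonoidalCategory.tensorHom_def']
    simp [-IsMonHom.one_hom, -IsMonHom.one_hom_assoc]

variable {A B : C} [BimonObj A] [BimonObj B] {f : A ⟶ B} {m : B ⟶ A}

lemma IsRightIntegralAlong.lmul_comp (h : IsRightIntegralAlong f m) (x : 𝟙_ C ⟶ B) :
    lmul (x ≫ m) = f ≫ lmul x ≫ m := by
  rw [lmul, comp_whiskerRight, Category.assoc, h.mul, lmul, Category.assoc,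
    Category.assoc, leftUnitor_inv_naturality_assoc, whisker_exchange_assoc]

lemma IsLeftIntegralAlong.rcomul_comp (h : IsLeftIntegralAlong f m) (t : A ⟶ 𝟙_ C) :
    rcomul (m ≫ t) = m ≫ rcomul t ≫ f := by
  rw [rcomul, MonoidalCategory.whiskerLeft_comp, Category.assoc, reassoc_of% h.comul, rcomul,
    Category.assoc, Category.assoc, ← rightUnitor_naturality, whisker_exchange_assoc]

lemma IsNormalizedIntegral.comp_epi [IsCommMonObj B] {σ : 𝟙_ C ⟶ A}
    (hσ : IsNormalizedIntegral A σ) (f : A ⟶ B) [IsBimonHom f] [Epi f] :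
    IsNormalizedIntegral B (σ ≫ f) := by
  refine isNormalizedIntegral_of_lmul ?_ (by simp [hσ.normalized])
  rw [← cancel_epi f, ← lmul_comp_hom, hσ.lmul_eq]
  simp

lemma IsNormalizedCointegral.mono_comp [IsCommComonObj A] {τ : B ⟶ 𝟙_ C}
    (hτ : IsNormalizedCointegral B τ) (f : A ⟶ B) [IsBimonHom f] [Mono f] :
    IsNormalizedCointegral A (f ≫ τ) := by
  refine isNormalizedCointegral_of_rcomul ?_ (by simp [hτ.normalized])
  rw [← cancel_mono f, ← comp_rcomul, hτ.rcomul_eq]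
  simp

end Volume

/-! ### Multiplicativity of the inverse volume in extensions -/

section ExtensionVolume

variable {C : Type u} [Category.{v} C] [MonoidalCategory C] [SymmetricCategory C]
  {N A Q : HopfBC C} {n : N ⟶ A} {p : A ⟶ Q} {σ : 𝟙_ C ⟶ N.X} {s : Q.X ⟶ A.X}
  {τ : Q.X ⟶ 𝟙_ C} {k : A.X ⟶ N.X}

lemma IsSection.isNormalizedIntegral (hs : IsSection n p σ s) {σ' : 𝟙_ C ⟶ Q.X}
    (hσ' : IsNormalizedIntegral Q.X σ') : IsNormalizedIntegral A.X (σ' ≫ s) := by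
  refine isNormalizedIntegral_of_lmul ?_ ?_
  · rw [hs.integral.lmul_comp, hσ'.lmul_eq]
    simp
  · rw [Category.assoc, ← IsComonHom.hom_counit p.hom, reassoc_of% hs.comp_hom, hσ'.normalized]

lemma IsRetraction.isNormalizedCointegral (hk : IsRetraction n p τ k) {τ' : N.X ⟶ 𝟙_ C}
    (hτ' : IsNormalizedCointegral N.X τ') : IsNormalizedCointegral A.X (k ≫ τ') := by
  refine isNormalizedCointegral_of_rcomul ?_ ?_
  · rw [hk.integral.left.rcomul_comp, hτ'.rcomul_eq]
    simp
  · rw [← IsMonHom.one_hom n.hom, Category.assoc, reassoc_of% hk.hom_comp, hτ'.normalized]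

/-- After inclusion into A, the retraction is contraction by `τ`. It passes through the integral `s`
to contraction on Q, which collapses to `τ` and the unit; and `s` sends the unit to the image of
`σ`. -/
lemma IsSection.comp_retraction [Mono n.hom] (hs : IsSection n p σ s)
    (hk : IsRetraction n p τ k) (hτ : IsNormalizedCointegral Q.X τ) : s ≫ k = τ ≫ σ := by
  rw [← cancel_mono n.hom, Category.assoc, hk.fac, ← hs.integral.rcomul_comp, hτ.rcomul_eq,
    ← IsMonHom.one_hom p.hom, Category.assoc, Category.assoc, hs.fac, one_lmul, Category.assoc]

/-- The integral of A is that of Q moved along the section, the cointegral is that of N pulled back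
along the retraction. Their composite breaks in the middle because section followed by retraction
factors through the unit object. -/
theorem IsExtension.exists_integrals [HasEqualizers C] [HasCoequalizers C] (hC : IsBistable C)
    (h : IsExtension n p) {σN : 𝟙_ C ⟶ N.X} {τN : N.X ⟶ 𝟙_ C} {σQ : 𝟙_ C ⟶ Q.X}
    {τQ : Q.X ⟶ 𝟙_ C} (hσN : IsNormalizedIntegral N.X σN) (hτN : IsNormalizedCointegral N.X τN)
    (hσQ : IsNormalizedIntegral Q.X σQ) (hτQ : IsNormalizedCointegral Q.X τQ) :
    ∃ σ τ, IsNormalizedIntegral A.X σ ∧ IsNormalizedCointegral A.X τ ∧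
      σ ≫ τ = (σQ ≫ τQ) ≫ σN ≫ τN := by
  obtain ⟨s, hs⟩ := h.exists_isSection hC.stable hσN
  obtain ⟨k, hk⟩ := h.exists_isRetraction hC.costable hτQ
  have := h.ker.mono
  refine ⟨_, _, hs.isNormalizedIntegral hσQ, hk.isNormalizedCointegral hτN, ?_⟩
  rw [Category.assoc, reassoc_of% hs.comp_retraction hk hτQ, Category.assoc]

variable [HasEqualizers C] [HasCoequalizers C] [Abelian (HopfBC C)]

lemma HopfBC.mono_hom (hC : IsBistable C) {A B : HopfBC C} (f : A ⟶ B) [Mono f] : Mono f.hom :=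
  (isExtension_cokernel hC f).ker.mono

lemma HopfBC.epi_hom (hC : IsBistable C) {A B : HopfBC C} (f : A ⟶ B) [Epi f] : Epi f.hom :=
  (isExtension_kernel hC f).cok.epi

end ExtensionVolume

/-! ### The action of endomorphisms of the unit object -/

section Scalar

variable {C : Type u} [Category.{v} C] [MonoidalCategory C]

lemma scalarMul_eq (r : 𝟙_ C ⟶ 𝟙_ C) {X Y : C} (f : X ⟶ Y) :
    scalarMul r f = (λ_ X).inv ≫ r ▷ X ≫ (λ_ X).hom ≫ f := by
  simp [scalarMul, MonoidalCategory.tensorHom_def]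

lemma scalarMul_comp (r : 𝟙_ C ⟶ 𝟙_ C) {X Y Z : C} (f : X ⟶ Y) (g : Y ⟶ Z) :
    scalarMul r f ≫ g = scalarMul r (f ≫ g) := by
  simp [scalarMul_eq]

lemma comp_scalarMul (r : 𝟙_ C ⟶ 𝟙_ C) {X Y Z : C} (f : X ⟶ Y) (g : Y ⟶ Z) :
    f ≫ scalarMul r g = scalarMul r (f ≫ g) := by
  rw [scalarMul_eq, scalarMul_eq, leftUnitor_inv_naturality_assoc, whisker_exchange_assoc,
    leftUnitor_naturality_assoc]

@[simp] lemma scalarMul_id {X Y : C} (f : X ⟶ Y) : scalarMul (𝟙 _) f = f := by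
  simp [scalarMul_eq]

lemma scalarMul_scalarMul (r s : 𝟙_ C ⟶ 𝟙_ C) {X Y : C} (f : X ⟶ Y) :
    scalarMul r (scalarMul s f) = scalarMul (r ≫ s) f := by
  simp [scalarMul_eq]

lemma scalarMul_whiskerRight (r : 𝟙_ C ⟶ 𝟙_ C) {X Y : C} (f : X ⟶ Y) (Z : C) :
    scalarMul r f ▷ Z = scalarMul r (f ▷ Z) := by
  simp only [scalarMul_eq]
  monoidal

lemma scalarMul_of_source (r : 𝟙_ C ⟶ 𝟙_ C) {X : C} (x : 𝟙_ C ⟶ X) :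
    scalarMul r x = r ≫ x := by
  rw [scalarMul_eq, unitors_equal, unitors_inv_equal]
  simp

lemma scalarMul_of_target (r : 𝟙_ C ⟶ 𝟙_ C) {X : C} (t : X ⟶ 𝟙_ C) :
    scalarMul r t = t ≫ r := by
  conv_rhs => rw [← Category.comp_id r, ← scalarMul_of_source, comp_scalarMul, Category.comp_id]

lemma unit_endo_comm (r s : 𝟙_ C ⟶ 𝟙_ C) : r ≫ s = s ≫ r := by
  rw [← scalarMul_of_source, scalarMul_of_target]

lemma scalarMul_inj (r : 𝟙_ C ⟶ 𝟙_ C) [IsIso r] {X Y : C} {f g : X ⟶ Y}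
    (h : scalarMul r f = scalarMul r g) : f = g := by
  have := congrArg (scalarMul (inv r)) h
  simpa [scalarMul_scalarMul] using this

variable [BraidedCategory C]

lemma whiskerLeft_scalarMul (r : 𝟙_ C ⟶ 𝟙_ C) {X Y : C} (Z : C) (f : X ⟶ Y) :
    Z ◁ scalarMul r f = scalarMul r (Z ◁ f) := by
  rw [← cancel_epi (β_ X Z).hom, ← BraidedCategory.braiding_naturality_left,
    scalarMul_whiskerRight, scalarMul_comp, BraidedCategory.braiding_naturality_left,
    comp_scalarMul]

end Scalar

/-! ### The Frobenius zigzag and the antipode -/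

section Frobenius

variable {C : Type u} [Category.{v} C] [MonoidalCategory C]

/-- The contraction of the copairing `σ ≫ Δ` with the pairing `μ ≫ τ`. -/
def frobenius {A : C} [MonObj A] [ComonObj A] (σ : 𝟙_ C ⟶ A) (τ : A ⟶ 𝟙_ C) : A ⟶ A :=
  (λ_ A).inv ≫ (σ ≫ Δ[A]) ▷ A ≫ (α_ A A A).hom ≫ A ◁ (μ[A] ≫ τ) ≫ (ρ_ A).hom

lemma whiskerLeft_frobenius_comp {A : C} [MonObj A] [ComonObj A] (σ : 𝟙_ C ⟶ A) (τ : A ⟶ 𝟙_ C)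
    {X Y : C} (g : X ⊗ A ⟶ Y) :
    X ◁ frobenius σ τ ≫ g = ((ρ_ X).inv ≫ X ◁ (σ ≫ Δ[A]) ≫ (α_ X A A).inv ≫ g ▷ A) ▷ A ≫
      (α_ Y A A).hom ≫ Y ◁ (μ[A] ≫ τ) ≫ (ρ_ Y).hom := by
  have : (X ⊗ A) ◁ (μ[A] ≫ τ) ≫ (ρ_ _).hom ≫ g = g ▷ (A ⊗ A) ≫ Y ◁ (μ[A] ≫ τ) ≫ (ρ_ Y).hom := by
    rw [← rightUnitor_naturality, whisker_exchange_assoc]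
  calc _ = (ρ_ X).inv ▷ A ≫ (X ◁ (σ ≫ Δ[A])) ▷ A ≫ (α_ X A A).inv ▷ A ≫ (α_ (X ⊗ A) A A).hom ≫
        (X ⊗ A) ◁ (μ[A] ≫ τ) ≫ (ρ_ _).hom ≫ g := by
        rw [frobenius]
        monoidal
    _ = _ := by
        rw [this]
        monoidal

lemma comp_frobenius_whiskerRight {A : C} [MonObj A] [ComonObj A] (σ : 𝟙_ C ⟶ A)
    (τ : A ⟶ 𝟙_ C) {X Y : C} (f : X ⟶ A ⊗ Y) :
    f ≫ frobenius σ τ ▷ Y = (λ_ X).inv ≫ (σ ≫ Δ[A]) ▷ X ≫ (α_ A A X).hom ≫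
      A ◁ (A ◁ f ≫ (α_ A A Y).inv ≫ (μ[A] ≫ τ) ▷ Y ≫ (λ_ Y).hom) := by
  have : (σ ≫ Δ[A]) ▷ X ≫ (α_ A A X).hom ≫ A ◁ A ◁ f =
      𝟙_ C ◁ f ≫ (σ ≫ Δ[A]) ▷ (A ⊗ Y) ≫ (α_ A A (A ⊗ Y)).hom := by
    rw [whisker_exchange_assoc]
    simp
  rw [MonoidalCategory.whiskerLeft_comp A (A ◁ f), reassoc_of% this,
    ← leftUnitor_inv_naturality_assoc, frobenius]
  monoidal

open scoped HopfObj

variable [SymmetricCategory C] {A : C} [HopfObj A] [IsCommComonObj A]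

/-- This is the convolution product of the zigzag with the identity. In Sweedler notation it sends a
to the sum of σ₁ a₁ τ(σ₂ a₂) (factors reordered by cocommutativity), the contraction of σa by τ,
which is τ(σa) times the unit. -/
lemma frobenius_conv (σ : 𝟙_ C ⟶ A) {τ : A ⟶ 𝟙_ C} (hτ : rcomul τ = τ ≫ η[A]) :
    Δ[A] ≫ frobenius σ τ ▷ A ≫ μ[A] = lmul σ ≫ τ ≫ η[A] := by
  have h₁ : A ◁ (β_ A A).hom ≫ (α_ A A A).inv ≫ (μ[A] ≫ τ) ▷ A ≫ (λ_ A).hom =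
      (α_ A A A).inv ≫ (β_ A A).hom ▷ A ≫ (α_ A A A).hom ≫ A ◁ (μ[A] ≫ τ) ≫ (ρ_ A).hom := by
    have : A ◁ (μ[A] ≫ τ) ≫ (ρ_ A).hom =
        (β_ A (A ⊗ A)).hom ≫ (μ[A] ≫ τ) ▷ A ≫ (λ_ A).hom := by
      rw [← BraidedCategory.braiding_naturality_right_assoc, braiding_tensorUnit_right]
      simp
    rw [this, BraidedCategory.braiding_tensor_right_hom]
    simp only [Category.assoc, Iso.hom_inv_id_assoc]
    rw [← comp_whiskerRight_assoc, SymmetricCategory.symmetry]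
    simp
  have h₂ : A ◁ Δ[A] ≫ (α_ A A A).inv ≫ (Δ[A] ▷ A ≫ (α_ A A A).hom ≫ A ◁ (μ[A] ≫ τ) ≫
      (ρ_ A).hom) ▷ A ≫ μ[A] = μ[A] ≫ rcomul τ := by
    calc _ = A ◁ Δ[A] ≫ Δ[A] ▷ (A ⊗ A) ≫ (α_ A A (A ⊗ A)).hom ≫
          A ◁ (A ◁ (β_ A A).hom ≫ (α_ A A A).inv ≫ (μ[A] ≫ τ) ▷ A ≫ (λ_ A).hom) ≫ μ[A] := by
          have : Δ[A] ▷ (A ⊗ A) ≫ (α_ A A (A ⊗ A)).hom ≫ A ◁ A ◁ (β_ A A).hom =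
              A ◁ (β_ A A).hom ≫ Δ[A] ▷ (A ⊗ A) ≫ (α_ A A (A ⊗ A)).hom := by
            rw [whisker_exchange_assoc]
            simp
          rw [MonoidalCategory.whiskerLeft_comp A (A ◁ _), Category.assoc, reassoc_of% this,
            ← MonoidalCategory.whiskerLeft_comp_assoc, IsCommComonObj.comul_comm]
          monoidal
      _ = (Δ[A] ⊗ₘ Δ[A]) ≫ tensorμ A A A A ≫ (μ[A] ⊗ₘ μ[A]) ≫ A ◁ τ ≫ (ρ_ A).hom := by
          rw [h₁, tensorμ, MonoidalCategory.tensorHom_def' Δ[A], MonoidalCategory.tensorHom_def μ[A]]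
          have : μ[A] ▷ (A ⊗ A) ≫ A ◁ μ[A] ≫ A ◁ τ ≫ (ρ_ A).hom =
              (A ⊗ A) ◁ (μ[A] ≫ τ) ≫ (ρ_ _).hom ≫ μ[A] := by
            rw [← rightUnitor_naturality, whisker_exchange_assoc,
              MonoidalCategory.whiskerLeft_comp, Category.assoc]
          simp only [Category.assoc]
          rw [this]
          monoidal
      _ = _ := by
          rw [rcomul, BimonObj.mul_comul_assoc]
  have h₃ : Δ[A] ≫ frobenius σ τ ▷ A ≫ μ[A] = (λ_ A).inv ≫ σ ▷ A ≫ A ◁ Δ[A] ≫ (α_ A A A).inv ≫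
      (Δ[A] ▷ A ≫ (α_ A A A).hom ≫ A ◁ (μ[A] ≫ τ) ≫ (ρ_ A).hom) ▷ A ≫ μ[A] := by
    rw [← whisker_exchange_assoc, ← leftUnitor_inv_naturality_assoc, frobenius]
    monoidal
  rw [h₃, h₂, hτ, lmul]
  simp only [Category.assoc]

/-- By `frobenius_conv` the zigzag is a convolution inverse of the identity up to the scalar `σ ≫
τ`; convolving with the antipode isolates it. Neither `σ` nor `τ` need be normalized, which matters
in the proof that the image has invertible volume. -/
theorem frobenius_eq {σ : 𝟙_ C ⟶ A} {τ : A ⟶ 𝟙_ C} (hσ : lmul σ = ε[A] ≫ σ)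
    (hτ : rcomul τ = τ ≫ η[A]) : frobenius σ τ = scalarMul (σ ≫ τ) 𝒮[A] := by
  have h : Δ[A] ≫ (Δ[A] ≫ frobenius σ τ ▷ A ≫ μ[A]) ▷ A ≫ A ◁ 𝒮[A] ≫ μ[A] = frobenius σ τ := by
    calc _ = Δ[A] ≫ Δ[A] ▷ A ≫ (α_ A A A).hom ≫ frobenius σ τ ▷ (A ⊗ A) ≫ A ◁ A ◁ 𝒮[A] ≫
          A ◁ μ[A] ≫ μ[A] := by
          have : (frobenius σ τ ▷ A) ▷ A ≫ μ[A] ▷ A ≫ A ◁ 𝒮[A] ≫ μ[A] =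
              (α_ A A A).hom ≫ frobenius σ τ ▷ (A ⊗ A) ≫ A ◁ A ◁ 𝒮[A] ≫ A ◁ μ[A] ≫ μ[A] := by
            rw [← whisker_exchange_assoc, MonObj.mul_assoc]
            simp
          rw [← this]
          simp
      _ = Δ[A] ≫ frobenius σ τ ▷ A ≫ A ◁ (Δ[A] ≫ A ◁ 𝒮[A] ≫ μ[A]) ≫ μ[A] := by
          rw [← ComonObj.comul_assoc_assoc, whisker_exchange_assoc]
          simp only [MonoidalCategory.whiskerLeft_comp, Category.assoc]
      _ = _ := by
          rw [HopfObj.antipode_right, MonoidalCategory.whiskerLeft_comp, Category.assoc,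
            MonObj.mul_one, ← whisker_exchange_assoc, ComonObj.comul_counit_assoc]
          simp
  rw [← h, frobenius_conv σ hτ, hσ]
  have : (ε[A] ≫ σ) ≫ τ ≫ η[A] = ε[A] ≫ scalarMul (σ ≫ τ) η[A] := by
    rw [scalarMul_of_source]
    simp
  rw [this, comp_whiskerRight, scalarMul_whiskerRight, comp_scalarMul, scalarMul_comp,
    comp_scalarMul, Category.assoc, ← whisker_exchange_assoc, MonObj.one_mul,
    ComonObj.counit_comul_assoc]
  simp

end Frobenius

/-! ### Consequences of Frobenius self-duality -/

section Duality

open scoped HopfObj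

variable {C : Type u} [Category.{v} C] [MonoidalCategory C] [SymmetricCategory C]

lemma isIso_antipode (A : C) [HopfObj A] [IsCommMonObj A] : IsIso 𝒮[A] := by
  have h := HopfObj.antipode_antipode A (IsCommMonObj.mul_comm A)
  exact ⟨𝒮[A], h, h⟩

lemma isBimonHom_antipode (A : C) [HopfObj A] [IsCommMonObj A] [IsCommComonObj A] :
    IsBimonHom 𝒮[A] where
  one_hom := HopfObj.one_antipode A
  mul_hom := mul_antipode_of_isCommMonObj A
  hom_counit := HopfObj.antipode_counit A
  hom_comul := antipode_comul_of_isCommComonObj A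

lemma IsNormalizedIntegral.comp_antipode {A : C} [HopfObj A] [IsCommMonObj A] [IsCommComonObj A]
    {σ : 𝟙_ C ⟶ A} (h : IsNormalizedIntegral A σ) : σ ≫ 𝒮[A] = σ := by
  have := isIso_antipode A
  have := isBimonHom_antipode A
  exact (h.comp_epi 𝒮[A]).unique h

lemma comp_frobenius {A : C} [MonObj A] [ComonObj A] [IsCommMonObj A] (x σ : 𝟙_ C ⟶ A)
    (τ : A ⟶ 𝟙_ C) : x ≫ frobenius σ τ = σ ≫ rcomul (lmul x ≫ τ) := by
  have h : lmul x = (ρ_ A).inv ≫ A ◁ x ≫ μ[A] := by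
    rw [lmul, ← IsCommMonObj.mul_comm A, BraidedCategory.braiding_naturality_left_assoc,
      braiding_tensorUnit_left]
    simp
  rw [frobenius, leftUnitor_inv_naturality_assoc, whisker_exchange_assoc, rcomul, h]
  simp [unitors_inv_equal]

variable {A : C} [HopfObj A] [IsCommMonObj A] [IsCommComonObj A] {σ : 𝟙_ C ⟶ A} {τ : A ⟶ 𝟙_ C}

/-- Nondegeneracy of the Frobenius pairing: contracting back with the copairing recovers the
morphism up to the antipode and `σ ≫ τ`, both invertible. -/
lemma eq_of_pairing_eq (hσ : lmul σ = ε[A] ≫ σ) (hτ : rcomul τ = τ ≫ η[A]) [IsIso (σ ≫ τ)]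
    {X Y : C} {f g : X ⟶ A ⊗ Y}
    (h : A ◁ f ≫ (α_ A A Y).inv ≫ (μ[A] ≫ τ) ▷ Y ≫ (λ_ Y).hom =
      A ◁ g ≫ (α_ A A Y).inv ≫ (μ[A] ≫ τ) ▷ Y ≫ (λ_ Y).hom) : f = g := by
  have := isIso_antipode A
  rw [← cancel_mono (𝒮[A] ▷ Y)]
  refine scalarMul_inj (σ ≫ τ) ?_
  rw [← comp_scalarMul, ← scalarMul_whiskerRight, ← frobenius_eq hσ hτ,
    comp_frobenius_whiskerRight, h, ← comp_frobenius_whiskerRight, frobenius_eq hσ hτ,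
    scalarMul_whiskerRight, comp_scalarMul]

/-- An object with a nondegenerate pairing and copairing is dualizable, so tensoring with it is a
left adjoint and preserves epimorphisms; the proof bends the wire by hand. -/
lemma epi_whiskerRight_of_frobenius (hσ : lmul σ = ε[A] ≫ σ) (hτ : rcomul τ = τ ≫ η[A])
    [IsIso (σ ≫ τ)] {X J : C} (π : X ⟶ J) [Epi π] : Epi (π ▷ A) where
  left_cancellation {Y} g g' h := by
    have := isIso_antipode A
    rw [← cancel_epi (J ◁ 𝒮[A])]
    refine scalarMul_inj (σ ≫ τ) ?_
    have key : (ρ_ J).inv ≫ J ◁ (σ ≫ Δ[A]) ≫ (α_ J A A).inv ≫ g ▷ A =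
        (ρ_ J).inv ≫ J ◁ (σ ≫ Δ[A]) ≫ (α_ J A A).inv ≫ g' ▷ A := by
      rw [← cancel_epi π]
      simp only [rightUnitor_inv_naturality_assoc, ← whisker_exchange_assoc,
        whiskerRight_tensor, Category.assoc, Iso.hom_inv_id_assoc, ← comp_whiskerRight, h]
    rw [← scalarMul_comp, ← whiskerLeft_scalarMul, ← frobenius_eq hσ hτ,
      whiskerLeft_frobenius_comp, key, ← whiskerLeft_frobenius_comp, frobenius_eq hσ hτ,
      whiskerLeft_scalarMul, scalarMul_comp]

lemma rcomul_comp_of_coinvariant' {A Q : C} [ComonObj A] [IsCommComonObj A] [MonObj Q]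
    (p : A ⟶ Q) (t : Q ⟶ 𝟙_ C) {W : C} (f : A ⟶ W)
    (hf : (Δ[A] ≫ p ▷ A) ≫ Q ◁ f = trivLeftCoaction Q A ≫ Q ◁ f) :
    rcomul (p ≫ t) ≫ f = scalarMul (η[Q] ≫ t) f := by
  have : rcomul (p ≫ t) = Δ[A] ≫ (p ≫ t) ▷ A ≫ (λ_ A).hom := by
    rw [rcomul]
    nth_rw 1 [← IsCommComonObj.comul_comm A]
    rw [Category.assoc, ← BraidedCategory.braiding_naturality_left_assoc,
      braiding_tensorUnit_left]
    simp
  have : rcomul (p ≫ t) ≫ f = ((Δ[A] ≫ p ▷ A) ≫ Q ◁ f) ≫ t ▷ W ≫ (λ_ W).hom := by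
    rw [this, Category.assoc, Category.assoc, ← leftUnitor_naturality, comp_whiskerRight,
      Category.assoc, ← whisker_exchange_assoc]
    simp
  rw [this, hf, trivLeftCoaction, scalarMul_eq]
  simp [whisker_exchange_assoc]

end Duality

/-! ### Invertibility of the volume of an image -/

section Image

open scoped HopfObj

variable {C : Type u} [Category.{v} C] [MonoidalCategory C]

lemma action_comp_pairing {M L H : C} (F : L ⟶ M ⊗ L) (B : M ⊗ M ⟶ 𝟙_ C) (φ : L ⊗ H ⟶ 𝟙_ C) :
    (M ◁ F ≫ (α_ M M L).inv ≫ B ▷ L ≫ (λ_ L).hom) ▷ H ≫ φ =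
      (α_ M L H).hom ≫ M ◁ (F ▷ H ≫ (α_ M L H).hom ≫ M ◁ φ ≫ (ρ_ M).hom) ≫ B := by
  calc _ = (M ◁ F) ▷ H ≫ (α_ M M L).inv ▷ H ≫ (α_ (M ⊗ M) L H).hom ≫ B ▷ (L ⊗ H) ≫
        𝟙_ C ◁ φ ≫ (λ_ _).hom := by
        monoidal
    _ = _ := by
        rw [← whisker_exchange_assoc]
        monoidal

lemma action_comp {M L J : C} (F : L ⟶ M ⊗ L) (B : M ⊗ M ⟶ 𝟙_ C) (π : L ⟶ J) :
    (M ◁ F ≫ (α_ M M L).inv ≫ B ▷ L ≫ (λ_ L).hom) ≫ π =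
      M ◁ (F ≫ M ◁ π) ≫ (α_ M M J).inv ≫ B ▷ J ≫ (λ_ J).hom := by
  simp only [Category.assoc, MonoidalCategory.whiskerLeft_comp]
  rw [← leftUnitor_naturality, ← whisker_exchange_assoc]
  simp

lemma epi_whiskerRight_of_retract {K H X J : C} (π : X ⟶ J) [Epi (π ▷ H)] (n : K ⟶ H)
    (E : H ⟶ K) (h : n ≫ E = 𝟙 K) : Epi (π ▷ K) where
  left_cancellation {Y} g g' hg := by
    have : J ◁ E ≫ g = J ◁ E ≫ g' := by
      rw [← cancel_epi (π ▷ H), ← whisker_exchange_assoc, hg, whisker_exchange_assoc]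
    simpa [← MonoidalCategory.whiskerLeft_comp_assoc, h] using J ◁ n ≫= this

variable [SymmetricCategory C]

lemma tensorμ_unit_middle (A A' B : C) : tensorμ A A' (𝟙_ C) B ≫ (ρ_ A).hom ▷ (A' ⊗ B) =
    (A ⊗ A') ◁ (λ_ B).hom ≫ (α_ A A' B).hom := by
  simp only [tensorμ, braiding_tensorUnit_right]
  monoidal

/-- The left coaction of `B` on `A` through `ξ`. -/
def leftCoactionThrough {A B : HopfBC C} (ξ : A ⟶ B) : A.X ⟶ B.X ⊗ A.X := Δ[A.X] ≫ ξ.hom ▷ A.X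

lemma coactionThrough_braiding {A B : HopfBC C} (ξ : A ⟶ B) :
    coactionThrough ξ ≫ (β_ A.X B.X).hom = leftCoactionThrough ξ := by
  rw [coactionThrough, Category.assoc, BraidedCategory.braiding_naturality_right,
    IsCommComonObj.comul_comm_assoc, leftCoactionThrough]

lemma trivRightCoaction_braiding (B Y : C) [MonObj B] :
    trivRightCoaction B Y ≫ (β_ Y B).hom = trivLeftCoaction B Y := by
  rw [trivRightCoaction, Category.assoc, BraidedCategory.braiding_naturality_right,
    braiding_tensorUnit_right, trivLeftCoaction]
  simp

lemma comp_leftCoactionThrough {A B : HopfBC C} (ξ : A ⟶ B) {W : C} {f : W ⟶ A.X}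
    (hf : f ≫ coactionThrough ξ = f ≫ trivRightCoaction B.X A.X) :
    f ≫ leftCoactionThrough ξ = f ≫ trivLeftCoaction B.X A.X := by
  rw [← coactionThrough_braiding, reassoc_of% hf, trivRightCoaction_braiding]

/-- Multiplication by elements that are coinvariant is colinear. -/
lemma mul_leftCoactionThrough {A B : HopfBC C} (ξ : A ⟶ B) {W : C} {f : W ⟶ A.X}
    (hf : f ≫ coactionThrough ξ = f ≫ trivRightCoaction B.X A.X) :
    A.X ◁ f ≫ μ[A.X] ≫ leftCoactionThrough ξ =
      leftCoactionThrough ξ ▷ W ≫ (α_ B.X A.X W).hom ≫ B.X ◁ (A.X ◁ f ≫ μ[A.X]) := by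
  have h₁ : μ[A.X] ≫ leftCoactionThrough ξ =
      (leftCoactionThrough ξ ⊗ₘ leftCoactionThrough ξ) ≫ tensorμ B.X A.X B.X A.X ≫
        (μ[B.X] ⊗ₘ μ[A.X]) := by
    simp only [leftCoactionThrough, BimonObj.mul_comul_assoc, ← tensorHom_comp_tensorHom,
      ← tensorHom_id, Category.assoc]
    rw [tensorμ_natural_assoc]
    simp only [tensorHom_comp_tensorHom, IsMonHom.mul_hom, Category.id_comp, id_tensorHom_id,
      Category.comp_id]
  have h₂ : (leftCoactionThrough ξ ⊗ₘ trivLeftCoaction B.X A.X) ≫ tensorμ B.X A.X B.X A.X ≫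
      (μ[B.X] ⊗ₘ μ[A.X]) = leftCoactionThrough ξ ▷ A.X ≫ (α_ B.X A.X A.X).hom ≫
        B.X ◁ μ[A.X] := by
    have : (leftCoactionThrough ξ ⊗ₘ trivLeftCoaction B.X A.X) =
        (leftCoactionThrough ξ ⊗ₘ (λ_ A.X).inv) ≫ ((𝟙 B.X ⊗ₘ 𝟙 A.X) ⊗ₘ (η[B.X] ⊗ₘ 𝟙 A.X)) := by
      rw [tensorHom_comp_tensorHom, id_tensorHom_id, Category.comp_id, tensorHom_id,
        trivLeftCoaction]
    rw [this, Category.assoc, tensorμ_natural_assoc, tensorHom_comp_tensorHom]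
    have : (𝟙 B.X ⊗ₘ η[B.X]) ≫ μ[B.X] ⊗ₘ (𝟙 A.X ⊗ₘ 𝟙 A.X) ≫ μ[A.X] =
        (ρ_ B.X).hom ▷ (A.X ⊗ A.X) ≫ B.X ◁ μ[A.X] := by
      simp [MonoidalCategory.tensorHom_def]
    rw [this, reassoc_of% tensorμ_unit_middle, MonoidalCategory.tensorHom_def]
    simp
  have h₃ : A.X ◁ f ≫ (leftCoactionThrough ξ ⊗ₘ leftCoactionThrough ξ) =
      A.X ◁ f ≫ (leftCoactionThrough ξ ⊗ₘ trivLeftCoaction B.X A.X) := by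
    rw [MonoidalCategory.tensorHom_def', MonoidalCategory.tensorHom_def',
      ← MonoidalCategory.whiskerLeft_comp_assoc, comp_leftCoactionThrough ξ hf,
      MonoidalCategory.whiskerLeft_comp_assoc]
  rw [h₁, reassoc_of% h₃, h₂, whisker_exchange_assoc]
  simp

lemma leftCoactionThrough_cointegral {A B : HopfBC C} (ξ : A ⟶ B) {τ : A.X ⟶ 𝟙_ C}
    (hτ : rcomul τ = τ ≫ η[A.X]) :
    leftCoactionThrough ξ ≫ B.X ◁ τ = trivLeftCoaction B.X A.X ≫ B.X ◁ τ := by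
  have : Δ[A.X] ≫ A.X ◁ τ = τ ≫ η[A.X] ≫ (ρ_ A.X).inv := by
    rw [← reassoc_of% hτ, rcomul]
    simp
  rw [leftCoactionThrough, Category.assoc, ← whisker_exchange, reassoc_of% this, trivLeftCoaction,
    Category.assoc, ← whisker_exchange, ← rightUnitor_inv_naturality, IsMonHom.one_hom_assoc]
  rw [← leftUnitor_inv_naturality_assoc]
  simp [unitors_inv_equal, -IsMonHom.one_hom, -IsMonHom.one_hom_assoc]

/-- A quotient of `L` on which `M` coacts trivially through `q`, such that every pairing of `L`
that is balanced with respect to `q` descends to it. -/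
lemma exists_dual_quotient [HasCoequalizers C] {L M : HopfBC C} (q : L ⟶ M) {σ : 𝟙_ C ⟶ M.X}
    {t : M.X ⟶ 𝟙_ C} (hσ : lmul σ = ε[M.X] ≫ σ) (ht : rcomul t = t ≫ η[M.X]) [IsIso (σ ≫ t)] :
    ∃ (J : C) (π : L.X ⟶ J), Epi π ∧
      leftCoactionThrough q ≫ M.X ◁ π = trivLeftCoaction M.X L.X ≫ M.X ◁ π ∧
      ∀ {H A : C} (φ : L.X ⊗ H ⟶ 𝟙_ C) (c : 𝟙_ C ⟶ H ⊗ A),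
        leftCoactionThrough q ▷ H ≫ (α_ _ _ _).hom ≫ M.X ◁ φ =
          trivLeftCoaction M.X L.X ▷ H ≫ (α_ _ _ _).hom ≫ M.X ◁ φ →
        ∃ ψ : J ⟶ 𝟙_ C ⊗ A, π ≫ ψ = (ρ_ L.X).inv ≫ L.X ◁ c ≫ (α_ L.X H A).inv ≫ φ ▷ A := by
  -- The pairing on M turns a coaction into an action, and coequalizing the two actions trivializes
  -- the coaction by nondegeneracy. A pairing φ is descended only in its transposed form ψ, since
  -- this coequalizer is not known to be preserved by tensoring.
  let act (F : L.X ⟶ M.X ⊗ L.X) : M.X ⊗ L.X ⟶ L.X :=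
    M.X ◁ F ≫ (α_ _ _ _).inv ≫ (μ[M.X] ≫ t) ▷ L.X ≫ (λ_ L.X).hom
  have h := isCoequalizer_coequalizer (act (leftCoactionThrough q)) (act (trivLeftCoaction M.X L.X))
  refine ⟨_, _, h.epi, eq_of_pairing_eq hσ ht ?_, fun {H A} φ c hφ => ?_⟩
  · rw [← action_comp, ← action_comp]
    exact h.condition
  · refine h.exists_desc _ ?_
    have key : act (leftCoactionThrough q) ▷ H ≫ φ = act (trivLeftCoaction M.X L.X) ▷ H ≫ φ := by
      rw [action_comp_pairing, action_comp_pairing, reassoc_of% hφ]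
    simp only [rightUnitor_inv_naturality_assoc, ← whisker_exchange_assoc, whiskerRight_tensor,
      Category.assoc, Iso.hom_inv_id_assoc, ← comp_whiskerRight, key]

lemma IsNormalizedIntegral.comp_lmul {A : C} [BimonObj A] {σ : 𝟙_ C ⟶ A}
    (h : IsNormalizedIntegral A σ) (x : 𝟙_ C ⟶ A) : σ ≫ lmul x = (x ≫ ε[A]) ≫ σ := by
  rw [comp_lmul_eq, MonoidalCategory.tensorHom_def, Category.assoc, h.right,
    MonoidalCategory.tensorHom_def, Category.assoc, ← comp_whiskerRight_assoc]
  simp [unitors_inv_equal]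

/-- The quotient J of L plays the role of the dual of I: it is dual to the inclusion of I into L.
The duality of L supplies a copairing on I and J, that of H a pairing. The loop they form,
multiplied by the inverse volume of I, is the product of the inverse volumes of L and H. -/
theorem isIso_integral_comp_cointegral [HasEqualizers C] [HasCoequalizers C] (hC : IsBistable C)
    {K H I L M : HopfBC C} {n : K ⟶ H} {p : H ⟶ I} {j : I ⟶ L} {q : L ⟶ M}
    (h₁ : IsExtension n p) (h₂ : IsExtension j q) {σH : 𝟙_ C ⟶ H.X} {τH : H.X ⟶ 𝟙_ C}
    {σL : 𝟙_ C ⟶ L.X} {τL : L.X ⟶ 𝟙_ C} (hσH : IsNormalizedIntegral H.X σH)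
    (hτH : IsNormalizedCointegral H.X τH) (hσL : IsNormalizedIntegral L.X σL)
    (hτL : IsNormalizedCointegral L.X τL) [IsIso (σH ≫ τH)] [IsIso (σL ≫ τL)] :
    IsIso ((σH ≫ p.hom) ≫ j.hom ≫ τL) := by
  have := h₁.cok.epi
  have := h₂.ker.mono
  set σI := σH ≫ p.hom with hσI'
  have hσI : IsNormalizedIntegral I.X σI := hσH.comp_epi p.hom
  have hτI : IsNormalizedCointegral I.X (j.hom ≫ τL) := hτL.mono_comp j.hom
  obtain ⟨s, hs⟩ := h₂.exists_isSection hC.stable hσI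
  obtain ⟨E, hE⟩ := h₁.exists_isRetraction hC.costable hτI
  -- The cointegral on M cannot yet be normalized: its value on the unit is exactly the scalar to be
  -- inverted. Its value on the integral of M is the inverse volume of L, so the Frobenius pairing
  -- on M is still nondegenerate.
  have ht : rcomul (s ≫ τL) = (s ≫ τL) ≫ η[M.X] := by
    rw [hs.integral.left.rcomul_comp, hτL.rcomul_eq]
    simp
  have hqt : q.hom ≫ s ≫ τL = lmul (σI ≫ j.hom) ≫ τL := by rw [reassoc_of% hs.fac]
  have hσM : IsNormalizedIntegral M.X (σL ≫ q.hom) := by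
    have := h₂.cok.epi
    exact hσL.comp_epi q.hom
  have hw : (σL ≫ q.hom) ≫ s ≫ τL = σL ≫ τL := by
    rw [Category.assoc, hqt, reassoc_of% hσL.comp_lmul, Category.assoc,
      IsComonHom.hom_counit_assoc, reassoc_of% hσI.normalized]
  have : IsIso ((σL ≫ q.hom) ≫ s ≫ τL) := by rwa [hw]
  have hη : η[M.X] ≫ s ≫ τL = σI ≫ j.hom ≫ τL := by
    rw [← IsMonHom.one_hom q.hom, Category.assoc, hqt, one_lmul_assoc, Category.assoc]
  obtain ⟨J, π, hπ, hcoinv, hdual⟩ := exists_dual_quotient q hσM.lmul_eq ht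
  have := hC.stable
  -- the copairing
  obtain ⟨c, hc⟩ : ∃ c : 𝟙_ C ⟶ I.X ⊗ J, c ≫ j.hom ▷ J = σL ≫ Δ[L.X] ≫ L.X ◁ π := by
    refine (hC.costable.isEqualizer_whiskerRight (isRightCoaction_coactionThrough q)
      h₂.ker J).exists_lift _ ?_
    have h₃ : Δ[L.X] ≫ coactionThrough q ▷ L.X =
        Δ[L.X] ≫ L.X ◁ leftCoactionThrough q ≫ (α_ _ _ _).inv := by
      rw [coactionThrough, leftCoactionThrough, comp_whiskerRight, ComonObj.comul_assoc_flip_assoc]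
      simp
    have h₄ : trivRightCoaction M.X L.X ▷ L.X =
        L.X ◁ trivLeftCoaction M.X L.X ≫ (α_ _ _ _).inv := by
      simp [trivRightCoaction, trivLeftCoaction]
    simp only [Category.assoc, whisker_exchange]
    rw [reassoc_of% h₃, h₄, Category.assoc, ← associator_inv_naturality_right,
      ← MonoidalCategory.whiskerLeft_comp_assoc, hcoinv, MonoidalCategory.whiskerLeft_comp_assoc]
  -- Contracting by the cointegral of M multiplies a coinvariant quotient map by its value on the
  -- unit. On the other side that contraction is translation by the integral of I, and the Frobenius
  -- identity on L turns the copairing into the one made from the comultiplication of I.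
  have hc' : scalarMul (σI ≫ j.hom ≫ τL) c =
      scalarMul (σL ≫ τL) (σI ≫ Δ[I.X] ≫ I.X ◁ (j.hom ≫ π)) := by
    have := (hC.costable.isEqualizer_whiskerRight (isRightCoaction_coactionThrough q)
      h₂.ker J).mono
    rw [← cancel_mono (j.hom ▷ J), scalarMul_comp, hc, ← comp_scalarMul, ← comp_scalarMul,
      ← whiskerLeft_scalarMul, ← hη, ← rcomul_comp_of_coinvariant' _ _ _ hcoinv, hqt,
      MonoidalCategory.whiskerLeft_comp, ← reassoc_of% rcomul_comul, ← reassoc_of% comp_frobenius,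
      frobenius_eq hσL.lmul_eq hτL.rcomul_eq, scalarMul_comp, scalarMul_comp, comp_scalarMul,
      Category.assoc, reassoc_of% HopfObj.hom_antipode j.hom, reassoc_of% hσI.comp_antipode,
      IsComonHom.hom_comul_assoc, MonoidalCategory.tensorHom_def]
    simp [whisker_exchange_assoc, whisker_exchange]
  -- the pairing
  set φ : L.X ⊗ H.X ⟶ 𝟙_ C := L.X ◁ (p.hom ≫ j.hom) ≫ μ[L.X] ≫ τL with hφ
  have hω : (p.hom ≫ j.hom) ≫ coactionThrough q =
      (p.hom ≫ j.hom) ≫ trivRightCoaction M.X L.X := by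
    rw [Category.assoc, h₂.ker.condition, Category.assoc]
  obtain ⟨ψ, hψ⟩ := hdual φ (σH ≫ Δ[H.X]) (by
    have h₃ : trivLeftCoaction M.X L.X ▷ H.X ≫ (α_ _ _ _).hom =
        trivLeftCoaction M.X (L.X ⊗ H.X) := by
      simp [trivLeftCoaction]
    have h₄ := mul_leftCoactionThrough q hω =≫ M.X ◁ τL
    simp only [Category.assoc, leftCoactionThrough_cointegral q hτL.rcomul_eq,
      ← MonoidalCategory.whiskerLeft_comp] at h₄
    rw [← h₄, reassoc_of% h₃, trivLeftCoaction_whiskerLeft, trivLeftCoaction_whiskerLeft, hφ]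
    simp)
  -- Self-duality of H transposes ψ back to a pairing; the cost is an antipode and the inverse
  -- volume of H.
  set eH : J ⊗ H.X ⟶ 𝟙_ C :=
    ψ ▷ H.X ≫ (α_ _ _ _).hom ≫ 𝟙_ C ◁ (μ[H.X] ≫ τH) ≫ (ρ_ _).hom with heH
  have hπe : π ▷ H.X ≫ eH = scalarMul (σH ≫ τH) (L.X ◁ 𝒮[H.X] ≫ φ) := by
    rw [heH, ← comp_whiskerRight_assoc, hψ, ← whiskerLeft_frobenius_comp,
      frobenius_eq hσH.lmul_eq hτH.rcomul_eq, whiskerLeft_scalarMul, scalarMul_comp]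
  obtain ⟨e, he⟩ : ∃ e : J ⊗ I.X ⟶ 𝟙_ C, J ◁ p.hom ≫ e = eH := by
    refine (hC.stable.isCoequalizer_whiskerLeft (isLeftAction_actionThrough n)
      h₁.cok J).exists_desc _ ?_
    have h₃ : Epi (π ▷ H.X) := epi_whiskerRight_of_frobenius hσH.lmul_eq hτH.rcomul_eq π
    -- No volume is known for K, but K is a retract of H in `C` through the integral along `n`, so
    -- tensoring with K also keeps `π` epi.
    have h₄ : Epi (π ▷ K.X) := epi_whiskerRight_of_retract π n.hom E hE.hom_comp
    have h₅ : Epi (π ▷ K.X ▷ H.X) :=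
      epi_whiskerRight_of_frobenius hσH.lmul_eq hτH.rcomul_eq (π ▷ K.X)
    have h₆ : Epi (π ▷ (K.X ⊗ H.X)) := by
      rw [whiskerRight_tensor]
      infer_instance
    have h₇ : actionThrough n ≫ 𝒮[H.X] ≫ p.hom ≫ j.hom =
        trivLeftAction K.X H.X ≫ 𝒮[H.X] ≫ p.hom ≫ j.hom := by
      rw [← reassoc_of% HopfObj.hom_antipode p.hom, reassoc_of% h₁.cok.condition]
    rw [← cancel_epi (π ▷ (K.X ⊗ H.X)), ← whisker_exchange_assoc, ← whisker_exchange_assoc, hπe,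
      comp_scalarMul, comp_scalarMul, hφ]
    simp only [← MonoidalCategory.whiskerLeft_comp_assoc, h₇]
  have h₃ : (σI ≫ j.hom ≫ τL) ≫ c ≫ (β_ I.X J).hom ≫ e = (σL ≫ τL) ≫ σH ≫ τH := by
    rw [← Category.assoc, ← scalarMul_of_source, hc', scalarMul_comp, scalarMul_of_source]
    congr 1
    have h₄ : Δ[H.X] ≫ (p.hom ≫ j.hom) ▷ H.X ≫ L.X ◁ 𝒮[H.X] ≫ φ =
        ε[H.X] ≫ η[H.X] ≫ p.hom ≫ j.hom ≫ τL := by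
      have : (p.hom ≫ j.hom) ▷ H.X ≫ L.X ◁ (p.hom ≫ j.hom) ≫ μ[L.X] =
          μ[H.X] ≫ p.hom ≫ j.hom := by
        rw [IsMonHom.mul_hom_assoc, IsMonHom.mul_hom, MonoidalCategory.tensorHom_def,
          MonoidalCategory.tensorHom_def]
        simp [whisker_exchange_assoc]
      rw [← whisker_exchange_assoc, hφ, reassoc_of% this, HopfObj.antipode_right_assoc]
    have h₅ : Δ[I.X] ≫ I.X ◁ (j.hom ≫ π) ≫ (β_ I.X J).hom =
        Δ[I.X] ≫ j.hom ▷ I.X ≫ π ▷ I.X := by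
      rw [BraidedCategory.braiding_naturality_right, IsCommComonObj.comul_comm_assoc,
        comp_whiskerRight]
    simp only [Category.assoc]
    rw [reassoc_of% h₅, hσI', Category.assoc, IsComonHom.hom_comul_assoc,
      MonoidalCategory.tensorHom_def, Category.assoc, whisker_exchange_assoc,
      whisker_exchange_assoc, he, hπe, comp_scalarMul, comp_scalarMul, comp_scalarMul,
      ← comp_whiskerRight_assoc, h₄, comp_scalarMul, scalarMul_of_source]
    simp [hσH.normalized, hτI.normalized]
  have h₄ : IsIso ((σI ≫ j.hom ≫ τL) ≫ c ≫ (β_ I.X J).hom ≫ e) := by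
    rw [h₃]
    infer_instance
  set x := c ≫ (β_ I.X J).hom ≫ e
  -- Endomorphisms of the unit commute, so a factor of an invertible one is invertible.
  refine ⟨x ≫ inv ((σI ≫ j.hom ≫ τL) ≫ x), ?_, ?_⟩
  · rw [← Category.assoc, IsIso.hom_inv_id]
  · rw [unit_endo_comm, ← Category.assoc, IsIso.hom_inv_id]

end Image

/-! ### Integrals of the kernel and cokernel from the volume of the image -/

section KernelCokernel

variable {C : Type u} [Category.{v} C] [MonoidalCategory C]

lemma lmul_scalar {A : C} [MonObj A] (r : 𝟙_ C ⟶ 𝟙_ C) (x : 𝟙_ C ⟶ A) :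
    lmul (r ≫ x) = scalarMul r (lmul x) := by
  simp [lmul, scalarMul_eq]

variable [SymmetricCategory C]

lemma rcomul_scalar {A : C} [ComonObj A] (r : 𝟙_ C ⟶ 𝟙_ C) (t : A ⟶ 𝟙_ C) :
    rcomul (t ≫ r) = scalarMul r (rcomul t) := by
  rw [rcomul, ← scalarMul_of_target, whiskerLeft_scalarMul, scalarMul_comp, comp_scalarMul, rcomul]

lemma IsNormalizedCointegral.rcomul_comp {A : C} [BimonObj A] {τ : A ⟶ 𝟙_ C}
    (h : IsNormalizedCointegral A τ) (t : A ⟶ 𝟙_ C) : rcomul t ≫ τ = τ ≫ η[A] ≫ t := by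
  rw [rcomul_comp_eq, MonoidalCategory.tensorHom_def, Category.assoc, reassoc_of% h.left,
    MonoidalCategory.tensorHom_def, Category.assoc, ← MonoidalCategory.whiskerLeft_comp_assoc]
  simp

/-- The retraction carries the integral of H to an integral of K whose counit value is `v`, so
dividing by `v` normalizes it. The stated identity is multiplicativity of volumes, here with the
kernel as the unknown. -/
theorem IsExtension.exists_integral_kernel [HasEqualizers C] (hC : IsCostable C)
    {K H I : HopfBC C} {n : K ⟶ H} {p : H ⟶ I} (h : IsExtension n p) {σH : 𝟙_ C ⟶ H.X}
    {τH : H.X ⟶ 𝟙_ C} {τI : I.X ⟶ 𝟙_ C} (hσH : IsNormalizedIntegral H.X σH)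
    (hτH : IsNormalizedCointegral H.X τH) (hτI : IsNormalizedCointegral I.X τI)
    (v : 𝟙_ C ⟶ 𝟙_ C) [IsIso v] (hv : σH ≫ p.hom ≫ τI = v) :
    ∃ σK, IsNormalizedIntegral K.X σK ∧ v ≫ σK ≫ n.hom ≫ τH = σH ≫ τH := by
  obtain ⟨E, hE⟩ := h.exists_isRetraction hC hτI
  refine ⟨inv v ≫ σH ≫ E, isNormalizedIntegral_of_lmul ?_ ?_, ?_⟩
  · rw [lmul_scalar, hE.integral.lmul_comp, hσH.lmul_eq, ← scalarMul_of_source, comp_scalarMul]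
    simp
  · rw [Category.assoc, ← IsComonHom.hom_counit n.hom, Category.assoc, reassoc_of% hE.fac,
      rcomul_counit, hv, IsIso.inv_hom_id]
  · rw [← Category.assoc, IsIso.hom_inv_id_assoc, Category.assoc, reassoc_of% hE.fac,
      hτH.rcomul_comp, IsMonHom.one_hom_assoc, hτI.normalized, Category.comp_id]

/-- Dually, the cointegral of L restricted along the section has value `v` on the unit and is
divided by `v`. -/
theorem IsExtension.exists_cointegral_cokernel [HasCoequalizers C] (hC : IsStable C)
    {I L M : HopfBC C} {j : I ⟶ L} {q : L ⟶ M} (h : IsExtension j q) {σL : 𝟙_ C ⟶ L.X}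
    {τL : L.X ⟶ 𝟙_ C} {σI : 𝟙_ C ⟶ I.X} (hσL : IsNormalizedIntegral L.X σL)
    (hτL : IsNormalizedCointegral L.X τL) (hσI : IsNormalizedIntegral I.X σI)
    (v : 𝟙_ C ⟶ 𝟙_ C) [IsIso v] (hv : σI ≫ j.hom ≫ τL = v) :
    ∃ τM, IsNormalizedCointegral M.X τM ∧ v ≫ σL ≫ q.hom ≫ τM = σL ≫ τL := by
  obtain ⟨s, hs⟩ := h.exists_isSection hC hσI
  refine ⟨(s ≫ τL) ≫ inv v, isNormalizedCointegral_of_rcomul ?_ ?_, ?_⟩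
  · rw [rcomul_scalar, hs.integral.left.rcomul_comp, hτL.rcomul_eq, ← scalarMul_of_target,
      scalarMul_comp]
    simp
  · rw [← IsMonHom.one_hom q.hom, Category.assoc, Category.assoc, reassoc_of% hs.fac,
      one_lmul_assoc, ← Category.assoc, Category.assoc σI, hv, IsIso.hom_inv_id]
  · rw [Category.assoc, reassoc_of% hs.fac, reassoc_of% hσL.comp_lmul, Category.assoc,
      IsComonHom.hom_counit_assoc, reassoc_of% hσI.normalized, ← Category.assoc σL, unit_endo_comm]
    simp

end KernelCokernel

/-! ### The kernel-cokernel sequence of a composite in an abelian category -/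

section AbelianComp

variable {𝒜 : Type u} [Category.{v} 𝒜] [Abelian 𝒜] {X Y Z : 𝒜} (f : X ⟶ Y) (g : Y ⟶ Z)

/-- The morphism from the kernel of `g` to the cokernel of `f`. -/
noncomputable abbrev kernelToCokernel : kernel g ⟶ cokernel f := kernel.ι g ≫ cokernel.π f

/-- The projection from the kernel of a composite to the kernel of `kernelToCokernel`. -/
noncomputable def kernelCompProj : kernel (f ≫ g) ⟶ kernel (kernelToCokernel f g) :=
  kernel.lift _ (kernel.lift g (kernel.ι (f ≫ g) ≫ f) (by simp)) (by simp)

lemma kernelCompProj_fac :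
    kernelCompProj f g ≫ kernel.ι (kernelToCokernel f g) ≫ kernel.ι g =
      kernel.ι (f ≫ g) ≫ f := by
  simp [kernelCompProj]

instance : Epi (kernelCompProj f g) := by
  rw [epi_iff_surjective_up_to_refinements]
  intro A y
  have hS : (ShortComplex.mk f (cokernel.π f) (cokernel.condition f)).Exact :=
    ShortComplex.exact_of_g_is_cokernel _ (cokernelIsCokernel f)
  -- An element of Ker g that dies in Cok f is, after refinement, the image under `f` of some `a`,
  -- and `a` then lies in the kernel of the composite.
  obtain ⟨A', e, he, a, ha⟩ := hS.exact_up_to_refinements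
    (y ≫ kernel.ι (kernelToCokernel f g) ≫ kernel.ι g) (by simp)
  dsimp at a ha
  refine ⟨A', e, he, kernel.lift _ a ?_, ?_⟩
  · rw [← reassoc_of% ha]
    simp
  · rw [← cancel_mono (kernel.ι (kernelToCokernel f g)), ← cancel_mono (kernel.ι g)]
    simp [kernelCompProj_fac, ← ha]

lemma kernelMap_kernelCompProj :
    kernel.map f (f ≫ g) (𝟙 X) g (by simp) ≫ kernelCompProj f g = 0 := by
  rw [← cancel_mono (kernel.ι (kernelToCokernel f g)), ← cancel_mono (kernel.ι g)]
  simp [kernelCompProj_fac]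

/-- `Ker f` is the kernel of the projection from `Ker (f ≫ g)`. -/
noncomputable def isLimitKernelMap :
    IsLimit (KernelFork.ofι _ (kernelMap_kernelCompProj f g)) :=
  KernelFork.IsLimit.ofι' _ _ fun k hk =>
    ⟨kernel.lift f (k ≫ kernel.ι (f ≫ g)) (by
      rw [Category.assoc, ← kernelCompProj_fac, reassoc_of% hk, zero_comp]), by
      rw [← cancel_mono (kernel.ι (f ≫ g))]
      simp⟩

/-- The inclusion of the cokernel of `kernelToCokernel` into the cokernel of a composite. -/
noncomputable def cokernelCompIncl : cokernel (kernelToCokernel f g) ⟶ cokernel (f ≫ g) :=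
  cokernel.desc _ (cokernel.desc f (g ≫ cokernel.π (f ≫ g)) (by
    rw [← Category.assoc, cokernel.condition])) (by simp)

lemma cokernelCompIncl_fac :
    cokernel.π f ≫ cokernel.π (kernelToCokernel f g) ≫ cokernelCompIncl f g =
      g ≫ cokernel.π (f ≫ g) := by
  simp [cokernelCompIncl]

instance : Mono (cokernelCompIncl f g) := by
  refine Preadditive.mono_of_cancel_zero _ fun {A} y hy => ?_
  obtain ⟨A₁, e₁, _, y₁, h₁⟩ := surjective_up_to_refinements_of_epi
    (cokernel.π f ≫ cokernel.π (kernelToCokernel f g)) y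
  have hS : (ShortComplex.mk (f ≫ g) (cokernel.π (f ≫ g)) (cokernel.condition _)).Exact :=
    ShortComplex.exact_of_g_is_cokernel _ (cokernelIsCokernel _)
  obtain ⟨A₂, e₂, _, a, h₂⟩ := hS.exact_up_to_refinements (y₁ ≫ g) (by
    dsimp
    rw [Category.assoc, ← cokernelCompIncl_fac, ← Category.assoc (cokernel.π f), ← Category.assoc y₁,
      ← h₁, Category.assoc, hy, comp_zero])
  dsimp at a h₂
  -- A representative in Y splits into an element of Ker g and one in the image of `f`; both vanish
  -- in the cokernel of `kernelToCokernel f g`.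
  have h₃ : e₂ ≫ y₁ = kernel.lift g (e₂ ≫ y₁ - a ≫ f) (by simp [h₂]) ≫ kernel.ι g + a ≫ f := by
    simp
  have h₄ : kernel.ι g ≫ cokernel.π f ≫ cokernel.π (kernelToCokernel f g) = 0 := by
    rw [← Category.assoc, cokernel.condition]
  rw [← cancel_epi e₁, ← cancel_epi e₂, h₁, reassoc_of% h₃, Preadditive.add_comp, Category.assoc,
    h₄]
  simp

lemma cokernelCompIncl_cokernelMap :
    cokernelCompIncl f g ≫ cokernel.map (f ≫ g) g f (𝟙 Z) (by simp) = 0 := by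
  rw [← cancel_epi (cokernel.π (kernelToCokernel f g)), ← cancel_epi (cokernel.π f)]
  simp [reassoc_of% cokernelCompIncl_fac]

/-- `Cok g` is the cokernel of the inclusion into `Cok (f ≫ g)`. -/
noncomputable def isColimitCokernelMap :
    IsColimit (CokernelCofork.ofπ _ (cokernelCompIncl_cokernelMap f g)) :=
  CokernelCofork.IsColimit.ofπ' _ _ fun k hk =>
    ⟨cokernel.desc g (cokernel.π (f ≫ g) ≫ k) (by
      rw [← Category.assoc, ← cokernelCompIncl_fac, Category.assoc, Category.assoc, hk, comp_zero,
        comp_zero]), by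
      rw [← cancel_epi (cokernel.π (f ≫ g))]
      simp⟩

end AbelianComp

/-! ### The four extensions attached to a composite -/

section AbelianExtension

variable {C : Type u} [Category.{v} C] [MonoidalCategory C] [SymmetricCategory C]
  [HasEqualizers C] [HasCoequalizers C] [Abelian (HopfBC C)] {A B D : HopfBC C}

lemma isExtension_kernelComp (hC : IsBistable C) (f : A ⟶ B) (g : B ⟶ D) :
    IsExtension (kernel.map f (f ≫ g) (𝟙 A) g (by simp)) (kernelCompProj f g) where
  ker := isEqualizer_of_isLimit hC.costable (isLimitKernelMap f g)
  cok := isCoequalizer_of_isColimit hC.stable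
    (Abelian.epiIsCokernelOfKernel _ (isLimitKernelMap f g))

lemma isExtension_cokernelComp (hC : IsBistable C) (f : A ⟶ B) (g : B ⟶ D) :
    IsExtension (cokernelCompIncl f g) (cokernel.map (f ≫ g) g f (𝟙 D) (by simp)) where
  ker := isEqualizer_of_isLimit hC.costable
    (Abelian.monoIsKernelOfCokernel _ (isColimitCokernelMap f g))
  cok := isCoequalizer_of_isColimit hC.stable (isColimitCokernelMap f g)

lemma isExtension_kernel_image (hC : IsBistable C) (f : A ⟶ B) :
    IsExtension (kernel.ι f) (Abelian.factorThruImage f) := by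
  have w : kernel.ι f ≫ Abelian.factorThruImage f = 0 := by
    rw [← cancel_mono (Abelian.image.ι f)]
    simp
  have h : IsLimit (KernelFork.ofι (kernel.ι f) w) :=
    KernelFork.IsLimit.ofι' _ _ fun k hk => ⟨kernel.lift f k (by
      rw [← Abelian.image.fac f, reassoc_of% hk, zero_comp]), by simp⟩
  exact ⟨isEqualizer_of_isLimit hC.costable h,
    isCoequalizer_of_isColimit hC.stable (Abelian.epiIsCokernelOfKernel _ h)⟩

lemma isExtension_image_cokernel (hC : IsBistable C) (f : A ⟶ B) :
    IsExtension (Abelian.image.ι f) (cokernel.π f) :=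
  isExtension_kernel hC (cokernel.π f)

end AbelianExtension

/-! ### Scalar bookkeeping for volumes -/

section Scalar

variable {C : Type u} [Category.{v} C] [MonoidalCategory C]

lemma scalarMul_inv_scalarMul_inv (e₁ e₂ e : 𝟙_ C ≅ 𝟙_ C) (r : 𝟙_ C ⟶ 𝟙_ C)
    (h : r ≫ e.hom = e₁.hom ≫ e₂.hom) {X Y : C} (m : X ⟶ Y) :
    scalarMul e₁.inv (scalarMul e₂.inv (scalarMul r m)) = scalarMul e.inv m := by
  rw [Iso.eq_comp_inv e |>.2 h, scalarMul_scalarMul, scalarMul_scalarMul,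
    unit_endo_comm e₁.inv e₂.inv]
  simp

variable [BraidedCategory C]

lemma invVolIso_hom {X : C} [BimonObj X] (h : HasFiniteVolume X) {σ : 𝟙_ C ⟶ X} {τ : X ⟶ 𝟙_ C}
    (hσ : IsNormalizedIntegral X σ) (hτ : IsNormalizedCointegral X τ) :
    (invVolIso X h).hom = σ ≫ τ :=
  invVol_eq hσ hτ _ _

end Scalar

/-! ### Composition of Fredholm homomorphisms and part (b) -/

section Composition

variable {C : Type u} [Category.{v} C] [MonoidalCategory C] [SymmetricCategory C]
  [Abelian (HopfBC C)] {A B D : HopfBC C}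

/-- The scalar by which the integral along a composite differs from the composite of the
integrals. -/
noncomputable def compScalar (f : A ⟶ B) (g : B ⟶ D) (σ : 𝟙_ C ⟶ (kernel g).X)
    (τ : (cokernel f).X ⟶ 𝟙_ C) : 𝟙_ C ⟶ 𝟙_ C :=
  σ ≫ (kernelToCokernel f g).hom ≫ τ

lemma compScalar_eq (f : A ⟶ B) (g : B ⟶ D) (σ : 𝟙_ C ⟶ (kernel g).X)
    (τ : (cokernel f).X ⟶ 𝟙_ C) : compScalar f g σ τ =
      σ ≫ (Abelian.factorThruImage (kernelToCokernel f g)).hom ≫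
        (Abelian.image.ι (kernelToCokernel f g)).hom ≫ τ := by
  conv_lhs => rw [compScalar, ← Abelian.image.fac (kernelToCokernel f g), HopfBC.comp_hom,
    Category.assoc]

variable [HasEqualizers C]

lemma IsFredholm.of_finiteVolume {ξ : A ⟶ B} (h₁ : HasFiniteVolume (kernel ξ).X)
    (h₂ : HasFiniteVolume (cokernel ξ).X) : IsFredholm ξ :=
  ⟨h₁.isBismall, h₂.isBismall, h₁, h₂⟩

variable [HasCoequalizers C]

lemma IsFredholm.isMuAlong (hC : IsBistable C) {ξ : A ⟶ B} (h : IsFredholm ξ) :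
    IsMuAlong ξ (fredholmIntegral ξ) :=
  isMuAlong_fredholmIntegral hC ξ h.ker_finiteVolume.integral h.cok_finiteVolume.cointegral

/-- The scalar is the inverse volume of the image of `kernelToCokernel f g`: integrals push forward
to the image and cointegrals restrict to it. -/
lemma isIso_compScalar (hC : IsBistable C) (f : A ⟶ B) (g : B ⟶ D) {σ : 𝟙_ C ⟶ (kernel g).X}
    {τ : (cokernel f).X ⟶ 𝟙_ C} (hσ : IsNormalizedIntegral _ σ) (hτ : IsNormalizedCointegral _ τ)
    (hg : HasFiniteVolume (kernel g).X) (hf : HasFiniteVolume (cokernel f).X) :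
    IsIso (compScalar f g σ τ) := by
  obtain ⟨τ', hτ'⟩ := hg.cointegral
  obtain ⟨σ', hσ'⟩ := hf.integral
  have := hg.isIso_comp hσ hτ'
  have := hf.isIso_comp hσ' hτ
  rw [compScalar_eq, ← Category.assoc]
  exact isIso_integral_comp_cointegral hC (isExtension_kernel_image hC _)
    (isExtension_image_cokernel hC _) hσ hτ' hσ' hτ

/-- Two extensions are used: Ker(f ≫ g) by Ker f and Ker δ, and Ker g by Ker δ and the image of δ,
for δ = `kernelToCokernel f g`. Eliminating the volume of Ker δ gives the identity. -/
theorem exists_integrals_kernel_comp (hC : IsBistable C) (f : A ⟶ B) (g : B ⟶ D)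
    {σ : 𝟙_ C ⟶ (kernel g).X} {τ : (cokernel f).X ⟶ 𝟙_ C} (hσ : IsNormalizedIntegral _ σ)
    (hτ : IsNormalizedCointegral _ τ) (hr : IsIso (compScalar f g σ τ))
    {τg : (kernel g).X ⟶ 𝟙_ C} (hτg : IsNormalizedCointegral _ τg)
    {σf : 𝟙_ C ⟶ (kernel f).X} {τf : (kernel f).X ⟶ 𝟙_ C} (hσf : IsNormalizedIntegral _ σf)
    (hτf : IsNormalizedCointegral _ τf) :
    ∃ σ' τ', IsNormalizedIntegral (kernel (f ≫ g)).X σ' ∧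
      IsNormalizedCointegral (kernel (f ≫ g)).X τ' ∧
      compScalar f g σ τ ≫ σ' ≫ τ' = (σ ≫ τg) ≫ σf ≫ τf := by
  have := HopfBC.mono_hom hC (Abelian.image.ι (kernelToCokernel f g))
  have := HopfBC.mono_hom hC (kernel.ι (kernelToCokernel f g))
  obtain ⟨σK, hσK, hK⟩ := (isExtension_kernel_image hC (kernelToCokernel f g)).exists_integral_kernel
    hC.costable hσ hτg (hτ.mono_comp (Abelian.image.ι (kernelToCokernel f g)).hom) _
    (compScalar_eq f g σ τ).symm
  obtain ⟨σ', τ', hσ', hτ', h⟩ := (isExtension_kernelComp hC f g).exists_integrals hC hσf hτf hσK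
    (hτg.mono_comp (kernel.ι (kernelToCokernel f g)).hom)
  exact ⟨σ', τ', hσ', hτ', by rw [h, ← hK]; simp only [Category.assoc]⟩

theorem exists_integrals_cokernel_comp (hC : IsBistable C) (f : A ⟶ B) (g : B ⟶ D)
    {σ : 𝟙_ C ⟶ (kernel g).X} {τ : (cokernel f).X ⟶ 𝟙_ C} (hσ : IsNormalizedIntegral _ σ)
    (hτ : IsNormalizedCointegral _ τ) (hr : IsIso (compScalar f g σ τ))
    {σf : 𝟙_ C ⟶ (cokernel f).X} (hσf : IsNormalizedIntegral _ σf)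
    {σg : 𝟙_ C ⟶ (cokernel g).X} {τg : (cokernel g).X ⟶ 𝟙_ C} (hσg : IsNormalizedIntegral _ σg)
    (hτg : IsNormalizedCointegral _ τg) :
    ∃ σ' τ', IsNormalizedIntegral (cokernel (f ≫ g)).X σ' ∧
      IsNormalizedCointegral (cokernel (f ≫ g)).X τ' ∧
      compScalar f g σ τ ≫ σ' ≫ τ' = (σg ≫ τg) ≫ σf ≫ τ := by
  have := HopfBC.epi_hom hC (Abelian.factorThruImage (kernelToCokernel f g))
  have := HopfBC.epi_hom hC (cokernel.π (kernelToCokernel f g))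
  obtain ⟨τM, hτM, hM⟩ :=
    (isExtension_image_cokernel hC (kernelToCokernel f g)).exists_cointegral_cokernel
      hC.stable hσf hτ (hσ.comp_epi (Abelian.factorThruImage (kernelToCokernel f g)).hom) _
      ((Category.assoc _ _ _).trans (compScalar_eq f g σ τ).symm)
  obtain ⟨σ', τ', hσ', hτ', h⟩ := (isExtension_cokernelComp hC f g).exists_integrals hC
    (hσf.comp_epi (cokernel.π (kernelToCokernel f g)).hom) hτM hσg hτg
  refine ⟨σ', τ', hσ', hτ', ?_⟩
  rw [h, ← Category.assoc, unit_endo_comm (compScalar f g σ τ), ← hM]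
  simp only [Category.assoc]

/-- The composite followed by the product of integrals is translation by a point `g`. This point
lies in Ker(ξ ≫ ξ') and is an integral there, hence a multiple of the normalized one, with factor
its counit value. The generator property then recovers the whole product of integrals from this
translation. -/
theorem fredholmIntegral_comp (hC : IsBistable C) {ξ : A ⟶ B} {ξ' : B ⟶ D} (h : IsFredholm ξ)
    (h' : IsFredholm ξ') (h'' : IsFredholm (ξ ≫ ξ')) {σ : 𝟙_ C ⟶ (kernel ξ').X}
    {τ : (cokernel ξ).X ⟶ 𝟙_ C} (hσ : IsNormalizedIntegral _ σ) (hτ : IsNormalizedCointegral _ τ) :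
    fredholmIntegral ξ' ≫ fredholmIntegral ξ =
      scalarMul (compScalar ξ ξ' σ τ) (fredholmIntegral (ξ ≫ ξ')) := by
  have hμ := h.isMuAlong hC
  have hμ' := h'.isMuAlong hC
  have hμ'' := h''.isMuAlong hC
  have hgen := hμ''.isNormalizedGeneratorIntegral h''.ker_finiteVolume.integral
    h''.cok_finiteVolume.cointegral
  obtain ⟨σ'', hσ''⟩ := h''.ker_finiteVolume.integral
  have hm : IsRightIntegralAlong (ξ ≫ ξ').hom (fredholmIntegral ξ' ≫ fredholmIntegral ξ) :=
    hμ.integral.comp hμ'.integral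
  set g := σ ≫ (kernel.ι ξ').hom ≫ fredholmIntegral ξ with hg
  have hmg : (ξ ≫ ξ').hom ≫ fredholmIntegral ξ' ≫ fredholmIntegral ξ = lmul g := by
    rw [HopfBC.comp_hom, Category.assoc, reassoc_of% hμ'.hom_comp σ hσ, ← hμ.integral.lmul_comp,
      hg, Category.assoc]
  have hcoact : g ≫ coactionThrough (ξ ≫ ξ') = g ≫ trivRightCoaction D.X A.X := by
    have hk := comp_coactionThrough_of_comp_eq_zero _ _ (kernel.condition ξ')
    have hc : fredholmIntegral ξ ≫ coactionThrough (ξ ≫ ξ') =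
        coactionThrough ξ' ≫ fredholmIntegral ξ ▷ D.X := by
      rw [coactionThrough, coactionThrough, HopfBC.comp_hom, MonoidalCategory.whiskerLeft_comp,
        ← reassoc_of% hμ.integral.comul, Category.assoc, whisker_exchange]
    rw [hg, Category.assoc, Category.assoc, hc, reassoc_of% hk, trivRightCoaction_whiskerRight]
    simp only [Category.assoc]
  have heq := isEqualizer_of_isLimit (w := kernel.condition (ξ ≫ ξ')) hC.costable
    (kernelIsKernel _)
  obtain ⟨g', hg'⟩ := heq.exists_lift g hcoact
  have := heq.mono
  have hη : η[D.X] ≫ fredholmIntegral ξ' ≫ fredholmIntegral ξ = g := by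
    rw [← one_lmul g, ← hmg, ← Category.assoc η[A.X], IsMonHom.one_hom (ξ ≫ ξ').hom]
  -- On the kernel, translation by `g` factors through the zero map followed by the product of
  -- integrals, so it is constant with value the image of the unit, namely `g`.
  have hl : lmul g' = ε ≫ g' := by
    rw [← cancel_mono (kernel.ι (ξ ≫ ξ')).hom, lmul_comp_hom, Category.assoc, hg', ← hmg,
      ← Category.assoc, (HopfBC.comp_eq_zero_iff _ _).1 (kernel.condition (ξ ≫ ξ')),
      Category.assoc, hη]
  have hε : g' ≫ ε = compScalar ξ ξ' σ τ := by
    have h₁ : fredholmIntegral ξ ≫ ε = (cokernel.π ξ).hom ≫ τ := by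
      rw [← IsComonHom.hom_counit ξ.hom, reassoc_of% hμ.comp_hom τ hτ, rcomul_counit]
    rw [← IsComonHom.hom_counit (kernel.ι (ξ ≫ ξ')).hom, reassoc_of% hg', hg, Category.assoc,
      Category.assoc, h₁, compScalar, kernelToCokernel, HopfBC.comp_hom, Category.assoc]
  have hg'' : g' = compScalar ξ ξ' σ τ ≫ σ'' := by
    rw [← hε, ← hσ''.comp_lmul, hl, reassoc_of% hσ''.normalized]
  rw [← (hgen.generator _ (Or.inl hm)).2, hmg, ← hg', hg'', Category.assoc, lmul_scalar,
    ← hμ''.hom_comp σ'' hσ'', comp_scalarMul, hμ''.comp_hom_comp]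

lemma shriek_comp (hC : IsBistable C) {ξ : A ⟶ B} {ξ' : B ⟶ D} (h : IsFredholm ξ)
    (h' : IsFredholm ξ') (h'' : IsFredholm (ξ ≫ ξ')) (υ : Cochain C) {σ : 𝟙_ C ⟶ (kernel ξ').X}
    {τ : (cokernel ξ).X ⟶ 𝟙_ C} (hσ : IsNormalizedIntegral _ σ) (hτ : IsNormalizedCointegral _ τ)
    (hυ : compScalar ξ ξ' σ τ ≫ (υ _ h'').hom = (υ _ h').hom ≫ (υ _ h).hom) :
    shriek υ (ξ ≫ ξ') h'' = shriek υ ξ' h' ≫ shriek υ ξ h := by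
  rw [shriek, shriek, shriek, scalarMul_comp, comp_scalarMul,
    fredholmIntegral_comp hC h h' h'' hσ hτ, scalarMul_inv_scalarMul_inv _ _ _ _ hυ]

/-- The volume identities play two roles: they express the new inverse volumes as quotients of
invertible scalars, which gives finiteness, and they are the cocycle conditions required by
`shriek_comp`. -/
theorem exists_isFredholm_comp (hC : IsBistable C) {ξ : A ⟶ B} {ξ' : B ⟶ D} (h : IsFredholm ξ)
    (h' : IsFredholm ξ') : ∃ h'' : IsFredholm (ξ ≫ ξ'),
      shriek (upsilonZero C) (ξ ≫ ξ') h'' =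
        shriek (upsilonZero C) ξ' h' ≫ shriek (upsilonZero C) ξ h ∧
      shriek (upsilonOne C) (ξ ≫ ξ') h'' =
        shriek (upsilonOne C) ξ' h' ≫ shriek (upsilonOne C) ξ h := by
  obtain ⟨σ, hσ⟩ := h'.ker_finiteVolume.integral
  obtain ⟨τ, hτ⟩ := h.cok_finiteVolume.cointegral
  obtain ⟨τ₁, hτ₁⟩ := h'.ker_finiteVolume.cointegral
  obtain ⟨σ₂, hσ₂⟩ := h.ker_finiteVolume.integral
  obtain ⟨τ₂, hτ₂⟩ := h.ker_finiteVolume.cointegral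
  obtain ⟨σ₃, hσ₃⟩ := h.cok_finiteVolume.integral
  obtain ⟨σ₄, hσ₄⟩ := h'.cok_finiteVolume.integral
  obtain ⟨τ₄, hτ₄⟩ := h'.cok_finiteVolume.cointegral
  have hr := isIso_compScalar hC ξ ξ' hσ hτ h'.ker_finiteVolume h.cok_finiteVolume
  obtain ⟨s, t, hs, ht, hst⟩ := exists_integrals_kernel_comp hC ξ ξ' hσ hτ hr hτ₁ hσ₂ hτ₂
  obtain ⟨s', t', hs', ht', hst'⟩ := exists_integrals_cokernel_comp hC ξ ξ' hσ hτ hr hσ₃ hσ₄ hτ₄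
  have i₁ := h'.ker_finiteVolume.isIso_comp hσ hτ₁
  have i₂ := h.ker_finiteVolume.isIso_comp hσ₂ hτ₂
  have i₃ := h.cok_finiteVolume.isIso_comp hσ₃ hτ
  have i₄ := h'.cok_finiteVolume.isIso_comp hσ₄ hτ₄
  have i₅ : IsIso (s ≫ t) := by
    rw [(IsIso.eq_inv_comp _).2 hst]
    infer_instance
  have i₆ : IsIso (s' ≫ t') := by
    rw [(IsIso.eq_inv_comp _).2 hst']
    infer_instance
  refine ⟨.of_finiteVolume (.mk' hs ht i₅) (.mk' hs' ht' i₆), shriek_comp hC h h' _ _ hσ hτ ?_,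
    shriek_comp hC h h' _ _ hσ hτ ?_⟩
  · simp only [upsilonZero]
    rw [invVolIso_hom _ hs ht, invVolIso_hom _ hσ hτ₁, invVolIso_hom _ hσ₂ hτ₂, hst]
  · simp only [upsilonOne]
    rw [invVolIso_hom _ hs' ht', invVolIso_hom _ hσ₃ hτ, invVolIso_hom _ hσ₄ hτ₄, hst']

end Composition

/-! ### Isomorphism invariance of the inverse volume -/

section Invariance

variable {C : Type u} [Category.{v} C] [MonoidalCategory C] [SymmetricCategory C]

/-- The inverse volume is invariant under isomorphisms of bicommutative Hopf monoids. -/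
lemma invVolIso_hom_eq_of_isIso {A B : HopfBC C} (f : A ⟶ B) [IsIso f] (hA : HasFiniteVolume A.X)
    (hB : HasFiniteVolume B.X) : (invVolIso A.X hA).hom = (invVolIso B.X hB).hom := by
  obtain ⟨σ, hσ⟩ := hA.integral
  obtain ⟨τ, hτ⟩ := hB.cointegral
  rw [invVolIso_hom hA hσ (hτ.mono_comp f.hom), invVolIso_hom hB (hσ.comp_epi f.hom) hτ,
    Category.assoc]

end Invariance

/-! ### Base change and part (c) -/

section BaseChange

variable {C : Type u} [Category.{v} C] [MonoidalCategory C] [SymmetricCategory C]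
  [Abelian (HopfBC C)] {A B D E : HopfBC C} {φ : A ⟶ B} {φ' : A ⟶ D} {ψ : D ⟶ E} {ψ' : B ⟶ E}

lemma kernelMap_hom (w : φ ≫ ψ' = φ' ≫ ψ) :
    (kernel.map φ ψ φ' ψ' w).hom ≫ (kernel.ι ψ).hom = (kernel.ι φ).hom ≫ φ'.hom := by
  rw [← HopfBC.comp_hom, ← HopfBC.comp_hom, kernel.lift_ι]

lemma cokernelMap_hom (w : φ ≫ ψ' = φ' ≫ ψ) :
    (cokernel.π φ).hom ≫ (cokernel.map φ ψ φ' ψ' w).hom = ψ'.hom ≫ (cokernel.π ψ).hom := by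
  rw [← HopfBC.comp_hom, ← HopfBC.comp_hom, cokernel.π_desc]

variable [HasEqualizers C] [HasCoequalizers C]

/-- Both sides equal the zigzag through `φ'`, `ψ` and the two integrals. Averaging over Ker ψ can be
done with the integral pushed forward from Ker φ, and contraction by Cok φ with the cointegral
pulled back from Cok ψ, so each is absorbed by the adjacent integral. -/
theorem fredholmIntegral_baseChange (hC : IsBistable C) (w : φ ≫ ψ' = φ' ≫ ψ)
    (hφ : IsFredholm φ) (hψ : IsFredholm ψ) [Epi (kernel.map φ ψ φ' ψ' w)]
    [Mono (cokernel.map φ ψ φ' ψ' w)] :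
    fredholmIntegral φ ≫ φ'.hom = ψ'.hom ≫ fredholmIntegral ψ := by
  have hμ := hφ.isMuAlong hC
  have hν := hψ.isMuAlong hC
  have hw : φ.hom ≫ ψ'.hom = φ'.hom ≫ ψ.hom := by
    rw [← HopfBC.comp_hom, w, HopfBC.comp_hom]
  have := HopfBC.epi_hom hC (kernel.map φ ψ φ' ψ' w)
  have := HopfBC.mono_hom hC (cokernel.map φ ψ φ' ψ' w)
  obtain ⟨σ, hσ⟩ := hφ.ker_finiteVolume.integral
  obtain ⟨τ, hτ⟩ := hψ.cok_finiteVolume.cointegral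
  have hσ' := hσ.comp_epi (kernel.map φ ψ φ' ψ' w).hom
  have hτ' := hτ.mono_comp (cokernel.map φ ψ φ' ψ' w).hom
  have h₁ : fredholmIntegral φ ≫ φ'.hom ≫ ψ.hom ≫ fredholmIntegral ψ =
      fredholmIntegral φ ≫ φ'.hom := by
    rw [hν.hom_comp _ hσ', Category.assoc, kernelMap_hom, ← Category.assoc σ, ← lmul_comp_hom,
      ← hμ.hom_comp σ hσ]
    simp only [Category.assoc]
    rw [reassoc_of% hμ.comp_hom_comp]
  have h₂ : fredholmIntegral φ ≫ φ'.hom ≫ ψ.hom ≫ fredholmIntegral ψ =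
      ψ'.hom ≫ fredholmIntegral ψ := by
    rw [← reassoc_of% hw, reassoc_of% hμ.comp_hom _ hτ', reassoc_of% cokernelMap_hom w,
      ← comp_rcomul_assoc, ← hν.comp_hom τ hτ, Category.assoc, hν.comp_hom_comp]
  rw [← h₁, h₂]

lemma shriek_baseChange (hC : IsBistable C) (w : φ ≫ ψ' = φ' ≫ ψ) (hφ : IsFredholm φ)
    (hψ : IsFredholm ψ) [Epi (kernel.map φ ψ φ' ψ' w)] [Mono (cokernel.map φ ψ φ' ψ' w)]
    (υ : Cochain C) (hυ : (υ φ hφ).hom = (υ ψ hψ).hom) :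
    shriek υ φ hφ ≫ φ'.hom = ψ'.hom ≫ shriek υ ψ hψ := by
  rw [shriek, shriek, scalarMul_comp, comp_scalarMul, fredholmIntegral_baseChange hC w hφ hψ,
    Iso.ext hυ]

end BaseChange

end HopfIntegral

theorem theorem201908011123 {C : Type u} [Category.{v} C] [MonoidalCategory C]
    [SymmetricCategory C] [HasEqualizers C] [HasCoequalizers C]
    (hC : HopfIntegral.IsBistable C) [Abelian (HopfIntegral.HopfBC C)] :
    -- the morphism `μ_ξ` is the normalized generator integral along `ξ`
    (∀ (A B : HopfIntegral.HopfBC C) (ξ : A ⟶ B), HopfIntegral.IsFredholm ξ →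
      ∀ m : B.X ⟶ A.X, HopfIntegral.IsNormalizedGeneratorIntegral ξ.hom m ↔
        m = HopfIntegral.fredholmIntegral ξ) ∧
    -- functoriality
    (∀ (A B D : HopfIntegral.HopfBC C) (ξ : A ⟶ B) (ξ' : B ⟶ D)
      (h : HopfIntegral.IsFredholm ξ) (h' : HopfIntegral.IsFredholm ξ'),
      ∃ h'' : HopfIntegral.IsFredholm (ξ ≫ ξ'),
        HopfIntegral.shriek (HopfIntegral.upsilonZero C) (ξ ≫ ξ') h'' =
          HopfIntegral.shriek (HopfIntegral.upsilonZero C) ξ' h' ≫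
            HopfIntegral.shriek (HopfIntegral.upsilonZero C) ξ h ∧
        HopfIntegral.shriek (HopfIntegral.upsilonOne C) (ξ ≫ ξ') h'' =
          HopfIntegral.shriek (HopfIntegral.upsilonOne C) ξ' h' ≫
            HopfIntegral.shriek (HopfIntegral.upsilonOne C) ξ h) ∧
    -- base change along a commutative square
    (∀ (A B D E : HopfIntegral.HopfBC C) (φ : A ⟶ B) (φ' : A ⟶ D) (ψ : D ⟶ E) (ψ' : B ⟶ E)
      (w : φ ≫ ψ' = φ' ≫ ψ)
      (hφ : HopfIntegral.IsFredholm φ) (hψ : HopfIntegral.IsFredholm ψ),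
      (IsIso (kernel.map φ ψ φ' ψ' w) → Mono (cokernel.map φ ψ φ' ψ' w) →
        HopfIntegral.shriek (HopfIntegral.upsilonZero C) φ hφ ≫ φ'.hom =
          ψ'.hom ≫ HopfIntegral.shriek (HopfIntegral.upsilonZero C) ψ hψ) ∧
      (Epi (kernel.map φ ψ φ' ψ' w) → IsIso (cokernel.map φ ψ φ' ψ' w) →
        HopfIntegral.shriek (HopfIntegral.upsilonOne C) φ hφ ≫ φ'.hom =
          ψ'.hom ≫ HopfIntegral.shriek (HopfIntegral.upsilonOne C) ψ hψ)) := by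
  refine ⟨fun A B ξ hξ m => HopfIntegral.isNormalizedGeneratorIntegral_iff hC hξ m,
    fun A B D ξ ξ' h h' => HopfIntegral.exists_isFredholm_comp hC h h',
    fun A B D E φ φ' ψ ψ' w hφ hψ => ⟨fun _ _ => ?_, fun _ _ => ?_⟩⟩
  · exact HopfIntegral.shriek_baseChange hC w hφ hψ _
      (HopfIntegral.invVolIso_hom_eq_of_isIso (kernel.map φ ψ φ' ψ' w) _ _)
  · exact HopfIntegral.shriek_baseChange hC w hφ hψ _
      (HopfIntegral.invVolIso_hom_eq_of_isIso (cokernel.map φ ψ φ' ψ' w) _ _)
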